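/- Let $n\ge 2$ and let $(M,g)$ be a smooth compact $n$-dimensional Riemannian manifold without boundary (not necessarily connected), with Riemannian measure $\mathrm{dvol}_g$ and volume $\mathrm{Vol}_g$. Let $H^1(M)$ be the space of functions $u\in L^2(M)$ whose weak gradient $\nabla^g u$ is in $L^2$, with $\|u\|_{H^1}^2=\int_M u^2\,\mathrm{dvol}_g+\int_M\|\nabla^g u\|_g^2\,\mathrm{dvol}_g$, and let $H^1_0(M)$ be the closure of $C^\infty_c(M)$ in $H^1(M)$. For $A\subset M$ put $$\mathrm{cap}_g(A)=\inf\{\|u\|_{H^1}^2:\ u\in H^1(M),\ u\ge 1 \text{ a.e. in a neighborhood of } A\}.$$ A property holds quasi-everywhere (q.e.) if it holds outside a set of capacity $0$. A set $\Omega\subset M$ is quasi-open if for every $\varepsilon>0$ there is an open set $\omega$ with $\mathrm{cap}_g(\omega)<\varepsilon$ and $\Omega\cup\omega$ open. For a quasi-open set $\Omega$ let $$H^1_0(\Omega)=\{u\in H^1_0(M):\ u=0 \text{ q.e. on } M\setminus\Omega\}$$ (where $u$ is represented by its quasi-continuous representative, i.e. one that for every $\varepsilon>0$ is continuous off some open set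 of capacity less than $\varepsilon$), and let $$\lambda_1(\Omega)=\inf\left\{\frac{\int_\Omega\|\nabla^g u\|_g^2\,\mathrm{dvol}_g}{\int_\Omega u^2\,\mathrm{dvol}_g}:\ u\in H^1_0(\Omega),\ u\ne 0\right\}$$ be the first Dirichlet eigenvalue of the Laplace–Beltrami operator in $\Omega$ (with $\inf\emptyset=+\infty$). **Theorem (Existence).** For every $m\in(0,\mathrm{Vol}_g(M))$ there is a quasi-open set $\Omega^*\subset M$ with $\mathrm{Vol}_g(\Omega^*)=m$ such that $\lambda_1(\Omega^*)$ is finite, the infimum that defines it is attained, and $$\lambda_1(\Omega^*)=\min\{\lambda_1(\Omega):\ \Omega \text{ quasi-open subset of } M,\ \mathrm{Vol}_g(\Omega)=m\}.$$ -/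

import Mathlib

open MeasureTheory Set Bundle Manifold
open scoped ENNReal ContDiff Topology Manifold

noncomputable section

namespace FaberKrahn

variable (n : ℕ) {M : Type*} [TopologicalSpace M] [ChartedSpace (EuclideanSpace ℝ (Fin n)) M]

/-- The image under `d(e⁻¹)` at the point `y` of the chart `e` of the constant vector `v`. For `v`
the `i`-th vector of the standard basis this is the coordinate vector field `∂ᵢ` at `e⁻¹ y`. -/
def coordVec (e : OpenPartialHomeomorph M (EuclideanSpace ℝ (Fin n)))
    (y v : EuclideanSpace ℝ (Fin n)) : TangentSpace (𝓡 n) (e.symm y) :=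
  mfderiv (𝓡 n) (𝓡 n) e.symm y v

variable [RiemannianBundle (fun p : M ↦ TangentSpace (𝓡 n) p)]

/-- The matrix `G = (g(∂ᵢ, ∂ⱼ))` of the metric in the chart `e`, at the point `y` of the chart. -/
def metricMatrix (e : OpenPartialHomeomorph M (EuclideanSpace ℝ (Fin n)))
    (y : EuclideanSpace ℝ (Fin n)) : Matrix (Fin n) (Fin n) ℝ :=
  Matrix.of fun i j ↦ inner ℝ (coordVec n e y (EuclideanSpace.single i 1))
    (coordVec n e y (EuclideanSpace.single j 1))

/-- `X` is a weak gradient of `u`: in every chart `e`, the weak derivative of `u ∘ e⁻¹` in the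
direction `v` is the (locally integrable) function `y ↦ g(X, d(e⁻¹) v)`. -/
structure IsWeakGradient (u : M → ℝ) (X : (p : M) → TangentSpace (𝓡 n) p) : Prop where
  locallyIntegrableOn : ∀ e ∈ atlas (EuclideanSpace ℝ (Fin n)) M,
    LocallyIntegrableOn (fun y ↦ u (e.symm y)) e.target volume
  locallyIntegrableOn_inner : ∀ e ∈ atlas (EuclideanSpace ℝ (Fin n)) M,
    ∀ v : EuclideanSpace ℝ (Fin n),
      LocallyIntegrableOn (fun y ↦ inner ℝ (X (e.symm y)) (coordVec n e y v)) e.target volume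
  integral_eq : ∀ e ∈ atlas (EuclideanSpace ℝ (Fin n)) M, ∀ v : EuclideanSpace ℝ (Fin n),
    ∀ φ : EuclideanSpace ℝ (Fin n) → ℝ, ContDiff ℝ ∞ φ → HasCompactSupport φ →
      tsupport φ ⊆ e.target →
      ∫ y in e.target, u (e.symm y) * fderiv ℝ φ y v =
        - ∫ y in e.target, inner ℝ (X (e.symm y)) (coordVec n e y v) * φ y

open Classical in
/-- The weak gradient of `u`, which is unique up to almost everywhere equality (and `0` if `u` has
no weak gradient). -/
def weakGrad (u : M → ℝ) : (p : M) → TangentSpace (𝓡 n) p :=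
  if h : ∃ X, IsWeakGradient n u X then h.choose else fun _ ↦ 0

variable [MeasurableSpace M]

/-- The measure `√|g| dx` in the chart `e`, seen as a measure on `M` carried by `e.source`. -/
def chartVolume (e : OpenPartialHomeomorph M (EuclideanSpace ℝ (Fin n))) : Measure M :=
  ((volume.restrict e.target).withDensity
    (fun y ↦ ENNReal.ofReal (Real.sqrt (metricMatrix n e y).det))).map e.symm

variable (M) in
/-- The Riemannian volume measure `dvol_g`. The measures `√|g| dx` of two charts agree on the
intersection of their domains, so that their supremum in the lattice of measures is the measure
that is given by `√|g| dx` in every chart. -/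
def vol : Measure M :=
  ⨆ e ∈ atlas (EuclideanSpace ℝ (Fin n)) M, chartVolume n e

/-- `u` belongs to `H¹(M)`: it is in `L²(M)`, and so is its weak gradient. -/
def MemH1 (u : M → ℝ) : Prop :=
  MemLp u 2 (vol n M) ∧
    ∃ X, IsWeakGradient n u X ∧ MemLp (fun p ↦ ‖X p‖) 2 (vol n M)

/-- `‖u‖²_{H¹} = ∫ u² dvol_g + ∫ ‖∇u‖² dvol_g`, for `u` in `H¹(M)`. -/
def h1NormSq (u : M → ℝ) : ℝ≥0∞ :=
  (∫⁻ p, ‖u p‖ₑ ^ 2 ∂(vol n M)) + ∫⁻ p, ‖weakGrad n u p‖ₑ ^ 2 ∂(vol n M)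

/-- The capacity `cap_g(A)`: the infimum of `‖u‖²_{H¹}` among the functions `u` in `H¹(M)` with
`u ≥ 1` almost everywhere in a neighborhood of `A`. -/
def cap (A : Set M) : ℝ≥0∞ :=
  ⨅ (u : M → ℝ) (_ : MemH1 n u ∧ ∃ U : Set M, IsOpen U ∧ A ⊆ U ∧
    ∀ᵐ p ∂(vol n M), p ∈ U → 1 ≤ u p), h1NormSq n u

/-- `Ω` is quasi-open: it becomes open after adding an open set of arbitrarily small capacity. -/
def QuasiOpen (Ω : Set M) : Prop :=
  ∀ ε : ℝ≥0∞, 0 < ε → ∃ W : Set M, IsOpen W ∧ cap n W < ε ∧ IsOpen (Ω ∪ W)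

/-- `u` is quasi-continuous: it is continuous off an open set of arbitrarily small capacity. -/
def QuasiContinuous (u : M → ℝ) : Prop :=
  ∀ ε : ℝ≥0∞, 0 < ε → ∃ W : Set M, IsOpen W ∧ cap n W < ε ∧ ContinuousOn u Wᶜ

/-- `u` belongs to `H¹₀(M)`, the closure of `C_c^∞(M)` in `H¹(M)`. -/
def MemH10 (u : M → ℝ) : Prop :=
  MemH1 n u ∧ ∀ ε : ℝ≥0∞, 0 < ε → ∃ φ : M → ℝ,
    ContMDiff (𝓡 n) 𝓘(ℝ, ℝ) ∞ φ ∧ HasCompactSupport φ ∧ h1NormSq n (fun p ↦ u p - φ p) < ε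

/-- `u` belongs to `H¹₀(Ω)`: it is in `H¹₀(M)` and vanishes quasi-everywhere on `M ∖ Ω`. As usual,
a statement that holds quasi-everywhere is about the quasi-continuous representative of `u`. -/
def MemH10On (Ω : Set M) (u : M → ℝ) : Prop :=
  MemH10 n u ∧ ∃ w : M → ℝ, w =ᵐ[vol n M] u ∧ QuasiContinuous n w ∧ cap n {p | p ∉ Ω ∧ w p ≠ 0} = 0

/-- The Rayleigh quotient `∫_Ω ‖∇u‖² dvol_g / ∫_Ω u² dvol_g`. -/
def rayleigh (Ω : Set M) (u : M → ℝ) : ℝ≥0∞ :=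
  (∫⁻ p in Ω, ‖weakGrad n u p‖ₑ ^ 2 ∂(vol n M)) / ∫⁻ p in Ω, ‖u p‖ₑ ^ 2 ∂(vol n M)

/-- `λ₁(Ω)`: the infimum of the Rayleigh quotients of the nonzero elements of `H¹₀(Ω)`. -/
def lambda1 (Ω : Set M) : ℝ≥0∞ :=
  ⨅ (u : M → ℝ) (_ : MemH10On n Ω u ∧ ¬ u =ᵐ[vol n M] 0), rayleigh n Ω u

end FaberKrahn

end

/-!
The proof is by the direct method. Let `Λ` be the infimum of `λ₁(Ω)` over the quasi-open sets `Ω` of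
volume `m`. It is finite, because there are smooth functions supported in open sets of small volume
(`exists_isOpen_contMDiff_support`) and the volume of a set can be increased to exactly `m` by adding
an open set (`exists_isOpen_vol_union_eq`).

Take functions `vₖ` of `L²` norm `1` that vanish outside sets of volume `m` and whose energies
`∫ ‖∇vₖ‖²` tend to `Λ`, together with smooth functions `ψₖ` close to them in `H¹`
(`exists_smooth_near_of_rayleigh_lt`). By Rellich's theorem (`exists_subseq_tendsto_L2`) a subsequence
converges in `L²` and almost everywhere. Its limit `u` has norm `1`, and `{u ≠ 0}` has volume at most
`m` (`measure_ne_zero_le_of_tendsto`). Convex combinations of the tails of `(ψₖ)` with almost minimal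
energy are Cauchy in `H¹` by the parallelogram identity, so that `u` is an `H¹` limit of smooth
functions, of energy at most `Λ` (`exists_h1_limit_of_energy_le`). A fast converging subsequence
converges uniformly off open sets of small capacity (`exists_quasiContinuous_limit`), which gives a
quasi-continuous representative `w` of `u`. The set `{w ≠ 0}` is then quasi-open, and adding an open
set to it makes its volume equal to `m` without losing `w ∈ H¹₀(Ω)`. So the Rayleigh quotient of `w`
is at most `Λ`, hence equal to `Λ` and to `λ₁`.

The Rayleigh quotient of `u ∈ H¹₀(Ω)` is defined by integrals over `Ω`. They agree with the integrals
over `M`, since the gradient of `u` vanishes almost everywhere on `{u = 0}`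
(`weakGradient_ae_eq_zero`).

Rellich's theorem is reduced by a finite cover by coordinate balls to the Euclidean case, which
follows from the Poincaré inequality on small cubes (`lintegral_enorm_sq_le_poincare`): up to a small
error in `L²`, a bounded subset of `H¹` is described by finitely many rounded averages
(`exists_finite_discretization`).
-/

open scoped NNReal

set_option linter.unusedSectionVars false

noncomputable section

namespace FaberKrahn

/-! ### The metric in coordinates -/

section ChartGeometry

variable {n : ℕ} {M : Type*} [TopologicalSpace M] [ChartedSpace (EuclideanSpace ℝ (Fin n)) M]

theorem continuousOn_tangent_coordVec [IsManifold (𝓡 n) ∞ M]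
    {e : OpenPartialHomeomorph M (EuclideanSpace ℝ (Fin n))}
    (he : e ∈ atlas (EuclideanSpace ℝ (Fin n)) M) (v : EuclideanSpace ℝ (Fin n)) :
    ContinuousOn (fun y ↦ (⟨e.symm y, coordVec n e y v⟩ : TangentBundle (𝓡 n) M)) e.target := by
  have h1 : ContMDiffOn (𝓡 n) (𝓡 n) ∞ e.symm e.target :=
    contMDiffOn_symm_of_mem_maximalAtlas (IsManifold.subset_maximalAtlas he)
  have h2 := h1.continuousOn_tangentMapWithin (by simp) e.open_target.uniqueMDiffOn
  have h3 : Continuous (fun y : EuclideanSpace ℝ (Fin n) ↦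
      (⟨y, v⟩ : TangentBundle (𝓡 n) (EuclideanSpace ℝ (Fin n)))) := by
    exact (tangentBundleModelSpaceHomeomorph (𝓡 n)).symm.continuous.comp
      (Continuous.prodMk_left v)
  have h4 := h2.comp h3.continuousOn (s := e.target) (fun y hy ↦ hy)
  refine h4.congr fun y hy ↦ ?_
  simp only [Function.comp, tangentMapWithin, coordVec]
  rw [mfderivWithin_of_isOpen e.open_target hy]

theorem coordVec_smul (e : OpenPartialHomeomorph M (EuclideanSpace ℝ (Fin n)))
    (y v : EuclideanSpace ℝ (Fin n)) (c : ℝ) :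
    coordVec n e y (c • v) = c • coordVec n e y v :=
  map_smul (mfderiv (𝓡 n) (𝓡 n) e.symm y) c v

theorem coordVec_bijective [IsManifold (𝓡 n) ∞ M]
    {e : OpenPartialHomeomorph M (EuclideanSpace ℝ (Fin n))}
    (he : e ∈ atlas (EuclideanSpace ℝ (Fin n)) M) {y : EuclideanSpace ℝ (Fin n)}
    (hy : y ∈ e.target) : Function.Bijective (coordVec n e y) :=
  have : IsManifold (𝓡 n) 1 M := IsManifold.of_le (n := ∞) (by simp)
  (mdifferentiable_of_mem_atlas (I := 𝓡 n) he).symm.mfderiv_bijective hy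

variable [RiemannianBundle (fun p : M ↦ TangentSpace (𝓡 n) p)]

theorem continuousOn_inner_coordVec [IsManifold (𝓡 n) ∞ M]
    [IsContMDiffRiemannianBundle (𝓡 n) ∞ (EuclideanSpace ℝ (Fin n))
      (fun p : M ↦ TangentSpace (𝓡 n) p)]
    {e : OpenPartialHomeomorph M (EuclideanSpace ℝ (Fin n))}
    (he : e ∈ atlas (EuclideanSpace ℝ (Fin n)) M) (v w : EuclideanSpace ℝ (Fin n)) :
    ContinuousOn (fun y ↦ inner ℝ (coordVec n e y v) (coordVec n e y w)) e.target := by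
  have : IsContinuousRiemannianBundle (EuclideanSpace ℝ (Fin n))
      (fun p : M ↦ TangentSpace (𝓡 n) p) := by
    obtain ⟨g, hg, h⟩ := IsContMDiffRiemannianBundle.exists_contMDiff (IB := 𝓡 n) (n := ∞)
      (F := EuclideanSpace ℝ (Fin n)) (E := fun p : M ↦ TangentSpace (𝓡 n) p)
    exact ⟨g, hg.continuous, h⟩
  exact ContinuousOn.inner_bundle (F := EuclideanSpace ℝ (Fin n))
    (E := fun p : M ↦ TangentSpace (𝓡 n) p) (continuousOn_tangent_coordVec he v)
    (continuousOn_tangent_coordVec he w)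

theorem coordVec_eq_sum (e : OpenPartialHomeomorph M (EuclideanSpace ℝ (Fin n)))
    (y v : EuclideanSpace ℝ (Fin n)) :
    coordVec n e y v = ∑ i, v i • coordVec n e y (EuclideanSpace.single i 1) := by
  have h : v = ∑ i, v i • EuclideanSpace.single i (1 : ℝ) := by
    ext j
    simp [Pi.single_apply]
  conv_lhs => rw [h]
  exact (map_sum (mfderiv (𝓡 n) (𝓡 n) e.symm y) _ _).trans
    (Finset.sum_congr rfl fun i _ ↦ coordVec_smul e y _ _)

theorem metricMatrix_mulVec (e : OpenPartialHomeomorph M (EuclideanSpace ℝ (Fin n)))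
    (y v : EuclideanSpace ℝ (Fin n)) :
    Matrix.mulVec (metricMatrix n e y) (fun i ↦ v i) =
      fun i ↦ inner ℝ (coordVec n e y v) (coordVec n e y (EuclideanSpace.single i 1)) := by
  ext i
  rw [coordVec_eq_sum e y v, sum_inner]
  simp only [Matrix.mulVec, dotProduct, metricMatrix, Matrix.of_apply, real_inner_smul_left]
  refine Finset.sum_congr rfl fun j _ ↦ ?_
  rw [real_inner_comm, mul_comm]

theorem dotProduct_metricMatrix_mulVec (e : OpenPartialHomeomorph M (EuclideanSpace ℝ (Fin n)))
    (y v : EuclideanSpace ℝ (Fin n)) :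
    (fun i ↦ v i) ⬝ᵥ Matrix.mulVec (metricMatrix n e y) (fun i ↦ v i) =
      ‖coordVec n e y v‖ ^ 2 := by
  rw [metricMatrix_mulVec, ← real_inner_self_eq_norm_sq]
  conv_rhs => rw [coordVec_eq_sum e y v, inner_sum]
  simp only [dotProduct, real_inner_smul_right]
  refine Finset.sum_congr rfl fun j _ ↦ ?_
  rw [← coordVec_eq_sum e y v]

theorem posDef_metricMatrix [IsManifold (𝓡 n) ∞ M]
    {e : OpenPartialHomeomorph M (EuclideanSpace ℝ (Fin n))}
    (he : e ∈ atlas (EuclideanSpace ℝ (Fin n)) M) {y : EuclideanSpace ℝ (Fin n)}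
    (hy : y ∈ e.target) : (metricMatrix n e y).PosDef := by
  refine Matrix.PosDef.of_dotProduct_mulVec_pos ?_ fun x hx ↦ ?_
  · ext i j
    simp [metricMatrix, real_inner_comm]
  · have h := dotProduct_metricMatrix_mulVec e y (WithLp.toLp 2 x)
    simp only [star_trivial]
    refine lt_of_lt_of_eq ?_ h.symm
    have h0 : coordVec n e y (WithLp.toLp 2 x) ≠ 0 := by
      intro h1
      have h2 : coordVec n e y 0 = 0 := map_zero (mfderiv (𝓡 n) (𝓡 n) e.symm y)
      exact hx (by simpa using (coordVec_bijective he hy).1 (h1.trans h2.symm))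
    positivity

theorem det_metricMatrix_pos [IsManifold (𝓡 n) ∞ M]
    {e : OpenPartialHomeomorph M (EuclideanSpace ℝ (Fin n))}
    (he : e ∈ atlas (EuclideanSpace ℝ (Fin n)) M) {y : EuclideanSpace ℝ (Fin n)}
    (hy : y ∈ e.target) : 0 < (metricMatrix n e y).det :=
  (posDef_metricMatrix he hy).det_pos

/-- The squared norm of a tangent vector, from its inner products with the coordinate fields. -/
theorem norm_sq_eq_dotProduct_inv [IsManifold (𝓡 n) ∞ M]
    {e : OpenPartialHomeomorph M (EuclideanSpace ℝ (Fin n))}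
    (he : e ∈ atlas (EuclideanSpace ℝ (Fin n)) M) {y : EuclideanSpace ℝ (Fin n)}
    (hy : y ∈ e.target) (Z : TangentSpace (𝓡 n) (e.symm y)) :
    ‖Z‖ ^ 2 = (fun i ↦ inner ℝ Z (coordVec n e y (EuclideanSpace.single i 1))) ⬝ᵥ
      Matrix.mulVec (metricMatrix n e y)⁻¹
        (fun i ↦ inner ℝ Z (coordVec n e y (EuclideanSpace.single i 1))) := by
  obtain ⟨v, rfl⟩ := (coordVec_bijective he hy).2 Z
  rw [← metricMatrix_mulVec, Matrix.mulVec_mulVec, Matrix.nonsing_inv_mul _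
    (det_metricMatrix_pos he hy).ne'.isUnit, Matrix.one_mulVec, dotProduct_comm,
    dotProduct_metricMatrix_mulVec]

theorem continuousOn_metricMatrix [IsManifold (𝓡 n) ∞ M]
    [IsContMDiffRiemannianBundle (𝓡 n) ∞ (EuclideanSpace ℝ (Fin n))
      (fun p : M ↦ TangentSpace (𝓡 n) p)]
    {e : OpenPartialHomeomorph M (EuclideanSpace ℝ (Fin n))}
    (he : e ∈ atlas (EuclideanSpace ℝ (Fin n)) M) :
    ContinuousOn (metricMatrix n e) e.target :=
  continuousOn_pi.2 fun _ ↦ continuousOn_pi.2 fun _ ↦ continuousOn_inner_coordVec he _ _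

theorem continuousOn_det_metricMatrix [IsManifold (𝓡 n) ∞ M]
    [IsContMDiffRiemannianBundle (𝓡 n) ∞ (EuclideanSpace ℝ (Fin n))
      (fun p : M ↦ TangentSpace (𝓡 n) p)]
    {e : OpenPartialHomeomorph M (EuclideanSpace ℝ (Fin n))}
    (he : e ∈ atlas (EuclideanSpace ℝ (Fin n)) M) :
    ContinuousOn (fun y ↦ (metricMatrix n e y).det) e.target :=
  (Continuous.matrix_det continuous_id).comp_continuousOn (continuousOn_metricMatrix he)

theorem continuousOn_inv_metricMatrix [IsManifold (𝓡 n) ∞ M]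
    [IsContMDiffRiemannianBundle (𝓡 n) ∞ (EuclideanSpace ℝ (Fin n))
      (fun p : M ↦ TangentSpace (𝓡 n) p)]
    {e : OpenPartialHomeomorph M (EuclideanSpace ℝ (Fin n))}
    (he : e ∈ atlas (EuclideanSpace ℝ (Fin n)) M) :
    ContinuousOn (fun y ↦ (metricMatrix n e y)⁻¹) e.target := by
  have h : (fun y ↦ (metricMatrix n e y)⁻¹) =
      fun y ↦ (metricMatrix n e y).det⁻¹ • (metricMatrix n e y).adjugate := by
    ext1 y
    rw [Matrix.inv_def, Ring.inverse_eq_inv']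
  rw [h]
  exact ((continuousOn_det_metricMatrix he).inv₀ fun y hy ↦ (det_metricMatrix_pos he hy).ne').smul
    ((Continuous.matrix_adjugate continuous_id).comp_continuousOn (continuousOn_metricMatrix he))

theorem continuousOn_norm_coordVec [IsManifold (𝓡 n) ∞ M]
    [IsContMDiffRiemannianBundle (𝓡 n) ∞ (EuclideanSpace ℝ (Fin n))
      (fun p : M ↦ TangentSpace (𝓡 n) p)]
    {e : OpenPartialHomeomorph M (EuclideanSpace ℝ (Fin n))}
    (he : e ∈ atlas (EuclideanSpace ℝ (Fin n)) M) (v : EuclideanSpace ℝ (Fin n)) :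
    ContinuousOn (fun y ↦ ‖coordVec n e y v‖) e.target := by
  refine (continuousOn_inner_coordVec he v v).sqrt.congr fun y _ ↦ ?_
  simp only [real_inner_self_eq_norm_sq, Real.sqrt_sq (norm_nonneg _)]

/-- The chain rule for coordinate fields: the transition map `τ = e ∘ e'⁻¹` relates the
coordinate fields of two charts. -/
theorem coordVec_transition [IsManifold (𝓡 n) ∞ M]
    {e e' : OpenPartialHomeomorph M (EuclideanSpace ℝ (Fin n))}
    (he : e ∈ atlas (EuclideanSpace ℝ (Fin n)) M) (he' : e' ∈ atlas (EuclideanSpace ℝ (Fin n)) M)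
    {y : EuclideanSpace ℝ (Fin n)} (hy : y ∈ e'.target) (hy' : e'.symm y ∈ e.source) :
    HasFDerivAt (fun z ↦ e (e'.symm z)) (fderiv ℝ (fun z ↦ e (e'.symm z)) y) y ∧
    ∀ v w, (inner ℝ (coordVec n e' y v) (coordVec n e' y w) : ℝ) =
      inner ℝ (coordVec n e (e (e'.symm y)) (fderiv ℝ (fun z ↦ e (e'.symm z)) y v))
        (coordVec n e (e (e'.symm y)) (fderiv ℝ (fun z ↦ e (e'.symm z)) y w)) := by
  have : IsManifold (𝓡 n) 1 M := IsManifold.of_le (n := ∞) (by simp)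
  have h1 : MDifferentiableAt (𝓡 n) (𝓡 n) e'.symm y := mdifferentiableAt_atlas_symm he' hy
  have h2 : MDifferentiableAt (𝓡 n) (𝓡 n) e (e'.symm y) := mdifferentiableAt_atlas he hy'
  have h3 : MDifferentiableAt (𝓡 n) (𝓡 n) (fun z ↦ e (e'.symm z)) y := h2.comp y h1
  have h4 : DifferentiableAt ℝ (fun z ↦ e (e'.symm z)) y := h3.differentiableAt
  refine ⟨h4.hasFDerivAt, ?_⟩
  have h5 : MDifferentiableAt (𝓡 n) (𝓡 n) e.symm (e (e'.symm y)) :=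
    mdifferentiableAt_atlas_symm he (e.map_source hy')
  have h6 : (e.symm ∘ fun z ↦ e (e'.symm z)) =ᶠ[𝓝 y] e'.symm := by
    have : e'.symm ⁻¹' e.source ∈ 𝓝 y :=
      (e'.continuousAt_symm hy).preimage_mem_nhds (e.open_source.mem_nhds hy')
    filter_upwards [this] with z hz
    exact e.left_inv hz
  have h7 := mfderiv_comp y h5 h3
  rw [h6.mfderiv_eq, mfderiv_eq_fderiv] at h7
  -- The base points `e⁻¹ (τ y)` and `e'⁻¹ y` are equal, but not by definition.
  have key : ∀ p : M, p = e'.symm y → ∀ (a b : TangentSpace (𝓡 n) (e'.symm y))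
      (c d : TangentSpace (𝓡 n) p), (show EuclideanSpace ℝ (Fin n) from a) = c →
      (show EuclideanSpace ℝ (Fin n) from b) = d → (inner ℝ a b : ℝ) = inner ℝ c d := by
    rintro p rfl a b c d rfl rfl
    rfl
  intro v w
  exact key _ (e.left_inv hy') _ _ _ _ (DFunLike.congr_fun h7 v) (DFunLike.congr_fun h7 w)

end ChartGeometry

/-! ### The Riemannian volume in coordinates -/

section Volume

theorem measurableSet_inter_preimage_of_continuousOn {X Y : Type*} [TopologicalSpace X]
    [MeasurableSpace X] [BorelSpace X] [TopologicalSpace Y] [MeasurableSpace Y] [BorelSpace Y]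
    {f : X → Y} {s : Set X} {t : Set Y} (hf : ContinuousOn f s) (hs : MeasurableSet s)
    (ht : MeasurableSet t) : MeasurableSet (s ∩ f ⁻¹' t) := by
  have h := hs.subtype_image ((continuousOn_iff_continuous_domRestrict.1 hf).measurable ht)
  convert! h using 1
  ext x
  simp only [Set.mem_inter_iff, Set.mem_preimage, Set.mem_image, Subtype.exists]
  constructor
  · rintro ⟨h1, h2⟩
    exact ⟨x, h1, h2, rfl⟩
  · rintro ⟨a, h1, h2, rfl⟩
    exact ⟨h1, h2⟩

variable {n : ℕ} {M : Type*} [TopologicalSpace M] [ChartedSpace (EuclideanSpace ℝ (Fin n)) M]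
  [MeasurableSpace M] [BorelSpace M]

theorem aemeasurable_chart_symm (e : OpenPartialHomeomorph M (EuclideanSpace ℝ (Fin n))) :
    AEMeasurable e.symm (volume.restrict e.target) :=
  e.continuousOn_symm.aemeasurable e.open_target.measurableSet

theorem aemeasurable_chart_symm_of_subset (e : OpenPartialHomeomorph M (EuclideanSpace ℝ (Fin n)))
    {K : Set (EuclideanSpace ℝ (Fin n))} (hK : K ⊆ e.target) :
    AEMeasurable e.symm (volume.restrict K) :=
  (aemeasurable_chart_symm e).mono_measure (Measure.restrict_mono hK le_rfl)

theorem image_symm_eq (e : OpenPartialHomeomorph M (EuclideanSpace ℝ (Fin n)))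
    {K : Set (EuclideanSpace ℝ (Fin n))} (hK : K ⊆ e.target) :
    e.symm '' K = e.source ∩ e ⁻¹' K :=
  e.symm_image_eq_source_inter_preimage hK

theorem measurableSet_image_symm (e : OpenPartialHomeomorph M (EuclideanSpace ℝ (Fin n)))
    {K : Set (EuclideanSpace ℝ (Fin n))} (hK : K ⊆ e.target) (hm : MeasurableSet K) :
    MeasurableSet (e.symm '' K) := by
  rw [image_symm_eq e hK]
  exact measurableSet_inter_preimage_of_continuousOn e.continuousOn e.open_source.measurableSet hm

variable [RiemannianBundle (fun p : M ↦ TangentSpace (𝓡 n) p)]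

/-- The density `√|g|` of the Riemannian volume in the chart `e`. -/
def chartDensity (e : OpenPartialHomeomorph M (EuclideanSpace ℝ (Fin n)))
    (y : EuclideanSpace ℝ (Fin n)) : ℝ≥0∞ :=
  ENNReal.ofReal (Real.sqrt (metricMatrix n e y).det)

theorem chartVolume_apply (e : OpenPartialHomeomorph M (EuclideanSpace ℝ (Fin n)))
    {s : Set M} (hs : MeasurableSet s) :
    chartVolume n e s = ∫⁻ y in e.target ∩ e.symm ⁻¹' s, chartDensity e y := by
  have h : AEMeasurable e.symm ((volume.restrict e.target).withDensity (chartDensity e)) :=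
    (aemeasurable_chart_symm e).mono_ac (withDensity_absolutelyContinuous _ _)
  rw [chartVolume]
  erw [Measure.map_apply_of_aemeasurable h hs]
  rw [withDensity_apply', Measure.restrict_restrict' e.open_target.measurableSet, Set.inter_comm]

variable [IsManifold (𝓡 n) ∞ M]

theorem det_metricMatrix_transition
    {e e' : OpenPartialHomeomorph M (EuclideanSpace ℝ (Fin n))}
    (he : e ∈ atlas (EuclideanSpace ℝ (Fin n)) M) (he' : e' ∈ atlas (EuclideanSpace ℝ (Fin n)) M)
    {y : EuclideanSpace ℝ (Fin n)} (hy : y ∈ e'.target) (hy' : e'.symm y ∈ e.source) :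
    (metricMatrix n e' y).det = (fderiv ℝ (fun z ↦ e (e'.symm z)) y).det ^ 2 *
      (metricMatrix n e (e (e'.symm y))).det := by
  obtain ⟨-, h⟩ := coordVec_transition he he' hy hy'
  set J := fderiv ℝ (fun z ↦ e (e'.symm z)) y
  set b := (EuclideanSpace.basisFun (Fin n) ℝ).toBasis
  set A := LinearMap.toMatrix b b (J : EuclideanSpace ℝ (Fin n) →ₗ[ℝ] EuclideanSpace ℝ (Fin n))
  have hA : ∀ i j, A i j = J (EuclideanSpace.single j 1) i := fun i j ↦ by
    simp [A, b, LinearMap.toMatrix_apply]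
  have h2 : metricMatrix n e' y = A.transpose * metricMatrix n e (e (e'.symm y)) * A := by
    ext i j
    have h3 := congrFun (metricMatrix_mulVec e (e (e'.symm y)) (J (EuclideanSpace.single j 1)))
    rw [Matrix.mul_assoc, Matrix.mul_apply]
    simp only [metricMatrix, Matrix.of_apply, Matrix.transpose_apply, hA] at h3 ⊢
    rw [h, real_inner_comm, coordVec_eq_sum e _ (J (EuclideanSpace.single i 1)), inner_sum]
    refine Finset.sum_congr rfl fun k _ ↦ ?_
    rw [real_inner_smul_right, ← h3 k]
    simp only [Matrix.mul_apply, Matrix.mulVec, dotProduct, Matrix.of_apply, hA]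
  have h3 : A.det = J.det := LinearMap.det_toMatrix b _
  rw [h2, Matrix.det_mul, Matrix.det_mul, Matrix.det_transpose, h3]
  ring

/-- The change of variables formula: on the domain of the chart `e`, no chart measure exceeds that
of `e`. -/
theorem chartVolume_le {e e' : OpenPartialHomeomorph M (EuclideanSpace ℝ (Fin n))}
    (he : e ∈ atlas (EuclideanSpace ℝ (Fin n)) M) (he' : e' ∈ atlas (EuclideanSpace ℝ (Fin n)) M)
    {s : Set M} (hs : MeasurableSet s) (hse : s ⊆ e.source) :
    chartVolume n e' s ≤ chartVolume n e s := by
  rw [chartVolume_apply _ hs, chartVolume_apply _ hs]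
  set A := e'.target ∩ e'.symm ⁻¹' s
  have hA : MeasurableSet A :=
    measurableSet_inter_preimage_of_continuousOn e'.continuousOn_symm
      e'.open_target.measurableSet hs
  have h1 : ∀ y ∈ A, HasFDerivWithinAt (fun z ↦ e (e'.symm z))
      (fderiv ℝ (fun z ↦ e (e'.symm z)) y) A y := fun y hy ↦
    (coordVec_transition he he' hy.1 (hse hy.2)).1.hasFDerivWithinAt
  have h2 : InjOn (fun z ↦ e (e'.symm z)) A := by
    intro y hy z hz hyz
    exact e'.symm.injOn hy.1 hz.1 (e.injOn (hse hy.2) (hse hz.2) hyz)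
  have h3 : (fun z ↦ e (e'.symm z)) '' A ⊆ e.target ∩ e.symm ⁻¹' s := by
    rintro _ ⟨y, hy, rfl⟩
    refine ⟨e.map_source (hse hy.2), ?_⟩
    simp only [Set.mem_preimage, e.left_inv (hse hy.2)]
    exact hy.2
  refine le_trans (le_of_eq ?_) (lintegral_mono_set h3)
  rw [lintegral_image_eq_lintegral_abs_det_fderiv_mul volume hA h1 h2]
  refine setLIntegral_congr_fun hA fun y hy ↦ ?_
  simp only [chartDensity]
  rw [det_metricMatrix_transition he he' hy.1 (hse hy.2), Real.sqrt_mul (sq_nonneg _),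
    Real.sqrt_sq_eq_abs, ENNReal.ofReal_mul (abs_nonneg _)]

/-- The supremum of the chart measures is given by `√|g| dx` in each chart. -/
theorem vol_apply_of_subset {e : OpenPartialHomeomorph M (EuclideanSpace ℝ (Fin n))}
    (he : e ∈ atlas (EuclideanSpace ℝ (Fin n)) M) {s : Set M} (hs : MeasurableSet s)
    (hse : s ⊆ e.source) : vol n M s = chartVolume n e s := by
  refine le_antisymm ?_ (Measure.le_iff'.1 (le_iSup₂_of_le e he le_rfl) s)
  have h : vol n M ≤ chartVolume n e + (⊤ : Measure M).restrict e.sourceᶜ := by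
    refine iSup₂_le fun e' he' ↦ ?_
    rw [← Measure.restrict_add_restrict_compl (μ := chartVolume n e') e.open_source.measurableSet]
    refine add_le_add (Measure.le_iff.2 fun t ht ↦ ?_) (Measure.restrict_mono le_rfl le_top)
    rw [Measure.restrict_apply ht]
    exact (chartVolume_le he he' (ht.inter e.open_source.measurableSet)
      Set.inter_subset_right).trans (measure_mono Set.inter_subset_left)
  refine (Measure.le_iff'.1 h s).trans (le_of_eq ?_)
  rw [Measure.add_apply, Measure.restrict_apply hs,
    (Set.disjoint_compl_right_iff_subset.2 hse).inter_eq]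
  simp

variable [IsContMDiffRiemannianBundle (𝓡 n) ∞ (EuclideanSpace ℝ (Fin n))
      (fun p : M ↦ TangentSpace (𝓡 n) p)]
  {e : OpenPartialHomeomorph M (EuclideanSpace ℝ (Fin n))}

theorem continuousOn_sqrt_det (he : e ∈ atlas (EuclideanSpace ℝ (Fin n)) M) :
    ContinuousOn (fun y ↦ Real.sqrt (metricMatrix n e y).det) e.target :=
  (continuousOn_det_metricMatrix he).sqrt

theorem vol_image_symm (he : e ∈ atlas (EuclideanSpace ℝ (Fin n)) M)
    {A : Set (EuclideanSpace ℝ (Fin n))} (hA : A ⊆ e.target) (hm : MeasurableSet A) :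
    vol n M (e.symm '' A) = ∫⁻ y in A, chartDensity e y := by
  have h1 : e.symm '' A ⊆ e.source := by
    rw [image_symm_eq e hA]
    exact Set.inter_subset_left
  rw [vol_apply_of_subset he (measurableSet_image_symm e hA hm) h1,
    chartVolume_apply _ (measurableSet_image_symm e hA hm)]
  congr 2
  ext y
  constructor
  · rintro ⟨h2, z, hz, h3⟩
    rwa [← e.symm.injOn (hA hz) h2 h3]
  · exact fun h ↦ ⟨hA h, y, h, rfl⟩

theorem vol_image_symm_eq_zero (he : e ∈ atlas (EuclideanSpace ℝ (Fin n)) M)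
    {A : Set (EuclideanSpace ℝ (Fin n))} (hA : A ⊆ e.target) (h0 : volume A = 0) :
    vol n M (e.symm '' A) = 0 := by
  have h1 : A ⊆ toMeasurable volume A ∩ e.target := fun y hy ↦ ⟨subset_toMeasurable _ _ hy, hA hy⟩
  refine measure_mono_null (Set.image_mono h1) ?_
  rw [vol_image_symm he Set.inter_subset_right
    ((measurableSet_toMeasurable _ _).inter e.open_target.measurableSet)]
  refine setLIntegral_measure_zero _ _ (measure_mono_null Set.inter_subset_left ?_)
  rwa [measure_toMeasurable]

theorem ae_vol_of_forall_chart {P : M → Prop}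
    (h : ∀ e ∈ atlas (EuclideanSpace ℝ (Fin n)) M,
      ∀ᵐ y ∂(volume.restrict e.target), P (e.symm y)) [CompactSpace M] :
    ∀ᵐ p ∂(vol n M), P p := by
  obtain ⟨t, ht⟩ := isCompact_univ.elim_finite_subcover
    (fun p : M ↦ (chartAt (EuclideanSpace ℝ (Fin n)) p).source)
    (fun p ↦ (chartAt (EuclideanSpace ℝ (Fin n)) p).open_source)
    (fun p _ ↦ Set.mem_iUnion.2 ⟨p, mem_chart_source _ p⟩)
  have h1 : {p | ¬ P p} ⊆ ⋃ q ∈ t, (chartAt (EuclideanSpace ℝ (Fin n)) q).symm ''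
      ((chartAt (EuclideanSpace ℝ (Fin n)) q).target ∩
        {y | ¬ P ((chartAt (EuclideanSpace ℝ (Fin n)) q).symm y)}) := by
    intro p hp
    obtain ⟨q, hq, hpq⟩ := Set.mem_iUnion₂.1 (ht (Set.mem_univ p))
    refine Set.mem_iUnion₂.2 ⟨q, hq, chartAt (EuclideanSpace ℝ (Fin n)) q p, ⟨?_, ?_⟩, ?_⟩
    · exact OpenPartialHomeomorph.map_source _ hpq
    · simpa [OpenPartialHomeomorph.left_inv _ hpq] using hp
    · exact OpenPartialHomeomorph.left_inv _ hpq
  refine measure_mono_null h1 ((measure_biUnion_null_iff t.countable_toSet).2 fun q hq ↦ ?_)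
  refine vol_image_symm_eq_zero (chart_mem_atlas _ q) Set.inter_subset_left ?_
  have h2 := h _ (chart_mem_atlas (EuclideanSpace ℝ (Fin n)) q)
  rw [ae_iff, Measure.restrict_apply₀'
    (chartAt (EuclideanSpace ℝ (Fin n)) q).open_target.measurableSet.nullMeasurableSet] at h2
  rwa [Set.inter_comm]

theorem map_symm_absolutelyContinuous (he : e ∈ atlas (EuclideanSpace ℝ (Fin n)) M) :
    (volume.restrict e.target).map e.symm ≪ vol n M := by
  refine Measure.AbsolutelyContinuous.mk fun s hs h0 ↦ ?_
  rw [Measure.map_apply_of_aemeasurable (aemeasurable_chart_symm e) hs,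
    Measure.restrict_apply₀' e.open_target.measurableSet.nullMeasurableSet]
  have h1 : chartVolume n e s = 0 :=
    le_antisymm ((Measure.le_iff'.1 (le_iSup₂_of_le e he le_rfl) s).trans h0.le) zero_le
  have hm : MeasurableSet (e.target ∩ e.symm ⁻¹' s) :=
    measurableSet_inter_preimage_of_continuousOn e.continuousOn_symm e.open_target.measurableSet hs
  rw [chartVolume_apply _ hs] at h1
  have h2 : ∀ y ∈ e.target ∩ e.symm ⁻¹' s, chartDensity e y ≠ 0 := fun y hy ↦ by
    simpa [chartDensity] using det_metricMatrix_pos he hy.1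
  have h3 : AEMeasurable (chartDensity e) (volume.restrict (e.target ∩ e.symm ⁻¹' s)) :=
    (((continuousOn_sqrt_det he).mono Set.inter_subset_left).aemeasurable hm).ennreal_ofReal
  have h4 := (lintegral_eq_zero_iff' h3).1 h1
  rw [Filter.EventuallyEq, ae_restrict_iff' hm] at h4
  rw [Set.inter_comm]
  rw [ae_iff] at h4
  exact measure_mono_null (fun y hy ↦ by
    simp only [Set.mem_ofPred_eq, Classical.not_imp]
    exact ⟨hy, h2 y hy⟩) h4

theorem ae_chart_of_ae_vol (he : e ∈ atlas (EuclideanSpace ℝ (Fin n)) M) {P : M → Prop}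
    (h : ∀ᵐ p ∂(vol n M), P p) : ∀ᵐ y ∂(volume.restrict e.target), P (e.symm y) :=
  ae_of_ae_map (aemeasurable_chart_symm e) ((map_symm_absolutelyContinuous he).ae_le h)

/-- On compact parts of a chart, Lebesgue measure is bounded by a multiple of the Riemannian
volume. -/
theorem exists_map_symm_le (he : e ∈ atlas (EuclideanSpace ℝ (Fin n)) M)
    {K : Set (EuclideanSpace ℝ (Fin n))} (hK : IsCompact K) (hKe : K ⊆ e.target) :
    ∃ C : ℝ≥0, (volume.restrict K).map e.symm ≤ C • vol n M := by
  obtain ⟨c, hc0, hc⟩ : ∃ c : ℝ≥0, 0 < c ∧ ∀ y ∈ K, (c : ℝ≥0∞) ≤ chartDensity e y := by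
    rcases K.eq_empty_or_nonempty with rfl | hne
    · exact ⟨1, one_pos, by simp⟩
    obtain ⟨x, hx, hmin⟩ := hK.exists_isMinOn hne ((continuousOn_sqrt_det he).mono hKe)
    refine ⟨(Real.sqrt (metricMatrix n e x).det).toNNReal, ?_, fun y hy ↦ ?_⟩
    · exact Real.toNNReal_pos.2 (Real.sqrt_pos.2 (det_metricMatrix_pos he (hKe hx)))
    · exact ENNReal.ofReal_le_ofReal (hmin hy)
  refine ⟨c⁻¹, Measure.le_iff.2 fun s hs ↦ ?_⟩
  have hm : MeasurableSet (K ∩ e.symm ⁻¹' s) :=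
    measurableSet_inter_preimage_of_continuousOn (e.continuousOn_symm.mono hKe) hK.measurableSet hs
  rw [Measure.map_apply_of_aemeasurable (aemeasurable_chart_symm_of_subset e hKe) hs,
    Measure.restrict_apply₀' hK.measurableSet.nullMeasurableSet, Set.inter_comm]
  have h1 : (c : ℝ≥0∞) * volume (K ∩ e.symm ⁻¹' s) ≤ vol n M s := by
    rw [← setLIntegral_const]
    refine (setLIntegral_mono' hm fun y hy ↦ hc y hy.1).trans ?_
    rw [← vol_image_symm he (fun y hy ↦ hKe hy.1) hm]
    refine measure_mono ?_
    rintro _ ⟨y, hy, rfl⟩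
    exact hy.2
  calc volume (K ∩ e.symm ⁻¹' s) = (c⁻¹ : ℝ≥0) * (c * volume (K ∩ e.symm ⁻¹' s)) := by
        rw [← mul_assoc, ← ENNReal.coe_mul, inv_mul_cancel₀ hc0.ne']
        simp
    _ ≤ (c⁻¹ : ℝ≥0) * vol n M s := by gcongr
    _ = _ := rfl

/-- On compact parts of a chart, the Riemannian volume is bounded by a multiple of Lebesgue
measure. -/
theorem exists_vol_restrict_le (he : e ∈ atlas (EuclideanSpace ℝ (Fin n)) M)
    {K : Set (EuclideanSpace ℝ (Fin n))} (hK : IsCompact K) (hKe : K ⊆ e.target) :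
    ∃ C : ℝ≥0, (vol n M).restrict (e.symm '' K) ≤ C • (volume.restrict K).map e.symm := by
  obtain ⟨c, hc⟩ : ∃ c : ℝ≥0, ∀ y ∈ K, chartDensity e y ≤ c := by
    obtain ⟨c, hc⟩ := (hK.image_of_continuousOn ((continuousOn_sqrt_det he).mono hKe)).bddAbove
    refine ⟨c.toNNReal, fun y hy ↦ ENNReal.ofReal_le_ofReal (hc ⟨y, hy, rfl⟩)⟩
  refine ⟨c, Measure.le_iff.2 fun s hs ↦ ?_⟩
  have hm : MeasurableSet (K ∩ e.symm ⁻¹' s) :=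
    measurableSet_inter_preimage_of_continuousOn (e.continuousOn_symm.mono hKe) hK.measurableSet hs
  have h1 : s ∩ e.symm '' K = e.symm '' (K ∩ e.symm ⁻¹' s) := by
    rw [Set.image_inter_preimage, Set.inter_comm]
  rw [Measure.smul_apply,
    Measure.map_apply_of_aemeasurable (aemeasurable_chart_symm_of_subset e hKe) hs,
    Measure.restrict_apply₀' hK.measurableSet.nullMeasurableSet, Measure.restrict_apply hs, h1,
    vol_image_symm he (fun y hy ↦ hKe hy.1) hm, Set.inter_comm (e.symm ⁻¹' s)]
  refine (setLIntegral_mono' hm fun y hy ↦ hc y hy.1).trans (le_of_eq ?_)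
  rw [setLIntegral_const]
  rfl

/-- Finitely many coordinate balls cover `M`, with the balls of doubled radius still in the
charts. -/
theorem exists_finite_ball_cover (n : ℕ) (M : Type*) [TopologicalSpace M]
    [ChartedSpace (EuclideanSpace ℝ (Fin n)) M] [CompactSpace M] :
    ∃ (t : Finset M) (r : M → ℝ), (∀ p, 0 < r p) ∧
      (∀ p, Metric.closedBall (chartAt (EuclideanSpace ℝ (Fin n)) p p) (2 * r p) ⊆
        (chartAt (EuclideanSpace ℝ (Fin n)) p).target) ∧
      univ ⊆ ⋃ p ∈ t, (chartAt (EuclideanSpace ℝ (Fin n)) p).symm ''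
        Metric.ball (chartAt (EuclideanSpace ℝ (Fin n)) p p) (r p) := by
  have h1 : ∀ p : M, ∃ r : ℝ, 0 < r ∧ Metric.closedBall (chartAt (EuclideanSpace ℝ (Fin n)) p p)
      (2 * r) ⊆ (chartAt (EuclideanSpace ℝ (Fin n)) p).target := by
    intro p
    obtain ⟨ε, hε, h⟩ := Metric.nhds_basis_closedBall.mem_iff.1
      ((chartAt (EuclideanSpace ℝ (Fin n)) p).open_target.mem_nhds (mem_chart_target _ p))
    exact ⟨ε / 2, by positivity, by rwa [mul_div_cancel₀ _ two_ne_zero]⟩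
  choose r hr hrt using h1
  have hsub : ∀ p, Metric.ball (chartAt (EuclideanSpace ℝ (Fin n)) p p) (r p) ⊆
      (chartAt (EuclideanSpace ℝ (Fin n)) p).target := fun p ↦
    (Metric.ball_subset_closedBall.trans
      (Metric.closedBall_subset_closedBall (by linarith [hr p]))).trans (hrt p)
  obtain ⟨t, ht⟩ := isCompact_univ.elim_finite_subcover
    (fun p : M ↦ (chartAt (EuclideanSpace ℝ (Fin n)) p).symm ''
        Metric.ball (chartAt (EuclideanSpace ℝ (Fin n)) p p) (r p))
    (fun p ↦ (chartAt (EuclideanSpace ℝ (Fin n)) p).isOpen_image_symm_of_subset_target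
      Metric.isOpen_ball (hsub p))
    (fun p _ ↦ Set.mem_iUnion.2 ⟨p, _, Metric.mem_ball_self (hr p),
      OpenPartialHomeomorph.left_inv _ (mem_chart_source _ p)⟩)
  exact ⟨t, r, hr, hrt, ht⟩

instance isFiniteMeasure_vol [CompactSpace M] : IsFiniteMeasure (vol n M) := by
  obtain ⟨t, r, hr, hrt, ht⟩ := exists_finite_ball_cover n M
  refine ⟨(measure_mono ht).trans_lt ((measure_biUnion_finset_le _ _).trans_lt
    (ENNReal.sum_lt_top.2 fun p _ ↦ ?_))⟩
  have hsub : Metric.closedBall (chartAt (EuclideanSpace ℝ (Fin n)) p p) (r p) ⊆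
      (chartAt (EuclideanSpace ℝ (Fin n)) p).target :=
    (Metric.closedBall_subset_closedBall (by linarith [hr p])).trans (hrt p)
  obtain ⟨C, hC⟩ := exists_vol_restrict_le (chart_mem_atlas _ p)
    (isCompact_closedBall (chartAt (EuclideanSpace ℝ (Fin n)) p p) (r p)) hsub
  refine (measure_mono (Set.image_mono Metric.ball_subset_closedBall)).trans_lt ?_
  have h1 := Measure.le_iff'.1 hC univ
  rw [Measure.restrict_apply_univ] at h1
  refine h1.trans_lt ?_
  rw [Measure.smul_apply, Measure.map_apply_of_aemeasurable
    (aemeasurable_chart_symm_of_subset _ hsub) MeasurableSet.univ]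
  simp only [Set.preimage_univ, Measure.restrict_apply_univ]
  exact ENNReal.mul_lt_top ENNReal.coe_lt_top (isCompact_closedBall _ _).measure_lt_top

end Volume

/-! ### Measurable vector fields -/

section MeasurableSections

/-- The Cauchy–Schwarz inequality against the constant function `1`. -/
theorem sq_lintegral_le {α : Type*} [MeasurableSpace α] {μ : Measure α} {g : α → ℝ≥0∞}
    (hg : AEMeasurable g μ) : (∫⁻ a, g a ∂μ) ^ 2 ≤ μ univ * ∫⁻ a, g a ^ 2 ∂μ := by
  have h := ENNReal.lintegral_mul_le_Lp_mul_Lq μ (p := 2) (q := 2)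
    ⟨by norm_num, by norm_num, by norm_num⟩ (aemeasurable_const (b := (1 : ℝ≥0∞))) hg
  simp only [Pi.mul_apply, one_mul, ENNReal.one_rpow, lintegral_one] at h
  calc (∫⁻ a, g a ∂μ) ^ 2 ≤ ((μ univ) ^ (1 / 2 : ℝ) * (∫⁻ a, g a ^ (2 : ℝ) ∂μ) ^ (1 / 2 : ℝ)) ^ 2 := by
        gcongr
    _ = _ := by
      rw [mul_pow, ← ENNReal.rpow_natCast, ← ENNReal.rpow_natCast, ← ENNReal.rpow_mul,
        ← ENNReal.rpow_mul]
      simp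

variable {n : ℕ} {M : Type*} [TopologicalSpace M] [ChartedSpace (EuclideanSpace ℝ (Fin n)) M]
  [RiemannianBundle (fun p : M ↦ TangentSpace (𝓡 n) p)]

/-- A vector field `X`, which takes its values in varying tangent spaces, is measurable if in every
chart its inner products with the coordinate fields are almost everywhere strongly measurable. -/
def MeasurableSection (X : (p : M) → TangentSpace (𝓡 n) p) : Prop :=
  ∀ e ∈ atlas (EuclideanSpace ℝ (Fin n)) M, ∀ v : EuclideanSpace ℝ (Fin n),
    AEStronglyMeasurable (fun y ↦ (inner ℝ (X (e.symm y)) (coordVec n e y v) : ℝ))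
      (volume.restrict e.target)

theorem IsWeakGradient.measurableSection {u : M → ℝ} {X : (p : M) → TangentSpace (𝓡 n) p}
    (h : IsWeakGradient n u X) : MeasurableSection X := fun e he v ↦
  (h.locallyIntegrableOn_inner e he v).aestronglyMeasurable

theorem MeasurableSection.sub {X Y : (p : M) → TangentSpace (𝓡 n) p} (hX : MeasurableSection X)
    (hY : MeasurableSection Y) : MeasurableSection (fun p ↦ X p - Y p) := fun e he v ↦ by
  simp only [inner_sub_left]
  exact (hX e he v).sub (hY e he v)

variable [MeasurableSpace M] [BorelSpace M] [IsManifold (𝓡 n) ∞ M]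
  [IsContMDiffRiemannianBundle (𝓡 n) ∞ (EuclideanSpace ℝ (Fin n))
      (fun p : M ↦ TangentSpace (𝓡 n) p)]
  {e : OpenPartialHomeomorph M (EuclideanSpace ℝ (Fin n))}

theorem aemeasurable_comp_symm (he : e ∈ atlas (EuclideanSpace ℝ (Fin n)) M)
    {β : Type*} [MeasurableSpace β] {f : M → β} (hf : AEMeasurable f (vol n M)) :
    AEMeasurable (fun y ↦ f (e.symm y)) (volume.restrict e.target) :=
  (hf.mono_ac (map_symm_absolutelyContinuous he)).comp_aemeasurable (aemeasurable_chart_symm e)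

theorem aestronglyMeasurable_comp_symm (he : e ∈ atlas (EuclideanSpace ℝ (Fin n)) M)
    {f : M → ℝ} (hf : AEStronglyMeasurable f (vol n M)) :
    AEStronglyMeasurable (fun y ↦ f (e.symm y)) (volume.restrict e.target) :=
  (aemeasurable_comp_symm he hf.aemeasurable).aestronglyMeasurable

theorem map_chart_absolutelyContinuous (he : e ∈ atlas (EuclideanSpace ℝ (Fin n)) M) :
    ((vol n M).restrict e.source).map e ≪ volume.restrict e.target := by
  refine Measure.AbsolutelyContinuous.mk fun s hs h0 ↦ ?_
  rw [Measure.map_apply_of_aemeasurable (e.continuousOn.aemeasurable e.open_source.measurableSet)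
    hs, Measure.restrict_apply₀' e.open_source.measurableSet.nullMeasurableSet]
  rw [Measure.restrict_apply hs] at h0
  refine measure_mono_null ?_ (vol_image_symm_eq_zero he Set.inter_subset_right h0)
  rintro p ⟨h1, h2⟩
  exact ⟨e p, ⟨h1, e.map_source h2⟩, e.left_inv h2⟩

variable [CompactSpace M]

theorem aemeasurable_of_comp_symm {β : Type*} [MeasurableSpace β] {f : M → β}
    (h : ∀ e ∈ atlas (EuclideanSpace ℝ (Fin n)) M,
      AEMeasurable (fun y ↦ f (e.symm y)) (volume.restrict e.target)) :
    AEMeasurable f (vol n M) := by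
  obtain ⟨t, ht⟩ := isCompact_univ.elim_finite_subcover
    (fun p : M ↦ (chartAt (EuclideanSpace ℝ (Fin n)) p).source)
    (fun p ↦ (chartAt (EuclideanSpace ℝ (Fin n)) p).open_source)
    (fun p _ ↦ Set.mem_iUnion.2 ⟨p, mem_chart_source _ p⟩)
  have h1 : vol n M = (vol n M).restrict
      (⋃ p : t, (chartAt (EuclideanSpace ℝ (Fin n)) (p : M)).source) := by
    have h2 : (⋃ p : t, (chartAt (EuclideanSpace ℝ (Fin n)) (p : M)).source) = univ := by
      refine Set.univ_subset_iff.1 (ht.trans ?_)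
      exact Set.iUnion₂_subset fun p hp ↦ Set.subset_iUnion_of_subset ⟨p, hp⟩ subset_rfl
    rw [h2, Measure.restrict_univ]
  rw [h1]
  refine AEMeasurable.iUnion fun p ↦ ?_
  have he := chart_mem_atlas (EuclideanSpace ℝ (Fin n)) (p : M)
  set e := chartAt (EuclideanSpace ℝ (Fin n)) (p : M)
  have h2 : AEMeasurable (fun q ↦ f (e.symm (e q))) ((vol n M).restrict e.source) :=
    ((h e he).mono_ac (map_chart_absolutelyContinuous he)).comp_aemeasurable
      (e.continuousOn.aemeasurable e.open_source.measurableSet)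
  refine h2.congr ?_
  filter_upwards [ae_restrict_mem e.open_source.measurableSet] with q hq
  rw [e.left_inv hq]

theorem MeasurableSection.aemeasurable_norm {X : (p : M) → TangentSpace (𝓡 n) p}
    (hX : MeasurableSection X) : AEMeasurable (fun p ↦ ‖X p‖) (vol n M) := by
  refine aemeasurable_of_comp_symm fun e he ↦ ?_
  have h1 : ∀ i j, AEMeasurable (fun y ↦ (metricMatrix n e y)⁻¹ i j) (volume.restrict e.target) :=
    fun i j ↦ ((continuous_apply_apply i j).comp_continuousOn
      (continuousOn_inv_metricMatrix he)).aemeasurable e.open_target.measurableSet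
  have h2 : AEMeasurable (fun y ↦ Real.sqrt
      ((fun i ↦ inner ℝ (X (e.symm y)) (coordVec n e y (EuclideanSpace.single i 1))) ⬝ᵥ
      Matrix.mulVec (metricMatrix n e y)⁻¹
        (fun i ↦ inner ℝ (X (e.symm y)) (coordVec n e y (EuclideanSpace.single i 1)))))
      (volume.restrict e.target) := by
    simp only [dotProduct, Matrix.mulVec]
    refine (Finset.aemeasurable_fun_sum _ fun i _ ↦ (hX e he _).aemeasurable.mul
      (Finset.aemeasurable_fun_sum _ fun j _ ↦ (h1 i j).mul (hX e he _).aemeasurable)).sqrt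
  refine h2.congr ?_
  filter_upwards [ae_restrict_mem e.open_target.measurableSet] with y hy
  rw [← norm_sq_eq_dotProduct_inv he hy, Real.sqrt_sq (norm_nonneg _)]

theorem MeasurableSection.aemeasurable_enorm {X : (p : M) → TangentSpace (𝓡 n) p}
    (hX : MeasurableSection X) : AEMeasurable (fun p ↦ ‖X p‖ₑ) (vol n M) := by
  simpa only [ofReal_norm] using hX.aemeasurable_norm.ennreal_ofReal

omit [CompactSpace M] in
theorem MeasurableSection.smul {X : (p : M) → TangentSpace (𝓡 n) p}
    (hX : MeasurableSection X) {f : M → ℝ} (hf : AEStronglyMeasurable f (vol n M)) :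
    MeasurableSection (fun p ↦ f p • X p) := fun e he v ↦ by
  simp only [real_inner_smul_left]
  exact (aestronglyMeasurable_comp_symm he hf).mul (hX e he v)

omit [CompactSpace M] in
theorem MeasurableSection.of_tendsto {X : (p : M) → TangentSpace (𝓡 n) p}
    {Y : ℕ → (p : M) → TangentSpace (𝓡 n) p} (hY : ∀ k, MeasurableSection (Y k))
    (h : ∀ᵐ p ∂(vol n M), Filter.Tendsto (fun k ↦ Y k p) Filter.atTop (𝓝 (X p))) :
    MeasurableSection X := fun e he v ↦ by
  refine aestronglyMeasurable_of_tendsto_ae Filter.atTop (fun k ↦ hY k e he v) ?_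
  filter_upwards [ae_chart_of_ae_vol he h] with y hy
  exact hy.inner tendsto_const_nhds

omit [CompactSpace M] in
/-- On a compact part of a chart, the `L²` and `L¹` norms with respect to Lebesgue measure are
controlled by the `L²` norm with respect to the Riemannian volume. -/
theorem exists_sq_lintegral_chart_le (he : e ∈ atlas (EuclideanSpace ℝ (Fin n)) M)
    {K : Set (EuclideanSpace ℝ (Fin n))} (hK : IsCompact K) (hKe : K ⊆ e.target) :
    ∃ C : ℝ≥0, ∀ g : M → ℝ≥0∞, AEMeasurable g (vol n M) →
      ∫⁻ y in K, g (e.symm y) ^ 2 ≤ C * ∫⁻ p, g p ^ 2 ∂(vol n M) ∧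
      (∫⁻ y in K, g (e.symm y)) ^ 2 ≤ C * ∫⁻ p, g p ^ 2 ∂(vol n M) := by
  obtain ⟨C, hC⟩ := exists_map_symm_le he hK hKe
  have h0 : ∀ g : M → ℝ≥0∞, AEMeasurable g (vol n M) →
      ∫⁻ y in K, g (e.symm y) ^ 2 ≤ C * ∫⁻ p, g p ^ 2 ∂(vol n M) := fun g hg ↦ by
    have h1 : AEMeasurable g ((volume.restrict K).map e.symm) :=
      hg.mono_ac ((Measure.absolutelyContinuous_of_le hC).trans
        (Measure.smul_absolutelyContinuous))
    rw [← lintegral_map' (f := fun p ↦ g p ^ 2) (h1.pow_const 2)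
      (aemeasurable_chart_symm_of_subset e hKe)]
    exact (lintegral_mono' hC le_rfl).trans (by rw [lintegral_smul_measure]; rfl)
  refine ⟨C + (volume K).toNNReal * C, fun g hg ↦ ⟨(h0 g hg).trans ?_, ?_⟩⟩
  · gcongr
    simp
  · have h2 : AEMeasurable (fun y ↦ g (e.symm y)) (volume.restrict K) :=
      (aemeasurable_comp_symm he hg).mono_measure (Measure.restrict_mono hKe le_rfl)
    refine (sq_lintegral_le h2).trans ?_
    rw [Measure.restrict_apply_univ]
    refine (mul_le_mul_right (h0 g hg) _).trans ?_
    rw [← mul_assoc]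
    gcongr
    rw [ENNReal.coe_add, ENNReal.coe_mul, ENNReal.coe_toNNReal hK.measure_lt_top.ne]
    simp

end MeasurableSections

/-! ### Gradients of smooth functions and weak gradients -/

section Gradients

variable {n : ℕ} {M : Type*} [TopologicalSpace M] [ChartedSpace (EuclideanSpace ℝ (Fin n)) M]
  [RiemannianBundle (fun p : M ↦ TangentSpace (𝓡 n) p)]

instance finiteDimensional_tangentSpace (p : M) : FiniteDimensional ℝ (TangentSpace (𝓡 n) p) :=
  inferInstanceAs (FiniteDimensional ℝ (EuclideanSpace ℝ (Fin n)))

instance completeSpace_tangentSpace (p : M) : CompleteSpace (TangentSpace (𝓡 n) p) :=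
  FiniteDimensional.complete ℝ _

/-- The gradient of `φ`: the vector field that represents the differential of `φ`. -/
def grad (n : ℕ) {M : Type*} [TopologicalSpace M] [ChartedSpace (EuclideanSpace ℝ (Fin n)) M]
    [RiemannianBundle (fun p : M ↦ TangentSpace (𝓡 n) p)] (φ : M → ℝ) (p : M) :
    TangentSpace (𝓡 n) p :=
  (InnerProductSpace.toDual ℝ (TangentSpace (𝓡 n) p)).symm (mfderiv (𝓡 n) 𝓘(ℝ, ℝ) φ p)

theorem inner_grad (φ : M → ℝ) (p : M) (Z : TangentSpace (𝓡 n) p) :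
    (inner ℝ (grad n φ p) Z : ℝ) = mfderiv (𝓡 n) 𝓘(ℝ, ℝ) φ p Z :=
  InnerProductSpace.toDual_symm_apply

theorem grad_add {φ ψ : M → ℝ} (hφ : ContMDiff (𝓡 n) 𝓘(ℝ, ℝ) ∞ φ)
    (hψ : ContMDiff (𝓡 n) 𝓘(ℝ, ℝ) ∞ ψ) (p : M) :
    grad n (fun q ↦ φ q + ψ q) p = grad n φ p + grad n ψ p := by
  refine ext_inner_right ℝ fun Z ↦ ?_
  rw [inner_add_left, inner_grad, inner_grad, inner_grad]
  have h := mfderiv_add (hφ.mdifferentiable (by simp) p) (hψ.mdifferentiable (by simp) p)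
  exact DFunLike.congr_fun h Z

theorem grad_sub {φ ψ : M → ℝ} (hφ : ContMDiff (𝓡 n) 𝓘(ℝ, ℝ) ∞ φ)
    (hψ : ContMDiff (𝓡 n) 𝓘(ℝ, ℝ) ∞ ψ) (p : M) :
    grad n (fun q ↦ φ q - ψ q) p = grad n φ p - grad n ψ p := by
  refine ext_inner_right ℝ fun Z ↦ ?_
  rw [inner_sub_left, inner_grad, inner_grad, inner_grad]
  have h := mfderiv_sub (hφ.mdifferentiable (by simp) p) (hψ.mdifferentiable (by simp) p)
  exact DFunLike.congr_fun h Z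

theorem grad_comp {f : ℝ → ℝ} (hf : Differentiable ℝ f) {φ : M → ℝ}
    (hφ : ContMDiff (𝓡 n) 𝓘(ℝ, ℝ) ∞ φ) (p : M) :
    grad n (fun q ↦ f (φ q)) p = deriv f (φ p) • grad n φ p := by
  refine ext_inner_right ℝ fun Z ↦ ?_
  rw [real_inner_smul_left, inner_grad, inner_grad]
  have h := mfderiv_comp_apply p (g := f) (I' := 𝓘(ℝ, ℝ)) (I'' := 𝓘(ℝ, ℝ))
    (hf _).mdifferentiableAt (hφ.mdifferentiable (by simp) p) Z
  refine h.trans ?_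
  rw [mfderiv_eq_fderiv]
  exact (fderiv_eq_smul_deriv _).trans
    (mul_comm (show ℝ from mfderiv (𝓡 n) 𝓘(ℝ, ℝ) φ p Z) _)

theorem grad_const_mul {φ : M → ℝ} (hφ : ContMDiff (𝓡 n) 𝓘(ℝ, ℝ) ∞ φ) (c : ℝ) (p : M) :
    grad n (fun q ↦ c * φ q) p = c • grad n φ p := by
  rw [grad_comp (f := fun t ↦ c * t) (by fun_prop) hφ, deriv_const_mul_id']

variable [IsManifold (𝓡 n) ∞ M] {e : OpenPartialHomeomorph M (EuclideanSpace ℝ (Fin n))}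

theorem contDiffOn_comp_symm (he : e ∈ atlas (EuclideanSpace ℝ (Fin n)) M) {φ : M → ℝ}
    (hφ : ContMDiff (𝓡 n) 𝓘(ℝ, ℝ) ∞ φ) : ContDiffOn ℝ ∞ (fun y ↦ φ (e.symm y)) e.target :=
  contMDiffOn_iff_contDiffOn.1 (hφ.comp_contMDiffOn
    (contMDiffOn_symm_of_mem_maximalAtlas (IsManifold.subset_maximalAtlas he)))

theorem inner_grad_coordVec (he : e ∈ atlas (EuclideanSpace ℝ (Fin n)) M) {φ : M → ℝ}
    (hφ : ContMDiff (𝓡 n) 𝓘(ℝ, ℝ) ∞ φ) {y : EuclideanSpace ℝ (Fin n)} (hy : y ∈ e.target)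
    (v : EuclideanSpace ℝ (Fin n)) :
    (inner ℝ (grad n φ (e.symm y)) (coordVec n e y v) : ℝ) =
      fderiv ℝ (fun z ↦ φ (e.symm z)) y v := by
  have : IsManifold (𝓡 n) 1 M := IsManifold.of_le (n := ∞) (by simp)
  rw [inner_grad]
  have h := mfderiv_comp_apply y (g := φ) (I' := 𝓡 n) (I'' := 𝓘(ℝ, ℝ)) (f := e.symm)
    (I := 𝓡 n) (hφ.mdifferentiable (by simp) _) (mdifferentiableAt_atlas_symm he hy) v
  refine h.symm.trans ?_
  rw [mfderiv_eq_fderiv]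
  rfl

theorem continuousOn_fderiv_comp_symm (he : e ∈ atlas (EuclideanSpace ℝ (Fin n)) M) {φ : M → ℝ}
    (hφ : ContMDiff (𝓡 n) 𝓘(ℝ, ℝ) ∞ φ) :
    ContinuousOn (fun y ↦ fderiv ℝ (fun z ↦ φ (e.symm z)) y) e.target :=
  (contDiffOn_comp_symm he hφ).continuousOn_fderiv_of_isOpen e.open_target (by simp)

/-- Integration by parts in the charts. -/
theorem isWeakGradient_grad {φ : M → ℝ} (hφ : ContMDiff (𝓡 n) 𝓘(ℝ, ℝ) ∞ φ) :
    IsWeakGradient n φ (grad n φ) where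
  locallyIntegrableOn e he := (contDiffOn_comp_symm he hφ).continuousOn.locallyIntegrableOn
    e.open_target.measurableSet
  locallyIntegrableOn_inner e he v := by
    have h : ContinuousOn (fun y ↦ (inner ℝ (grad n φ (e.symm y)) (coordVec n e y v) : ℝ))
        e.target :=
      ((continuousOn_fderiv_comp_symm he hφ).clm_apply continuousOn_const).congr
        fun y hy ↦ inner_grad_coordVec he hφ hy v
    exact h.locallyIntegrableOn e.open_target.measurableSet
  integral_eq e he v ψ hψ hψc hψs := by
    have hd := contDiffOn_comp_symm he hφ
    have h0 : ∀ y ∉ e.target, ψ y = 0 := fun y hy ↦ image_eq_zero_of_notMem_tsupport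
      fun h ↦ hy (hψs h)
    have h0' : ∀ y ∉ e.target, fderiv ℝ ψ y v = 0 := fun y hy ↦ by
      rw [fderiv_of_notMem_tsupport ℝ fun h ↦ hy (hψs h)]
      rfl
    have hcont : ∀ f g : EuclideanSpace ℝ (Fin n) → ℝ, ContinuousOn f e.target → Continuous g →
        (∀ y ∉ tsupport ψ, g y = 0) → Integrable (fun y ↦ f y * g y) := by
      intro f g hf hg hg0
      have h1 : IntegrableOn (fun y ↦ f y * g y) (tsupport ψ) :=
        ((hf.mono hψs).mul hg.continuousOn).integrableOn_compact hψc
      refine (integrableOn_iff_integrable_of_support_subset fun y hy ↦ ?_).1 h1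
      by_contra h2
      exact hy (by simp [hg0 y h2])
    have hD : Continuous (fun y ↦ fderiv ℝ ψ y v) :=
      (hψ.continuous_fderiv (by simp)).clm_apply continuous_const
    have hp := integral_mul_fderiv_eq_neg_fderiv_mul_of_integrable (μ := volume) (v := v)
      (f := fun y ↦ φ (e.symm y)) (g := ψ)
      (hcont _ _ ((continuousOn_fderiv_comp_symm he hφ).clm_apply continuousOn_const)
        hψ.continuous fun y hy ↦ image_eq_zero_of_notMem_tsupport hy)
      (hcont _ _ hd.continuousOn hD fun y hy ↦ by
        rw [fderiv_of_notMem_tsupport ℝ hy]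
        rfl)
      (hcont _ _ hd.continuousOn hψ.continuous fun y hy ↦ image_eq_zero_of_notMem_tsupport hy)
      (fun y hy ↦ (hd.differentiableOn (by simp)).differentiableAt
        (e.open_target.mem_nhds (hψs hy)))
      (fun y _ ↦ hψ.differentiable (by simp) y)
    rw [setIntegral_eq_integral_of_forall_compl_eq_zero fun y hy ↦ by rw [h0' y hy, mul_zero], hp,
      setIntegral_eq_integral_of_forall_compl_eq_zero fun y hy ↦ by rw [h0 y hy, mul_zero]]
    congr 1
    refine integral_congr_ae (ae_of_all _ fun y ↦ ?_)
    by_cases hy : y ∈ e.target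
    · simp only [inner_grad_coordVec he hφ hy v]
    · simp only [h0 y hy, mul_zero]

theorem IsWeakGradient.sub {u u' : M → ℝ} {X X' : (p : M) → TangentSpace (𝓡 n) p}
    (h : IsWeakGradient n u X) (h' : IsWeakGradient n u' X') :
    IsWeakGradient n (fun p ↦ u p - u' p) (fun p ↦ X p - X' p) where
  locallyIntegrableOn e he := (h.locallyIntegrableOn e he).sub (h'.locallyIntegrableOn e he)
  locallyIntegrableOn_inner e he v := by
    simp only [inner_sub_left]
    exact (h.locallyIntegrableOn_inner e he v).sub (h'.locallyIntegrableOn_inner e he v)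
  integral_eq e he v ψ hψ hψc hψs := by
    have hint : ∀ f g : EuclideanSpace ℝ (Fin n) → ℝ, LocallyIntegrableOn f e.target →
        Continuous g → (∀ y ∉ tsupport ψ, g y = 0) → IntegrableOn (fun y ↦ f y * g y) e.target := by
      intro f g hf hg hg0
      have h1 : IntegrableOn (fun y ↦ f y * g y) (tsupport ψ) :=
        (hf.integrableOn_compact_subset hψs hψc).mul_continuousOn hg.continuousOn hψc
      refine ((integrableOn_iff_integrable_of_support_subset fun y hy ↦ ?_).1 h1).integrableOn
      by_contra h2
      exact hy (by simp [hg0 y h2])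
    have hD : Continuous (fun y ↦ fderiv ℝ ψ y v) :=
      (hψ.continuous_fderiv (by simp)).clm_apply continuous_const
    have hD0 : ∀ y ∉ tsupport ψ, fderiv ℝ ψ y v = 0 := fun y hy ↦ by
      rw [fderiv_of_notMem_tsupport ℝ hy]
      rfl
    have hψ0 : ∀ y ∉ tsupport ψ, ψ y = 0 := fun y hy ↦ image_eq_zero_of_notMem_tsupport hy
    simp only [sub_mul, inner_sub_left]
    rw [integral_sub (hint _ _ (h.locallyIntegrableOn e he) hD hD0)
      (hint _ _ (h'.locallyIntegrableOn e he) hD hD0),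
      integral_sub (hint _ _ (h.locallyIntegrableOn_inner e he v) hψ.continuous hψ0)
      (hint _ _ (h'.locallyIntegrableOn_inner e he v) hψ.continuous hψ0),
      h.integral_eq e he v ψ hψ hψc hψs, h'.integral_eq e he v ψ hψ hψc hψs]
    ring

variable [MeasurableSpace M] [BorelSpace M]
  [IsContMDiffRiemannianBundle (𝓡 n) ∞ (EuclideanSpace ℝ (Fin n))
      (fun p : M ↦ TangentSpace (𝓡 n) p)]

variable [CompactSpace M]

/-- The weak gradient is unique up to almost everywhere equality. -/
theorem IsWeakGradient.ae_eq {u : M → ℝ} {X X' : (p : M) → TangentSpace (𝓡 n) p}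
    (h : IsWeakGradient n u X) (h' : IsWeakGradient n u X') : ∀ᵐ p ∂(vol n M), X p = X' p := by
  refine ae_vol_of_forall_chart fun e he ↦ ?_
  have h1 : ∀ i : Fin n, ∀ᵐ y : EuclideanSpace ℝ (Fin n), y ∈ e.target →
      (inner ℝ (X (e.symm y) - X' (e.symm y))
        (coordVec n e y (EuclideanSpace.single i 1)) : ℝ) = 0 := by
    intro i
    have hs := h.sub h'
    refine e.open_target.ae_eq_zero_of_integral_contDiff_smul_eq_zero
      (hs.locallyIntegrableOn_inner e he _) fun ψ hψ hψc hψs ↦ ?_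
    have h2 := hs.integral_eq e he (EuclideanSpace.single i 1) ψ hψ hψc hψs
    simp only [sub_self, zero_mul, integral_zero, zero_eq_neg] at h2
    rw [setIntegral_eq_integral_of_forall_compl_eq_zero fun y hy ↦ by
      rw [image_eq_zero_of_notMem_tsupport fun h ↦ hy (hψs h), mul_zero]] at h2
    simpa only [smul_eq_mul, mul_comm] using h2
  rw [ae_restrict_iff' e.open_target.measurableSet]
  filter_upwards [ae_all_iff.2 h1] with y hy hye
  have h3 := norm_sq_eq_dotProduct_inv he hye (X (e.symm y) - X' (e.symm y))
  simp only [hy _ hye, Matrix.mulVec, dotProduct, zero_mul, Finset.sum_const_zero] at h3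
  exact sub_eq_zero.1 (norm_eq_zero.1 (pow_eq_zero_iff two_ne_zero |>.1 h3))

theorem IsWeakGradient.weakGrad_ae_eq {u : M → ℝ} {X : (p : M) → TangentSpace (𝓡 n) p}
    (h : IsWeakGradient n u X) : ∀ᵐ p ∂(vol n M), weakGrad n u p = X p := by
  have h1 : ∃ X, IsWeakGradient n u X := ⟨X, h⟩
  have h2 : IsWeakGradient n u (weakGrad n u) := by
    rw [weakGrad, dif_pos h1]
    exact h1.choose_spec
  exact h2.ae_eq h

theorem IsWeakGradient.h1NormSq_eq {u : M → ℝ} {X : (p : M) → TangentSpace (𝓡 n) p}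
    (h : IsWeakGradient n u X) : h1NormSq n u =
      (∫⁻ p, ‖u p‖ₑ ^ 2 ∂(vol n M)) + ∫⁻ p, ‖X p‖ₑ ^ 2 ∂(vol n M) := by
  rw [h1NormSq]
  congr 1
  refine lintegral_congr_ae ?_
  filter_upwards [h.weakGrad_ae_eq] with p hp
  rw [hp]

theorem tendsto_zero_of_sq {a : ℕ → ℝ≥0∞} (h : Filter.Tendsto (fun k ↦ a k ^ 2) Filter.atTop (𝓝 0)) :
    Filter.Tendsto a Filter.atTop (𝓝 0) := by
  have h1 := (ENNReal.continuous_rpow_const (y := (1 / 2 : ℝ))).tendsto 0 |>.comp h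
  simp only [ENNReal.zero_rpow_of_pos (show (0 : ℝ) < 1 / 2 by norm_num)] at h1
  refine h1.congr fun k ↦ ?_
  simp only [Function.comp]
  rw [← ENNReal.rpow_natCast, ← ENNReal.rpow_mul]
  simp

omit [CompactSpace M] in
/-- Convergence in `L¹(K)` passes to the limit in integrals against continuous functions that
vanish off `K`. -/
theorem tendsto_setIntegral_mul_of_L1 {α : Type*} [TopologicalSpace α] [T2Space α]
    [MeasurableSpace α] [BorelSpace α] {μ : Measure α}
    {U K : Set α} (hK : IsCompact K) (hU : MeasurableSet U) (hKU : K ⊆ U) {f : α → ℝ}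
    {F : ℕ → α → ℝ} (hf : AEStronglyMeasurable f (μ.restrict K)) (hF : ∀ k, IntegrableOn (F k) K μ)
    (h : Filter.Tendsto (fun k ↦ ∫⁻ y in K, ‖F k y - f y‖ₑ ∂μ) Filter.atTop (𝓝 0)) :
    IntegrableOn f K μ ∧ ∀ g : α → ℝ, Continuous g → (∀ y ∉ K, g y = 0) →
      Filter.Tendsto (fun k ↦ ∫ y in U, F k y * g y ∂μ) Filter.atTop
        (𝓝 (∫ y in U, f y * g y ∂μ)) := by
  have hfi : IntegrableOn f K μ := by
    obtain ⟨k, hk⟩ := (h.eventually (gt_mem_nhds ENNReal.zero_lt_top)).exists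
    have h1 : IntegrableOn (fun y ↦ F k y - f y) K μ :=
      ⟨(hF k).aestronglyMeasurable.sub hf, hk⟩
    refine ((hF k).sub h1).congr (ae_of_all _ fun y ↦ ?_)
    simp
  refine ⟨hfi, fun g hg hg0 ↦ ?_⟩
  have h2 : ∀ G : α → ℝ, ∫ y in U, G y * g y ∂μ = ∫ y in K, G y * g y ∂μ := fun G ↦
    setIntegral_eq_of_subset_of_forall_sdiff_eq_zero hU hKU fun y hy ↦ by rw [hg0 y hy.2, mul_zero]
  simp only [h2]
  obtain ⟨B, hB⟩ := (hK.image hg).isBounded.exists_norm_le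
  refine tendsto_integral_of_L1 _ (hfi.mul_continuousOn hg.continuousOn hK).aestronglyMeasurable
    (Filter.Eventually.of_forall fun k ↦ (hF k).mul_continuousOn hg.continuousOn hK) ?_
  have h3 : Filter.Tendsto (fun k ↦ ENNReal.ofReal B * ∫⁻ y in K, ‖F k y - f y‖ₑ ∂μ)
      Filter.atTop (𝓝 0) := by
    simpa using ENNReal.Tendsto.const_mul h (Or.inr ENNReal.ofReal_ne_top)
  refine tendsto_of_tendsto_of_tendsto_of_le_of_le tendsto_const_nhds h3 (fun _ ↦ zero_le)
    fun k ↦ ?_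
  simp only
  rw [← lintegral_const_mul' _ _ ENNReal.ofReal_ne_top]
  refine setLIntegral_mono' hK.measurableSet fun y hy ↦ ?_
  rw [← sub_mul, enorm_mul, mul_comm]
  gcongr
  rw [← ofReal_norm]
  exact ENNReal.ofReal_le_ofReal (hB _ ⟨y, hy, rfl⟩)

/-- The weak gradient is a closed operator in `L²`. -/
theorem IsWeakGradient.of_tendsto {u : M → ℝ} {X : (p : M) → TangentSpace (𝓡 n) p}
    {φ : ℕ → M → ℝ} {Y : ℕ → (p : M) → TangentSpace (𝓡 n) p}
    (hY : ∀ k, IsWeakGradient n (φ k) (Y k)) (hφ : ∀ k, AEStronglyMeasurable (φ k) (vol n M))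
    (hu : AEStronglyMeasurable u (vol n M)) (hX : MeasurableSection X)
    (h1 : Filter.Tendsto (fun k ↦ ∫⁻ p, ‖φ k p - u p‖ₑ ^ 2 ∂(vol n M)) Filter.atTop (𝓝 0))
    (h2 : Filter.Tendsto (fun k ↦ ∫⁻ p, ‖Y k p - X p‖ₑ ^ 2 ∂(vol n M)) Filter.atTop (𝓝 0)) :
    IsWeakGradient n u X := by
  have key : ∀ e ∈ atlas (EuclideanSpace ℝ (Fin n)) M, ∀ K : Set (EuclideanSpace ℝ (Fin n)),
      IsCompact K → K ⊆ e.target → ∀ (Z : ℕ → M → ℝ≥0∞), (∀ k, AEMeasurable (Z k) (vol n M)) →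
      Filter.Tendsto (fun k ↦ ∫⁻ p, Z k p ^ 2 ∂(vol n M)) Filter.atTop (𝓝 0) →
      Filter.Tendsto (fun k ↦ ∫⁻ y in K, Z k (e.symm y)) Filter.atTop (𝓝 0) := by
    intro e he K hK hKe Z hZ hlim
    obtain ⟨C, hC⟩ := exists_sq_lintegral_chart_le he hK hKe
    refine tendsto_zero_of_sq (tendsto_of_tendsto_of_tendsto_of_le_of_le tendsto_const_nhds ?_
      (fun _ ↦ zero_le) fun k ↦ (hC (Z k) (hZ k)).2)
    simpa using ENNReal.Tendsto.const_mul hlim (Or.inr ENNReal.coe_ne_top)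
  have A : ∀ e ∈ atlas (EuclideanSpace ℝ (Fin n)) M, ∀ K : Set (EuclideanSpace ℝ (Fin n)),
      IsCompact K → K ⊆ e.target → _ := fun e he K hK hKe ↦
    tendsto_setIntegral_mul_of_L1 (μ := volume) hK e.open_target.measurableSet hKe
      (f := fun y ↦ u (e.symm y)) (F := fun k y ↦ φ k (e.symm y))
      ((aestronglyMeasurable_comp_symm he hu).mono_measure (Measure.restrict_mono hKe le_rfl))
      (fun k ↦ ((hY k).locallyIntegrableOn e he).integrableOn_compact_subset hKe hK)
      (key e he K hK hKe (fun k p ↦ ‖φ k p - u p‖ₑ) (fun k ↦ ((hφ k).sub hu).enorm) h1)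
  have B : ∀ e ∈ atlas (EuclideanSpace ℝ (Fin n)) M, ∀ v : EuclideanSpace ℝ (Fin n),
      ∀ K : Set (EuclideanSpace ℝ (Fin n)),
      IsCompact K → K ⊆ e.target → _ := fun e he v K hK hKe ↦
    tendsto_setIntegral_mul_of_L1 (μ := volume) hK e.open_target.measurableSet hKe
      (f := fun y ↦ (inner ℝ (X (e.symm y)) (coordVec n e y v) : ℝ))
      (F := fun k y ↦ inner ℝ (Y k (e.symm y)) (coordVec n e y v))
      ((hX e he v).mono_measure (Measure.restrict_mono hKe le_rfl))
      (fun k ↦ ((hY k).locallyIntegrableOn_inner e he v).integrableOn_compact_subset hKe hK) (by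
        obtain ⟨b, hb⟩ := (hK.image_of_continuousOn
          ((continuousOn_norm_coordVec he v).mono hKe)).bddAbove
        have h3 := key e he K hK hKe (fun k p ↦ ‖Y k p - X p‖ₑ)
          (fun k ↦ ((hY k).measurableSection.sub hX).aemeasurable_enorm) h2
        have h4 : Filter.Tendsto (fun k ↦ ENNReal.ofReal b *
            ∫⁻ y in K, ‖Y k (e.symm y) - X (e.symm y)‖ₑ) Filter.atTop (𝓝 0) := by
          simpa using ENNReal.Tendsto.const_mul h3 (Or.inr ENNReal.ofReal_ne_top)
        refine tendsto_of_tendsto_of_tendsto_of_le_of_le tendsto_const_nhds h4 (fun _ ↦ zero_le)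
          fun k ↦ ?_
        simp only
        rw [← lintegral_const_mul' _ _ ENNReal.ofReal_ne_top]
        refine setLIntegral_mono' hK.measurableSet fun y hy ↦ ?_
        rw [← inner_sub_left, ← ofReal_norm, ← ofReal_norm, mul_comm,
          ← ENNReal.ofReal_mul (norm_nonneg _)]
        refine ENNReal.ofReal_le_ofReal ((norm_inner_le_norm _ _).trans ?_)
        gcongr
        exact hb ⟨y, hy, rfl⟩)
  refine ⟨fun e he ↦ ?_, fun e he v ↦ ?_, fun e he v ψ hψ hψc hψs ↦ ?_⟩
  · exact (locallyIntegrableOn_iff e.open_target.isLocallyClosed).2 fun K hKe hK ↦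
      (A e he K hK hKe).1
  · exact (locallyIntegrableOn_iff e.open_target.isLocallyClosed).2 fun K hKe hK ↦
      (B e he v K hK hKe).1
  · have h3 := (A e he _ hψc hψs).2 (fun y ↦ fderiv ℝ ψ y v)
      ((hψ.continuous_fderiv (by simp)).clm_apply continuous_const) fun y hy ↦ by
        rw [fderiv_of_notMem_tsupport ℝ hy]
        rfl
    have h4 := (B e he v _ hψc hψs).2 ψ hψ.continuous fun y hy ↦
      image_eq_zero_of_notMem_tsupport hy
    refine tendsto_nhds_unique h3 (h4.neg.congr fun k ↦ ?_)
    exact ((hY k).integral_eq e he v ψ hψ hψc hψs).symm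

end Gradients

/-! ### The Poincaré inequality on convex sets -/

section Poincare

theorem enn_add_sq_le (a b : ℝ≥0∞) : (a + b) ^ 2 ≤ 2 * (a ^ 2 + b ^ 2) := by
  have h := ENNReal.rpow_add_le_mul_rpow_add_rpow a b (p := 2) (by norm_num)
  rw [show (2 : ℝ) - 1 = 1 by norm_num, ENNReal.rpow_one] at h
  exact_mod_cast h

variable {E : Type*} [NormedAddCommGroup E] [NormedSpace ℝ E] [FiniteDimensional ℝ E]
  [MeasurableSpace E] [BorelSpace E] {μ : Measure E} [μ.IsAddHaarMeasure]

theorem lintegral_comp_add_smul_le {G : E → ℝ≥0∞} (hG : Measurable G) (c : E) {t : ℝ}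
    (ht : 1 / 2 ≤ t) :
    ∫⁻ x, G (c + t • x) ∂μ ≤ 2 ^ Module.finrank ℝ E * ∫⁻ x, G x ∂μ := by
  have ht0 : 0 < t := by linarith
  have h1 : ∫⁻ x, G (c + t • x) ∂μ = ∫⁻ z, G (c + z) ∂(μ.map (t • ·)) :=
    (lintegral_map (hG.comp (measurable_const_add c)) (measurable_const_smul t)).symm
  rw [h1, Measure.map_addHaar_smul μ ht0.ne', lintegral_smul_measure,
    lintegral_add_left_eq_self (μ := μ) G c, smul_eq_mul]
  gcongr
  rw [abs_of_pos (by positivity), ← inv_pow, ENNReal.ofReal_pow (by positivity)]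
  gcongr
  refine ENNReal.ofReal_le_of_le_toReal ?_
  rw [inv_le_comm₀ ht0 (by norm_num)]
  norm_num
  linarith

/-- The fundamental theorem of calculus along the segment from `y` to `x`, with the Cauchy–Schwarz
inequality. -/
theorem enorm_sub_sq_le_lintegral_segment {q : Set E} (hq : Convex ℝ q) {d : ℝ≥0}
    (hd : ∀ x ∈ q, ∀ y ∈ q, ‖x - y‖ₑ ≤ d) {v : E → ℝ} (hv : ∀ x ∈ q, DifferentiableAt ℝ v x)
    (hv' : ContinuousOn (fderiv ℝ v) q) {x y : E} (hx : x ∈ q) (hy : y ∈ q) :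
    ‖v x - v y‖ₑ ^ 2 ≤ d ^ 2 * ∫⁻ t in Ioc (0 : ℝ) 1,
      q.indicator (fun z ↦ ‖fderiv ℝ v z‖ₑ ^ 2) ((1 - t) • y + t • x) := by
  have hseg : ∀ t ∈ Icc (0 : ℝ) 1, (1 - t) • y + t • x ∈ q := fun t ht ↦
    hq hy hx (by linarith [ht.2]) ht.1 (by ring)
  have hcont : Continuous fun t : ℝ ↦ (1 - t) • y + t • x := by fun_prop
  have hc : ContinuousOn (fun t : ℝ ↦ fderiv ℝ v ((1 - t) • y + t • x)) (Icc 0 1) :=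
    hv'.comp hcont.continuousOn hseg
  have h1 : ∫ t in (0 : ℝ)..1, fderiv ℝ v ((1 - t) • y + t • x) (x - y) = v x - v y := by
    have h2 := intervalIntegral.integral_eq_sub_of_hasDerivAt (a := 0) (b := 1)
      (f := fun t : ℝ ↦ v ((1 - t) • y + t • x))
      (f' := fun t ↦ fderiv ℝ v ((1 - t) • y + t • x) (x - y)) (fun t ht ↦ ?_) ?_
    · simpa using h2
    · rw [Set.uIcc_of_le zero_le_one] at ht
      refine (hv _ (hseg t ht)).hasFDerivAt.comp_hasDerivAt t ?_
      have h3 : HasDerivAt (fun t : ℝ ↦ (1 - t) • y + t • x) ((-1 : ℝ) • y + (1 : ℝ) • x) t :=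
        (((hasDerivAt_id t).const_sub 1).smul_const y).add ((hasDerivAt_id t).smul_const x)
      convert! h3 using 1
      rw [neg_one_smul, one_smul]
      abel
    · refine ContinuousOn.intervalIntegrable ?_
      rw [Set.uIcc_of_le zero_le_one]
      exact hc.clm_apply continuousOn_const
  rw [← h1, intervalIntegral.integral_of_le zero_le_one]
  have hsub : Ioc (0 : ℝ) 1 ⊆ Icc 0 1 := Ioc_subset_Icc_self
  have hm : AEMeasurable (fun t : ℝ ↦ ‖fderiv ℝ v ((1 - t) • y + t • x)‖ₑ)
      (volume.restrict (Ioc (0 : ℝ) 1)) :=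
    ((hc.mono hsub).enorm).aemeasurable measurableSet_Ioc
  calc ‖∫ t in Ioc (0 : ℝ) 1, fderiv ℝ v ((1 - t) • y + t • x) (x - y)‖ₑ ^ 2
      ≤ (∫⁻ t in Ioc (0 : ℝ) 1, d * ‖fderiv ℝ v ((1 - t) • y + t • x)‖ₑ) ^ 2 := by
        gcongr
        refine (enorm_integral_le_lintegral_enorm _).trans (lintegral_mono fun t ↦ ?_)
        refine (ContinuousLinearMap.le_opENorm _ _).trans ?_
        rw [mul_comm]
        gcongr
        exact hd x hx y hy
    _ = d ^ 2 * (∫⁻ t in Ioc (0 : ℝ) 1, ‖fderiv ℝ v ((1 - t) • y + t • x)‖ₑ) ^ 2 := by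
        rw [lintegral_const_mul' _ _ ENNReal.coe_ne_top, mul_pow]
    _ ≤ d ^ 2 * ∫⁻ t in Ioc (0 : ℝ) 1, ‖fderiv ℝ v ((1 - t) • y + t • x)‖ₑ ^ 2 := by
        gcongr
        refine (sq_lintegral_le hm).trans (le_of_eq ?_)
        simp
    _ = _ := by
        congr 1
        refine setLIntegral_congr_fun measurableSet_Ioc fun t ht ↦ ?_
        rw [Set.indicator_of_mem (hseg t (hsub ht))]

theorem lintegral_lintegral_enorm_sub_sq_le {q : Set E} (hq : Convex ℝ q) (hqm : MeasurableSet q)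
    {d : ℝ≥0} (hd : ∀ x ∈ q, ∀ y ∈ q, ‖x - y‖ₑ ≤ d) {v : E → ℝ}
    (hv : ∀ x ∈ q, DifferentiableAt ℝ v x) (hv' : ContinuousOn (fderiv ℝ v) q) :
    ∫⁻ x in q, ∫⁻ y in q, ‖v x - v y‖ₑ ^ 2 ∂μ ∂μ ≤
      d ^ 2 * (μ q * (2 ^ Module.finrank ℝ E * ∫⁻ x in q, ‖fderiv ℝ v x‖ₑ ^ 2 ∂μ)) := by
  set G : E → ℝ≥0∞ := q.indicator (fun z ↦ ‖fderiv ℝ v z‖ₑ ^ 2)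
  have hG : Measurable G := by
    classical
    have h1 : ContinuousOn (fun z ↦ ‖fderiv ℝ v z‖ₑ ^ 2) q :=
      (ENNReal.continuous_pow 2).comp_continuousOn hv'.enorm
    have h2 := ContinuousOn.measurable_piecewise (s := q) h1
      (continuousOn_const (c := (0 : ℝ≥0∞))) hqm
    convert! h2 using 1
  have hGint : ∫⁻ x, G x ∂μ = ∫⁻ x in q, ‖fderiv ℝ v x‖ₑ ^ 2 ∂μ := lintegral_indicator hqm _
  have hslice : ∀ t ∈ Ioc (0 : ℝ) 1, ∫⁻ x in q, ∫⁻ y in q, G ((1 - t) • y + t • x) ∂μ ∂μ ≤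
      μ q * (2 ^ Module.finrank ℝ E * ∫⁻ x, G x ∂μ) := by
    intro t ht
    have hbd : ∀ F : E → ℝ≥0∞, (∀ x, F x ≤ 2 ^ Module.finrank ℝ E * ∫⁻ x, G x ∂μ) →
        ∫⁻ x in q, F x ∂μ ≤ μ q * (2 ^ Module.finrank ℝ E * ∫⁻ x, G x ∂μ) := fun F hF ↦ by
      refine (lintegral_mono hF).trans ?_
      rw [setLIntegral_const, mul_comm]
    -- One of the coefficients `t` and `1 - t` is at least `1 / 2`; the integral over the variable
    -- that it multiplies is computed first.
    rcases le_total (1 / 2) t with h | h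
    · rw [lintegral_lintegral_swap]
      · refine hbd _ fun y ↦ (setLIntegral_le_lintegral _ _).trans ?_
        exact lintegral_comp_add_smul_le hG _ h
      · exact (hG.comp (by fun_prop)).aemeasurable
    · refine hbd _ fun x ↦ (setLIntegral_le_lintegral _ _).trans ?_
      simp_rw [add_comm _ (t • x)]
      exact lintegral_comp_add_smul_le hG _ (by linarith)
  calc ∫⁻ x in q, ∫⁻ y in q, ‖v x - v y‖ₑ ^ 2 ∂μ ∂μ
      ≤ ∫⁻ x in q, ∫⁻ y in q, (d ^ 2 *
        ∫⁻ t in Ioc (0 : ℝ) 1, G ((1 - t) • y + t • x)) ∂μ ∂μ :=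
        setLIntegral_mono' hqm fun x hx ↦ setLIntegral_mono' hqm fun y hy ↦
          enorm_sub_sq_le_lintegral_segment hq hd hv hv' hx hy
    _ = d ^ 2 * ∫⁻ x in q, (∫⁻ t in Ioc (0 : ℝ) 1, ∫⁻ y in q,
        G ((1 - t) • y + t • x) ∂μ) ∂μ := by
        simp_rw [lintegral_const_mul' _ _ (ENNReal.pow_ne_top (n := 2) (ENNReal.coe_ne_top (r := d)))]
        congr 1
        refine lintegral_congr fun x ↦ lintegral_lintegral_swap ?_
        exact (hG.comp (by fun_prop)).aemeasurable
    _ = d ^ 2 * ∫⁻ t in Ioc (0 : ℝ) 1, ∫⁻ x in q, ∫⁻ y in q, G ((1 - t) • y + t • x) ∂μ ∂μ := by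
        congr 1
        refine lintegral_lintegral_swap ?_
        refine Measurable.aemeasurable ?_
        have h3 : Measurable fun z : (E × ℝ) × E ↦ G ((1 - z.1.2) • z.2 + z.1.2 • z.1.1) :=
          hG.comp (by fun_prop)
        exact h3.lintegral_prod_right'
    _ ≤ d ^ 2 * ∫⁻ t in Ioc (0 : ℝ) 1, μ q * (2 ^ Module.finrank ℝ E * ∫⁻ x, G x ∂μ) := by
        refine mul_le_mul_right ?_ _
        exact setLIntegral_mono' measurableSet_Ioc hslice
    _ = _ := by
        rw [setLIntegral_const, hGint]
        simp

/-- A Poincaré inequality on convex sets of diameter at most `d`. It follows from the bound for the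
mean of `|v x - v y|²` over pairs of points, by writing `v x` as the sum of the mean of `v` and the
mean of `y ↦ v x - v y`. -/
theorem lintegral_enorm_sq_le_poincare {q : Set E} (hq : Convex ℝ q) (hqm : MeasurableSet q)
    (hq_top : μ q ≠ ⊤)
    {d : ℝ≥0} (hd : ∀ x ∈ q, ∀ y ∈ q, ‖x - y‖ₑ ≤ d) {v : E → ℝ}
    (hv : ∀ x ∈ q, DifferentiableAt ℝ v x) (hv' : ContinuousOn (fderiv ℝ v) q)
    (hi : IntegrableOn v q μ) :
    ∫⁻ x in q, ‖v x‖ₑ ^ 2 ∂μ ≤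
      2 ^ (Module.finrank ℝ E + 1) * d ^ 2 * ∫⁻ x in q, ‖fderiv ℝ v x‖ₑ ^ 2 ∂μ +
        2 * ((μ q)⁻¹ * ‖∫ x in q, v x ∂μ‖ₑ ^ 2) := by
  rcases eq_or_ne (μ q) 0 with h0 | h0
  · rw [setLIntegral_measure_zero _ _ h0]
    exact zero_le
  have hvm : AEMeasurable v (μ.restrict q) := hi.aestronglyMeasurable.aemeasurable
  have hpt : ∀ x, μ q ^ 2 * ‖v x‖ₑ ^ 2 ≤
      2 * (μ q * ∫⁻ y in q, ‖v x - v y‖ₑ ^ 2 ∂μ) + 2 * ‖∫ x in q, v x ∂μ‖ₑ ^ 2 := by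
    intro x
    have h1 : μ q * ‖v x‖ₑ ≤ ∫⁻ y in q, ‖v x - v y‖ₑ ∂μ + ‖∫ x in q, v x ∂μ‖ₑ := by
      have h2 : μ.real q * v x = ∫ y in q, (v x - v y) ∂μ + ∫ x in q, v x ∂μ := by
        rw [integral_sub (integrableOn_const (C := v x) hq_top (by simp)) hi]
        simp
      have h3 : μ q * ‖v x‖ₑ = ‖μ.real q * v x‖ₑ := by
        rw [enorm_mul, Real.enorm_of_nonneg measureReal_nonneg, ofReal_measureReal hq_top]
      rw [h3, h2]
      exact (enorm_add_le _ _).trans (by gcongr; exact enorm_integral_le_lintegral_enorm _)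
    calc μ q ^ 2 * ‖v x‖ₑ ^ 2 = (μ q * ‖v x‖ₑ) ^ 2 := (mul_pow _ _ _).symm
      _ ≤ (∫⁻ y in q, ‖v x - v y‖ₑ ∂μ + ‖∫ x in q, v x ∂μ‖ₑ) ^ 2 := by gcongr
      _ ≤ 2 * (∫⁻ y in q, ‖v x - v y‖ₑ ∂μ) ^ 2 + 2 * ‖∫ x in q, v x ∂μ‖ₑ ^ 2 := by
        rw [← mul_add]
        exact enn_add_sq_le _ _
      _ ≤ _ := by
        gcongr
        refine (sq_lintegral_le ((aemeasurable_const.sub hvm).enorm)).trans (le_of_eq ?_)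
        rw [Measure.restrict_apply_univ]
        rfl
  have hint : μ q ^ 2 * ∫⁻ x in q, ‖v x‖ₑ ^ 2 ∂μ ≤
      2 * (μ q * ∫⁻ x in q, ∫⁻ y in q, ‖v x - v y‖ₑ ^ 2 ∂μ ∂μ) +
        2 * ‖∫ x in q, v x ∂μ‖ₑ ^ 2 * μ q := by
    rw [← lintegral_const_mul' _ _ (ENNReal.pow_ne_top hq_top)]
    refine (lintegral_mono hpt).trans (le_of_eq ?_)
    rw [lintegral_add_right _ measurable_const, setLIntegral_const,
      lintegral_const_mul' _ _ (by simp), lintegral_const_mul' _ _ hq_top]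
  have hpair := lintegral_lintegral_enorm_sub_sq_le (μ := μ) hq hqm hd hv hv'
  have hcancel : ∀ a : ℝ≥0∞, (μ q)⁻¹ ^ 2 * (μ q ^ 2 * a) = a := fun a ↦ by
    rw [← mul_assoc, ← mul_pow, ENNReal.inv_mul_cancel h0 hq_top, one_pow, one_mul]
  have hcancel' : (μ q)⁻¹ * μ q = 1 := ENNReal.inv_mul_cancel h0 hq_top
  calc ∫⁻ x in q, ‖v x‖ₑ ^ 2 ∂μ = (μ q)⁻¹ ^ 2 * (μ q ^ 2 * ∫⁻ x in q, ‖v x‖ₑ ^ 2 ∂μ) :=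
        (hcancel _).symm
    _ ≤ (μ q)⁻¹ ^ 2 * (2 * (μ q * (d ^ 2 * (μ q * (2 ^ Module.finrank ℝ E *
          ∫⁻ x in q, ‖fderiv ℝ v x‖ₑ ^ 2 ∂μ)))) + 2 * ‖∫ x in q, v x ∂μ‖ₑ ^ 2 * μ q) := by
        gcongr
        exact hint.trans (by gcongr)
    _ = ((μ q)⁻¹ * μ q) ^ 2 * (2 ^ (Module.finrank ℝ E + 1) * d ^ 2 *
          ∫⁻ x in q, ‖fderiv ℝ v x‖ₑ ^ 2 ∂μ) +
        ((μ q)⁻¹ * μ q) * (2 * ((μ q)⁻¹ * ‖∫ x in q, v x ∂μ‖ₑ ^ 2)) := by ring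
    _ = _ := by rw [hcancel', one_pow, one_mul, one_mul]

end Poincare

/-! ### Discretization of functions on balls -/

section Cells

variable {n : ℕ}

/-- The cell with index `z` of the cubical grid of mesh `δ`. -/
def gridCell (δ : ℝ) (z : Fin n → ℤ) : Set (EuclideanSpace ℝ (Fin n)) :=
  {y | ∀ i, ⌊y i / δ⌋ = z i}

theorem gridCell_eq {δ : ℝ} (hδ : 0 < δ) (z : Fin n → ℤ) :
    gridCell δ z = ⋂ i, {y : EuclideanSpace ℝ (Fin n) | y i ∈ Ico (z i * δ) ((z i + 1) * δ)} := by
  ext y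
  simp only [gridCell, Set.mem_ofPred_eq, Set.mem_iInter, Set.mem_Ico, Int.floor_eq_iff,
    le_div_iff₀ hδ, div_lt_iff₀ hδ]

theorem measurableSet_gridCell {δ : ℝ} (hδ : 0 < δ) (z : Fin n → ℤ) :
    MeasurableSet (gridCell δ z) := by
  rw [gridCell_eq hδ]
  refine MeasurableSet.iInter fun i ↦ ?_
  exact (EuclideanSpace.proj (𝕜 := ℝ) i).continuous.measurable measurableSet_Ico

theorem convex_gridCell {δ : ℝ} (hδ : 0 < δ) (z : Fin n → ℤ) : Convex ℝ (gridCell δ z) := by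
  rw [gridCell_eq hδ]
  refine convex_iInter fun i ↦ ?_
  exact (convex_Ico _ _).linear_preimage (EuclideanSpace.proj (𝕜 := ℝ) i).toLinearMap

theorem norm_sub_le_of_mem_gridCell {δ : ℝ} (hδ : 0 < δ) {z : Fin n → ℤ}
    {x y : EuclideanSpace ℝ (Fin n)} (hx : x ∈ gridCell δ z) (hy : y ∈ gridCell δ z) :
    ‖x - y‖ ≤ n * δ := by
  rw [gridCell_eq hδ] at hx hy
  simp only [Set.mem_iInter, Set.mem_ofPred_eq, Set.mem_Ico] at hx hy
  have h1 : ∀ i, ‖(x - y) i‖ ≤ δ := fun i ↦ by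
    rw [PiLp.sub_apply, Real.norm_eq_abs, abs_le]
    constructor <;> linarith [(hx i).1, (hx i).2, (hy i).1, (hy i).2]
  rw [EuclideanSpace.norm_eq]
  refine Real.sqrt_le_iff.2 ⟨by positivity, ?_⟩
  calc ∑ i, ‖(x - y) i‖ ^ 2 ≤ ∑ _i : Fin n, δ ^ 2 := Finset.sum_le_sum fun i _ ↦ by
        gcongr
        exact h1 i
    _ = n * δ ^ 2 := by simp
    _ ≤ (n * δ) ^ 2 := by
        rw [mul_pow]
        gcongr
        exact_mod_cast Nat.le_self_pow two_ne_zero n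

theorem disjoint_gridCell {δ : ℝ} {z z' : Fin n → ℤ} (h : z ≠ z') :
    Disjoint (gridCell δ z) (gridCell δ z') :=
  Set.disjoint_left.2 fun _ h1 h2 ↦ h (funext fun i ↦ (h1 i).symm.trans (h2 i))

theorem finite_gridCell_inter {δ : ℝ} (hδ : 0 < δ) (x : EuclideanSpace ℝ (Fin n)) (r : ℝ) :
    {z : Fin n → ℤ | (gridCell δ z ∩ Metric.closedBall x r).Nonempty}.Finite := by
  refine (Set.finite_Icc (fun i ↦ ⌊(x i - r) / δ⌋) (fun i ↦ ⌊(x i + r) / δ⌋)).subset ?_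
  rintro z ⟨y, hy, hyr⟩
  have h1 : ∀ i, |y i - x i| ≤ r := fun i ↦ by
    rw [Metric.mem_closedBall, dist_eq_norm] at hyr
    exact (PiLp.norm_apply_le (y - x) i).trans hyr
  constructor <;> intro i <;> simp only [← hy i] <;> refine Int.floor_le_floor ?_ <;> gcongr <;>
    linarith [abs_le.1 (h1 i)]

/-- Functions on the ball of radius `2 r` whose `L²` norm and the `L²` norm of whose derivative are
at most `√C` are determined on the ball of radius `r`, up to an arbitrarily small error in `L²`, by
finitely many data: the rounded averages over the cells of a fine grid. -/
theorem exists_finite_discretization_ball (x : EuclideanSpace ℝ (Fin n)) {r : ℝ} (hr : 0 < r)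
    (C : ℝ≥0) {ε : ℝ≥0∞} (hε : 0 < ε) :
    ∃ (β : Type) (_ : Finite β) (F : (EuclideanSpace ℝ (Fin n) → ℝ) → β),
      ∀ v w : EuclideanSpace ℝ (Fin n) → ℝ, (∀ u ∈ ({v, w} : Set (EuclideanSpace ℝ (Fin n) → ℝ)),
        (∀ y ∈ Metric.closedBall x (2 * r), DifferentiableAt ℝ u y) ∧
        ContinuousOn (fderiv ℝ u) (Metric.closedBall x (2 * r)) ∧
        ∫⁻ y in Metric.closedBall x (2 * r), ‖u y‖ₑ ^ 2 ≤ C ∧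
        ∫⁻ y in Metric.closedBall x (2 * r), ‖fderiv ℝ u y‖ₑ ^ 2 ≤ C) → F v = F w →
      ∫⁻ y in Metric.closedBall x r, ‖v y - w y‖ₑ ^ 2 ≤ ε := by
  -- The diameter of the cells, small enough for the term with the derivative in the Poincaré
  -- inequality to be at most `ε / 2`.
  obtain ⟨d, hd0, hdr, hdε⟩ : ∃ d : ℝ≥0, 0 < d ∧ (d : ℝ) ≤ r ∧
      (2 : ℝ≥0∞) ^ (n + 1) * d ^ 2 * (4 * C) ≤ ε / 2 := by
    have h1 : Filter.Tendsto (fun d : ℝ≥0 ↦ (2 : ℝ≥0∞) ^ (n + 1) * d ^ 2 * (4 * C))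
        (𝓝[>] 0) (𝓝 0) := by
      have h2 : Filter.Tendsto (fun d : ℝ≥0 ↦ ((2 ^ (n + 1) * d ^ 2 * (4 * C) : ℝ≥0) : ℝ≥0∞))
          (𝓝 0) (𝓝 ((2 ^ (n + 1) * 0 ^ 2 * (4 * C) : ℝ≥0) : ℝ≥0∞)) :=
        Continuous.tendsto (by fun_prop) 0
      simpa using h2.mono_left nhdsWithin_le_nhds
    have h2 := h1.eventually (ge_mem_nhds (ENNReal.half_pos hε.ne'))
    have h3 : ∀ᶠ d : ℝ≥0 in 𝓝[>] 0, (d : ℝ) ≤ r :=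
      ((NNReal.continuous_coe.tendsto 0).mono_left nhdsWithin_le_nhds).eventually
        (ge_mem_nhds hr)
    obtain ⟨d, h4, h5, h6⟩ := (h2.and (h3.and self_mem_nhdsWithin)).exists
    exact ⟨d, h6, h5, h4⟩
  obtain ⟨δ, hδ, hδd⟩ : ∃ δ : ℝ, 0 < δ ∧ n * δ ≤ d := by
    refine ⟨d / (n + 1), by positivity, ?_⟩
    rw [mul_div_assoc', div_le_iff₀ (by positivity)]
    nlinarith [d.coe_nonneg]
  set Z := (finite_gridCell_inter hδ x r).toFinset
  have hZsub : ∀ z ∈ Z, gridCell δ z ⊆ Metric.closedBall x (2 * r) := by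
    intro z hz y hy
    obtain ⟨y', h1, h2⟩ := (Set.Finite.mem_toFinset _).1 hz
    have h3 := norm_sub_le_of_mem_gridCell hδ hy h1
    rw [← dist_eq_norm] at h3
    rw [Metric.mem_closedBall] at h2 ⊢
    linarith [dist_triangle y y' x]
  have hZcov : Metric.closedBall x r ⊆ ⋃ z ∈ Z, gridCell δ z := fun y hy ↦
    Set.mem_iUnion₂.2 ⟨fun i ↦ ⌊y i / δ⌋, (Set.Finite.mem_toFinset _).2 ⟨y, fun _ ↦ rfl, hy⟩,
      fun _ ↦ rfl⟩
  -- The precision to which the averages are recorded.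
  obtain ⟨η, hη0, hη⟩ : ∃ η : ℝ≥0, 0 < η ∧ (Z.card : ℝ≥0∞) * (2 * η ^ 2) ≤ ε / 2 := by
    have h1 : Filter.Tendsto (fun η : ℝ≥0 ↦ (Z.card : ℝ≥0∞) * (2 * η ^ 2)) (𝓝[>] 0) (𝓝 0) := by
      have h2 : Filter.Tendsto (fun η : ℝ≥0 ↦ ((Z.card * (2 * η ^ 2) : ℝ≥0) : ℝ≥0∞))
          (𝓝 0) (𝓝 ((Z.card * (2 * 0 ^ 2) : ℝ≥0) : ℝ≥0∞)) :=
        Continuous.tendsto (by fun_prop) 0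
      simpa using h2.mono_left nhdsWithin_le_nhds
    obtain ⟨η, h2, h3⟩ := ((h1.eventually (ge_mem_nhds (ENNReal.half_pos hε.ne'))).and
      self_mem_nhdsWithin).exists
    exact ⟨η, h3, h2⟩
  -- The averages are normalized so that `|A v z|` is at most the `L²` norm of `v` on the cell.
  let A : (EuclideanSpace ℝ (Fin n) → ℝ) → (Fin n → ℤ) → ℝ := fun v z ↦
    (Real.sqrt (volume.real (gridCell δ z)))⁻¹ * ∫ y in gridCell δ z, v y
  obtain ⟨N, hN0, hN⟩ : ∃ N : ℤ, 0 ≤ N ∧ Real.sqrt C / η + 1 ≤ N :=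
    ⟨⌈Real.sqrt C / η + 1⌉, Int.ceil_nonneg (by positivity), Int.le_ceil _⟩
  refine ⟨Z → Set.Icc (-N) N, inferInstance,
    fun v z ↦ Set.projIcc (-N) N (by linarith) ⌊A v z / η⌋, fun v w huv hF ↦ ?_⟩
  have hcell_top : ∀ z ∈ Z, volume (gridCell δ z) ≠ ⊤ := fun z hz ↦
    ((measure_mono (hZsub z hz)).trans_lt (isCompact_closedBall x (2 * r)).measure_lt_top).ne
  have hint : ∀ u ∈ ({v, w} : Set (EuclideanSpace ℝ (Fin n) → ℝ)), ∀ z ∈ Z,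
      IntegrableOn u (gridCell δ z) := fun u hu z hz ↦
    (ContinuousOn.integrableOn_compact (isCompact_closedBall x (2 * r)) fun y hy ↦
      ((huv u hu).1 y hy).continuousAt.continuousWithinAt).mono_set (hZsub z hz)
  have hA : ∀ u : EuclideanSpace ℝ (Fin n) → ℝ, ∀ z,
      (volume (gridCell δ z))⁻¹ * ‖∫ y in gridCell δ z, u y‖ₑ ^ 2 = ‖A u z‖ₑ ^ 2 ∨
        volume (gridCell δ z) = 0 ∨ volume (gridCell δ z) = ⊤ := by
    intro u z
    by_cases h0 : volume (gridCell δ z) = 0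
    · exact Or.inr (Or.inl h0)
    by_cases htop : volume (gridCell δ z) = ⊤
    · exact Or.inr (Or.inr htop)
    left
    have hpos : 0 < volume.real (gridCell δ z) := ENNReal.toReal_pos h0 htop
    rw [enorm_mul, mul_pow, ← enorm_pow _⁻¹, inv_pow, Real.sq_sqrt hpos.le, enorm_inv hpos.ne',
      Real.enorm_of_nonneg hpos.le, ofReal_measureReal htop]
  have hAbd : ∀ u ∈ ({v, w} : Set (EuclideanSpace ℝ (Fin n) → ℝ)), ∀ z ∈ Z,
      |A u z| ≤ Real.sqrt C := by
    intro u hu z hz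
    rcases hA u z with h | h | h
    · have h1 : ‖∫ y in gridCell δ z, u y‖ₑ ^ 2 ≤ volume (gridCell δ z) * C := by
        refine le_trans (pow_le_pow_left' (enorm_integral_le_lintegral_enorm _) 2) ?_
        refine (sq_lintegral_le (hint u hu z hz).aestronglyMeasurable.enorm).trans ?_
        rw [Measure.restrict_apply_univ]
        gcongr
        exact (lintegral_mono_set (hZsub z hz)).trans (huv u hu).2.2.1
      have h2 : ‖A u z‖ₑ ^ 2 ≤ C := by
        rw [← h]
        calc _ ≤ (volume (gridCell δ z))⁻¹ * (volume (gridCell δ z) * C) := by gcongr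
          _ ≤ C := by
            rw [← mul_assoc]
            exact mul_le_of_le_one_left' (ENNReal.inv_mul_le_one _)
      refine Real.abs_le_sqrt ?_
      rw [← enorm_pow, Real.enorm_of_nonneg (sq_nonneg _)] at h2
      exact (ENNReal.ofReal_le_iff_le_toReal ENNReal.coe_ne_top).1 h2
    · have : A u z = 0 := by simp [A, Measure.real, h]
      rw [this, abs_zero]
      positivity
    · exact absurd h (hcell_top z hz)
  have hclose : ∀ z ∈ Z, |A v z - A w z| ≤ η := by
    intro z hz
    have hmem : ∀ u ∈ ({v, w} : Set (EuclideanSpace ℝ (Fin n) → ℝ)),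
        ⌊A u z / η⌋ ∈ Set.Icc (-N) N := fun u hu ↦ by
      have h1 := abs_le.1 (hAbd u hu z hz)
      have hη' : (0 : ℝ) < η := hη0
      have h2 : A u z / η ≤ Real.sqrt C / η := by gcongr; exact h1.2
      have h3 : -(Real.sqrt C / η) ≤ A u z / η := by
        rw [← neg_div]
        gcongr
        exact h1.1
      constructor
      · rw [Int.le_floor]
        push_cast
        linarith
      · have := Int.floor_le (A u z / η)
        have h4 : ((⌊A u z / η⌋ : ℤ) : ℝ) ≤ (N : ℝ) := by linarith
        exact_mod_cast h4
    have h1 := congrFun hF ⟨z, hz⟩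
    simp only at h1
    rw [Set.projIcc_of_mem _ (hmem v (by simp)), Set.projIcc_of_mem _ (hmem w (by simp))] at h1
    have h2 := Int.abs_sub_lt_one_of_floor_eq_floor (Subtype.ext_iff.1 h1)
    rw [← sub_div, abs_div, div_lt_one (by positivity), abs_of_pos (show (0 : ℝ) < η from hη0)] at h2
    exact h2.le
  have hv := huv v (by simp)
  have hw := huv w (by simp)
  have hfd : ∀ y ∈ Metric.closedBall x (2 * r),
      fderiv ℝ (fun y ↦ v y - w y) y = fderiv ℝ v y - fderiv ℝ w y := fun y hy ↦
    fderiv_fun_sub (hv.1 y hy) (hw.1 y hy)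
  have hfdc : ContinuousOn (fderiv ℝ fun y ↦ v y - w y) (Metric.closedBall x (2 * r)) :=
    (hv.2.1.sub hw.2.1).congr hfd
  have hgrad : ∫⁻ y in Metric.closedBall x (2 * r), ‖fderiv ℝ (fun y ↦ v y - w y) y‖ₑ ^ 2 ≤
      4 * C := by
    calc ∫⁻ y in Metric.closedBall x (2 * r), ‖fderiv ℝ (fun y ↦ v y - w y) y‖ₑ ^ 2
        ≤ ∫⁻ y in Metric.closedBall x (2 * r), 2 * (‖fderiv ℝ v y‖ₑ ^ 2 + ‖fderiv ℝ w y‖ₑ ^ 2) := by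
          refine setLIntegral_mono' Metric.isClosed_closedBall.measurableSet fun y hy ↦ ?_
          rw [hfd y hy]
          exact (pow_le_pow_left' enorm_sub_le 2).trans (enn_add_sq_le _ _)
      _ ≤ 2 * (C + C) := by
          rw [lintegral_const_mul' _ _ (by simp), lintegral_add_left']
          · gcongr
            exacts [hv.2.2.2, hw.2.2.2]
          · exact (((ENNReal.continuous_pow 2).comp_continuousOn hv.2.1.enorm)).aemeasurable
              Metric.isClosed_closedBall.measurableSet
      _ = 4 * C := by ring
  have hcell : ∀ z ∈ Z, ∫⁻ y in gridCell δ z, ‖v y - w y‖ₑ ^ 2 ≤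
      2 ^ (n + 1) * d ^ 2 * (∫⁻ y in gridCell δ z, ‖fderiv ℝ (fun y ↦ v y - w y) y‖ₑ ^ 2) +
        2 * η ^ 2 := by
    intro z hz
    have hi : IntegrableOn (fun y ↦ v y - w y) (gridCell δ z) :=
      (hint v (by simp) z hz).sub (hint w (by simp) z hz)
    have h1 := lintegral_enorm_sq_le_poincare (μ := volume) (convex_gridCell hδ z)
      (measurableSet_gridCell hδ z) (hcell_top z hz) (d := d) (fun a ha b hb ↦ by
        rw [← ofReal_norm, ENNReal.ofReal_le_iff_le_toReal ENNReal.coe_ne_top]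
        exact (norm_sub_le_of_mem_gridCell hδ ha hb).trans hδd)
      (fun y hy ↦ (hv.1 y (hZsub z hz hy)).fun_sub (hw.1 y (hZsub z hz hy)))
      (hfdc.mono (hZsub z hz)) hi
    rw [finrank_euclideanSpace_fin] at h1
    rcases hA (fun y ↦ v y - w y) z with h | h | h
    · rw [h] at h1
      refine h1.trans ?_
      gcongr
      have h2 : A (fun y ↦ v y - w y) z = A v z - A w z := by
        simp only [A]
        rw [integral_sub (hint v (by simp) z hz) (hint w (by simp) z hz), mul_sub]
      rw [h2, ← ofReal_norm, ENNReal.ofReal_le_iff_le_toReal ENNReal.coe_ne_top]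
      exact hclose z hz
    · rw [setLIntegral_measure_zero _ _ h]
      exact zero_le
    · exact absurd h (hcell_top z hz)
  calc ∫⁻ y in Metric.closedBall x r, ‖v y - w y‖ₑ ^ 2
      ≤ ∫⁻ y in ⋃ z ∈ Z, gridCell δ z, ‖v y - w y‖ₑ ^ 2 := lintegral_mono_set hZcov
    _ ≤ ∑ z ∈ Z, ∫⁻ y in gridCell δ z, ‖v y - w y‖ₑ ^ 2 := by
        rw [lintegral_biUnion_finset (fun z _ z' _ h ↦ disjoint_gridCell h)
          fun z _ ↦ measurableSet_gridCell hδ z]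
    _ ≤ ∑ z ∈ Z, (2 ^ (n + 1) * d ^ 2 *
          (∫⁻ y in gridCell δ z, ‖fderiv ℝ (fun y ↦ v y - w y) y‖ₑ ^ 2) + 2 * η ^ 2) :=
        Finset.sum_le_sum hcell
    _ = 2 ^ (n + 1) * d ^ 2 *
          (∫⁻ y in ⋃ z ∈ Z, gridCell δ z, ‖fderiv ℝ (fun y ↦ v y - w y) y‖ₑ ^ 2) +
          Z.card * (2 * η ^ 2) := by
        rw [Finset.sum_add_distrib, ← Finset.mul_sum, lintegral_biUnion_finset
          (fun z _ z' _ h ↦ disjoint_gridCell h) fun z _ ↦ measurableSet_gridCell hδ z]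
        simp
    _ ≤ 2 ^ (n + 1) * d ^ 2 * (4 * C) + Z.card * (2 * η ^ 2) := by
        gcongr
        exact (lintegral_mono_set (Set.iUnion₂_subset hZsub)).trans hgrad
    _ ≤ ε / 2 + ε / 2 := add_le_add hdε hη
    _ = ε := ENNReal.add_halves ε

end Cells

/-! ### Rellich's theorem -/

section Rellich

theorem eLpNorm_two_sq {α F : Type*} [MeasurableSpace α] [NormedAddCommGroup F] {μ : Measure α}
    (f : α → F) : eLpNorm f 2 μ ^ 2 = ∫⁻ a, ‖f a‖ₑ ^ 2 ∂μ := by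
  have h := eLpNorm_nnreal_pow_eq_lintegral (f := f) (μ := μ) (p := 2) two_ne_zero
  simpa using h

theorem tendsto_lintegral_sq_iff {α F : Type*} [MeasurableSpace α] [NormedAddCommGroup F]
    {μ : Measure α} {f : ℕ → α → F} :
    Filter.Tendsto (fun k ↦ ∫⁻ a, ‖f k a‖ₑ ^ 2 ∂μ) Filter.atTop (𝓝 0) ↔
      Filter.Tendsto (fun k ↦ eLpNorm (f k) 2 μ) Filter.atTop (𝓝 0) := by
  simp only [← eLpNorm_two_sq]
  refine ⟨tendsto_zero_of_sq, fun h ↦ ?_⟩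
  simpa [Function.comp_def] using ((ENNReal.continuous_pow 2).tendsto 0).comp h

variable {n : ℕ} {M : Type*} [TopologicalSpace M] [ChartedSpace (EuclideanSpace ℝ (Fin n)) M]
  [RiemannianBundle (fun p : M ↦ TangentSpace (𝓡 n) p)] [IsManifold (𝓡 n) ∞ M]
  [MeasurableSpace M] [BorelSpace M]
  [IsContMDiffRiemannianBundle (𝓡 n) ∞ (EuclideanSpace ℝ (Fin n))
      (fun p : M ↦ TangentSpace (𝓡 n) p)]
  {e : OpenPartialHomeomorph M (EuclideanSpace ℝ (Fin n))} {φ : M → ℝ}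

theorem continuous_norm_grad (hφ : ContMDiff (𝓡 n) 𝓘(ℝ, ℝ) ∞ φ) :
    Continuous (fun p ↦ ‖grad n φ p‖) := by
  refine continuous_iff_continuousAt.2 fun p ↦ ?_
  have he := chart_mem_atlas (EuclideanSpace ℝ (Fin n)) p
  have hp := mem_chart_source (EuclideanSpace ℝ (Fin n)) p
  set e := chartAt (EuclideanSpace ℝ (Fin n)) p
  have h1 : ContinuousOn (fun y ↦ ‖grad n φ (e.symm y)‖) e.target := by
    have h2 : ∀ i : Fin n, ContinuousOn (fun y ↦ (inner ℝ (grad n φ (e.symm y))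
        (coordVec n e y (EuclideanSpace.single i 1)) : ℝ)) e.target := fun i ↦
      ((continuousOn_fderiv_comp_symm he hφ).clm_apply continuousOn_const).congr
        fun y hy ↦ inner_grad_coordVec he hφ hy _
    have h3 : ContinuousOn (fun y ↦ Real.sqrt
        ((fun i ↦ inner ℝ (grad n φ (e.symm y)) (coordVec n e y (EuclideanSpace.single i 1))) ⬝ᵥ
        Matrix.mulVec (metricMatrix n e y)⁻¹
        (fun i ↦ inner ℝ (grad n φ (e.symm y)) (coordVec n e y (EuclideanSpace.single i 1)))))
        e.target := by
      simp only [dotProduct, Matrix.mulVec]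
      refine ContinuousOn.sqrt (continuousOn_finsetSum _ fun i _ ↦ (h2 i).mul
        (continuousOn_finsetSum _ fun j _ ↦ ContinuousOn.mul ?_ (h2 j)))
      exact (continuous_apply_apply i j).comp_continuousOn (continuousOn_inv_metricMatrix he)
    refine h3.congr fun y hy ↦ ?_
    beta_reduce
    rw [← norm_sq_eq_dotProduct_inv he hy, Real.sqrt_sq (norm_nonneg _)]
  have h4 : ContinuousOn (fun q ↦ ‖grad n φ (e.symm (e q))‖) e.source :=
    h1.comp e.continuousOn fun q hq ↦ e.map_source hq
  have h5 : ContinuousOn (fun q ↦ ‖grad n φ q‖) e.source := h4.congr fun q hq ↦ by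
    beta_reduce
    rw [e.left_inv hq]
  exact h5.continuousAt (e.open_source.mem_nhds hp)

variable [CompactSpace M]

theorem memLp_of_continuous {f : M → ℝ} (hf : Continuous f) : MemLp f 2 (vol n M) := by
  obtain ⟨C, hC⟩ := isCompact_univ.exists_bound_of_continuousOn hf.continuousOn
  exact MemLp.of_bound hf.aestronglyMeasurable C (ae_of_all _ fun p ↦ hC p (mem_univ p))

theorem lintegral_sq_lt_top {F : Type*} [NormedAddCommGroup F] {f : M → F}
    (hf : MemLp f 2 (vol n M)) : ∫⁻ p, ‖f p‖ₑ ^ 2 ∂(vol n M) < ⊤ := by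
  rw [← eLpNorm_two_sq]
  exact ENNReal.pow_lt_top hf.2

theorem memLp_norm_grad (hφ : ContMDiff (𝓡 n) 𝓘(ℝ, ℝ) ∞ φ) :
    MemLp (fun p ↦ ‖grad n φ p‖) 2 (vol n M) :=
  memLp_of_continuous (continuous_norm_grad hφ)

omit [CompactSpace M] in
theorem exists_enorm_fderiv_le (he : e ∈ atlas (EuclideanSpace ℝ (Fin n)) M)
    {K : Set (EuclideanSpace ℝ (Fin n))} (hK : IsCompact K) (hKe : K ⊆ e.target) :
    ∃ b : ℝ≥0, ∀ φ : M → ℝ, ContMDiff (𝓡 n) 𝓘(ℝ, ℝ) ∞ φ → ∀ y ∈ K,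
      ‖fderiv ℝ (fun z ↦ φ (e.symm z)) y‖ₑ ≤ b * ‖grad n φ (e.symm y)‖ₑ := by
  have h1 : ∀ i : Fin n, ∃ b : ℝ, ∀ y ∈ K, ‖coordVec n e y (EuclideanSpace.single i 1)‖ ≤ b := by
    intro i
    obtain ⟨b, hb⟩ := (hK.image_of_continuousOn
      ((continuousOn_norm_coordVec he (EuclideanSpace.single i 1)).mono hKe)).bddAbove
    exact ⟨b, fun y hy ↦ hb ⟨y, hy, rfl⟩⟩
  choose b hb using h1
  refine ⟨(∑ i, b i).toNNReal, fun φ hφ y hy ↦ ?_⟩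
  have hb0 : ∀ i, 0 ≤ b i := fun i ↦ (norm_nonneg _).trans (hb i y hy)
  have h2 : ‖fderiv ℝ (fun z ↦ φ (e.symm z)) y‖ ≤ (∑ i, b i) * ‖grad n φ (e.symm y)‖ := by
    refine ContinuousLinearMap.opNorm_le_bound _ (mul_nonneg (Finset.sum_nonneg fun i _ ↦ hb0 i)
      (norm_nonneg _)) fun v ↦ ?_
    rw [← inner_grad_coordVec he hφ (hKe hy)]
    refine (norm_inner_le_norm _ _).trans ?_
    have h3 : ‖coordVec n e y v‖ ≤ (∑ i, b i) * ‖v‖ := by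
      rw [coordVec_eq_sum, Finset.sum_mul]
      refine (norm_sum_le _ _).trans (Finset.sum_le_sum fun i _ ↦ ?_)
      rw [norm_smul, mul_comm]
      exact mul_le_mul (hb i y hy) (PiLp.norm_apply_le v i) (norm_nonneg _) (hb0 i)
    calc _ ≤ ‖grad n φ (e.symm y)‖ * ((∑ i, b i) * ‖v‖) := by gcongr
      _ = _ := by ring
  rw [← ofReal_norm, ← ofReal_norm, ← ENNReal.ofReal, ← ENNReal.ofReal_mul
    (Finset.sum_nonneg fun i _ ↦ hb0 i)]
  exact ENNReal.ofReal_le_ofReal h2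

/-- The `H¹` ball of smooth functions is determined, up to an arbitrarily small error in `L²`, by
finitely many data: those of the functions in the charts of a finite cover by coordinate balls. -/
theorem exists_finite_discretization (n : ℕ) (M : Type*) [TopologicalSpace M]
    [ChartedSpace (EuclideanSpace ℝ (Fin n)) M]
    [RiemannianBundle (fun p : M ↦ TangentSpace (𝓡 n) p)] [IsManifold (𝓡 n) ∞ M]
    [MeasurableSpace M] [BorelSpace M]
    [IsContMDiffRiemannianBundle (𝓡 n) ∞ (EuclideanSpace ℝ (Fin n))
      (fun p : M ↦ TangentSpace (𝓡 n) p)] [CompactSpace M] (C : ℝ≥0) {ε : ℝ≥0∞} (hε : 0 < ε) :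
    ∃ (β : Type) (_ : Finite β) (F : (M → ℝ) → β), ∀ φ ψ : M → ℝ,
      (∀ u ∈ ({φ, ψ} : Set (M → ℝ)), ContMDiff (𝓡 n) 𝓘(ℝ, ℝ) ∞ u ∧
        ∫⁻ p, ‖u p‖ₑ ^ 2 ∂(vol n M) ≤ C ∧ ∫⁻ p, ‖grad n u p‖ₑ ^ 2 ∂(vol n M) ≤ C) → F φ = F ψ →
      ∫⁻ p, ‖φ p - ψ p‖ₑ ^ 2 ∂(vol n M) ≤ ε := by
  obtain ⟨t, r, hr, hrt, ht⟩ := exists_finite_ball_cover n M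
  have hrt' : ∀ p, Metric.closedBall (chartAt (EuclideanSpace ℝ (Fin n)) p p) (r p) ⊆
      (chartAt (EuclideanSpace ℝ (Fin n)) p).target := fun p ↦
    (Metric.closedBall_subset_closedBall (by linarith [hr p])).trans (hrt p)
  have hloc : ∀ p : M, ∃ (β : Type) (_ : Finite β) (F : (M → ℝ) → β), ∀ φ ψ : M → ℝ,
      (∀ u ∈ ({φ, ψ} : Set (M → ℝ)), ContMDiff (𝓡 n) 𝓘(ℝ, ℝ) ∞ u ∧
        ∫⁻ p, ‖u p‖ₑ ^ 2 ∂(vol n M) ≤ C ∧ ∫⁻ p, ‖grad n u p‖ₑ ^ 2 ∂(vol n M) ≤ C) → F φ = F ψ →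
      ∫⁻ q in (chartAt (EuclideanSpace ℝ (Fin n)) p).symm ''
        Metric.closedBall (chartAt (EuclideanSpace ℝ (Fin n)) p p) (r p), ‖φ q - ψ q‖ₑ ^ 2
          ∂(vol n M) ≤ ε / (t.card + 1) := by
    intro p
    have he := chart_mem_atlas (EuclideanSpace ℝ (Fin n)) p
    have hp := hrt p
    have hp' := hrt' p
    set e := chartAt (EuclideanSpace ℝ (Fin n)) p
    obtain ⟨C₁, hC₁⟩ := exists_sq_lintegral_chart_le he (isCompact_closedBall (e p) (2 * r p)) hp
    obtain ⟨C₂, hC₂⟩ := exists_vol_restrict_le he (isCompact_closedBall (e p) (r p)) hp'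
    obtain ⟨b, hb⟩ := exists_enorm_fderiv_le he (isCompact_closedBall (e p) (2 * r p)) hp
    have hε' : 0 < ε / (t.card + 1) / (C₂ + 1) := by
      refine ENNReal.div_pos (ENNReal.div_pos hε.ne' ?_).ne' ?_ <;> finiteness
    obtain ⟨β, hβ, F, hF⟩ := exists_finite_discretization_ball (e p) (hr p)
      (C₁ * C + b ^ 2 * (C₁ * C)) hε'
    refine ⟨β, hβ, fun u ↦ F fun y ↦ u (e.symm y), fun φ ψ huv hFeq ↦ ?_⟩
    have h1 := hF (fun y ↦ φ (e.symm y)) (fun y ↦ ψ (e.symm y)) (fun v hv ↦ ?_) hFeq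
    · refine (lintegral_mono' hC₂ le_rfl).trans ?_
      rw [lintegral_smul_measure]
      refine (mul_le_mul_right ((lintegral_map_le (fun q ↦ ‖φ q - ψ q‖ₑ ^ 2) e.symm).trans h1)
        (C₂ : ℝ≥0∞)).trans ?_
      calc (C₂ : ℝ≥0∞) * (ε / (t.card + 1) / (C₂ + 1))
          ≤ (C₂ + 1) * (ε / (t.card + 1) / (C₂ + 1)) := by
            gcongr
            exact le_self_add
        _ ≤ _ := ENNReal.mul_div_le
    · obtain ⟨u, hu, rfl⟩ : ∃ u ∈ ({φ, ψ} : Set (M → ℝ)), (fun y ↦ u (e.symm y)) = v := by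
        rcases hv with rfl | rfl
        · exact ⟨φ, by simp, rfl⟩
        · exact ⟨ψ, by simp, rfl⟩
      obtain ⟨hu1, hu2, hu3⟩ := huv u hu
      refine ⟨fun y hy ↦ ?_, (continuousOn_fderiv_comp_symm he hu1).mono hp, ?_, ?_⟩
      · exact ((contDiffOn_comp_symm he hu1).differentiableOn (by simp)).differentiableAt
          (e.open_target.mem_nhds (hp hy))
      · refine ((hC₁ (fun q ↦ ‖u q‖ₑ) hu1.continuous.enorm.measurable.aemeasurable).1).trans ?_
        push_cast
        exact (mul_le_mul_right hu2 _).trans le_self_add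
      · calc ∫⁻ y in Metric.closedBall (e p) (2 * r p), ‖fderiv ℝ (fun z ↦ u (e.symm z)) y‖ₑ ^ 2
            ≤ ∫⁻ y in Metric.closedBall (e p) (2 * r p), b ^ 2 * ‖grad n u (e.symm y)‖ₑ ^ 2 := by
              refine setLIntegral_mono' Metric.isClosed_closedBall.measurableSet fun y hy ↦ ?_
              rw [← mul_pow]
              exact pow_le_pow_left' (hb u hu1 y hy) 2
          _ ≤ b ^ 2 * (C₁ * C) := by
              rw [lintegral_const_mul' _ _ (by finiteness)]
              gcongr
              exact ((hC₁ (fun q ↦ ‖grad n u q‖ₑ)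
                (isWeakGradient_grad hu1).measurableSection.aemeasurable_enorm).1).trans
                (mul_le_mul_right hu3 _)
          _ ≤ _ := by
              push_cast
              exact le_add_self
  choose β hβ F hF using hloc
  refine ⟨(i : Fin t.card) → β (t.equivFin.symm i), inferInstance, fun u i ↦ F _ u,
    fun φ ψ huv hFeq ↦ ?_⟩
  calc ∫⁻ p, ‖φ p - ψ p‖ₑ ^ 2 ∂(vol n M)
      ≤ ∫⁻ q in ⋃ p ∈ t, (chartAt (EuclideanSpace ℝ (Fin n)) p).symm ''
          Metric.closedBall (chartAt (EuclideanSpace ℝ (Fin n)) p p) (r p),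
          ‖φ q - ψ q‖ₑ ^ 2 ∂(vol n M) := by
        rw [← setLIntegral_univ]
        refine lintegral_mono_set (ht.trans ?_)
        exact Set.iUnion₂_mono fun p _ ↦ Set.image_mono Metric.ball_subset_closedBall
    _ ≤ ∑ p ∈ t, ∫⁻ q in (chartAt (EuclideanSpace ℝ (Fin n)) p).symm ''
          Metric.closedBall (chartAt (EuclideanSpace ℝ (Fin n)) p p) (r p),
          ‖φ q - ψ q‖ₑ ^ 2 ∂(vol n M) := by
        refine (lintegral_mono_set (t := ⋃ p : t, (chartAt (EuclideanSpace ℝ (Fin n)) (p : M)).symm ''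
          Metric.closedBall (chartAt (EuclideanSpace ℝ (Fin n)) (p : M) p) (r p))
          (Set.iUnion₂_subset fun p hp ↦ Set.subset_iUnion_of_subset ⟨p, hp⟩ subset_rfl)).trans ?_
        refine (lintegral_iUnion_le _ _).trans (le_of_eq ?_)
        exact Finset.tsum_subtype t fun p ↦ ∫⁻ q in (chartAt (EuclideanSpace ℝ (Fin n)) p).symm ''
          Metric.closedBall (chartAt (EuclideanSpace ℝ (Fin n)) p p) (r p),
          ‖φ q - ψ q‖ₑ ^ 2 ∂(vol n M)
    _ ≤ ∑ p ∈ t, ε / (t.card + 1) := Finset.sum_le_sum fun p hp ↦ by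
        obtain ⟨i, rfl⟩ : ∃ i, (t.equivFin.symm i : M) = p := ⟨t.equivFin ⟨p, hp⟩, by simp⟩
        exact hF _ φ ψ huv (congrFun hFeq i)
    _ ≤ (t.card + 1) * (ε / (t.card + 1)) := by
        rw [Finset.sum_const, nsmul_eq_mul]
        gcongr
        exact le_self_add
    _ ≤ ε := ENNReal.mul_div_le

/-- **Rellich's theorem** for smooth functions: a sequence that is bounded in `H¹` has a
subsequence that converges in `L²`. By the finite discretizations, the sequence is totally bounded
in `L²`. -/
theorem exists_subseq_tendsto_L2 {φ : ℕ → M → ℝ} (hφ : ∀ k, ContMDiff (𝓡 n) 𝓘(ℝ, ℝ) ∞ (φ k))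
    {C : ℝ≥0} (h0 : ∀ k, ∫⁻ p, ‖φ k p‖ₑ ^ 2 ∂(vol n M) ≤ C)
    (h1 : ∀ k, ∫⁻ p, ‖grad n (φ k) p‖ₑ ^ 2 ∂(vol n M) ≤ C) :
    ∃ (σ : ℕ → ℕ) (u : M → ℝ), StrictMono σ ∧ MemLp u 2 (vol n M) ∧
      Filter.Tendsto (fun k ↦ ∫⁻ p, ‖φ (σ k) p - u p‖ₑ ^ 2 ∂(vol n M)) Filter.atTop (𝓝 0) := by
  have hm : ∀ k, MemLp (φ k) 2 (vol n M) := fun k ↦ memLp_of_continuous (hφ k).continuous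
  have htb : TotallyBounded (Set.range fun k ↦ (hm k).toLp (φ k)) := by
    refine EMetric.totallyBounded_iff.2 fun ε hε ↦ ?_
    obtain ⟨δ, hδ0, hδε⟩ := ENNReal.lt_iff_exists_nnreal_btwn.1 hε
    have hδ0' : (0 : ℝ≥0∞) < δ ^ 2 := ENNReal.pow_pos hδ0 2
    obtain ⟨β, hβ, F, hF⟩ := exists_finite_discretization n M C hδ0'
    have hfin : (Set.range fun k ↦ F (φ k)).Finite := Set.toFinite _
    have hch : ∀ b : Set.range fun k ↦ F (φ k), ∃ k, F (φ k) = b := fun b ↦ b.2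
    choose κ hκ using hch
    have : Finite (Set.range fun k ↦ F (φ k)) := hfin
    refine ⟨Set.range fun b ↦ (hm (κ b)).toLp (φ (κ b)), Set.finite_range _, ?_⟩
    rintro _ ⟨k, rfl⟩
    refine Set.mem_iUnion₂.2 ⟨_, ⟨⟨F (φ k), k, rfl⟩, rfl⟩, ?_⟩
    rw [Metric.mem_eball, Lp.edist_toLp_toLp]
    refine lt_of_le_of_lt ?_ hδε
    refine (ENNReal.pow_le_pow_left_iff two_ne_zero).1 ?_
    rw [eLpNorm_two_sq]
    refine hF _ _ ?_ (hκ ⟨F (φ k), k, rfl⟩).symm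
    rintro u (rfl | rfl) <;> exact ⟨hφ _, h0 _, h1 _⟩
  have hcpt : IsCompact (closure (Set.range fun k ↦ (hm k).toLp (φ k))) :=
    htb.closure.isCompact_of_isClosed isClosed_closure
  obtain ⟨f, -, σ, hσ, hlim⟩ := hcpt.tendsto_subseq fun k ↦ subset_closure ⟨k, rfl⟩
  refine ⟨σ, f, hσ, Lp.memLp f, ?_⟩
  rw [tendsto_lintegral_sq_iff]
  rw [Lp.tendsto_Lp_iff_tendsto_eLpNorm'] at hlim
  refine hlim.congr fun k ↦ eLpNorm_congr_ae ?_
  filter_upwards [(hm (σ k)).coeFn_toLp] with p hp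
  simp [hp]

end Rellich

/-! ### Convergence of series in `H¹` -/

section Completeness

theorem eLpNorm_two_sq_ennreal {α : Type*} [MeasurableSpace α] {μ : Measure α}
    (f : α → ℝ≥0∞) : eLpNorm f 2 μ ^ 2 = ∫⁻ a, f a ^ 2 ∂μ := by
  have h := eLpNorm_nnreal_pow_eq_lintegral (f := f) (μ := μ) (p := 2) two_ne_zero
  simpa using h

/-- The countable Minkowski inequality in `L²`. -/
theorem eLpNorm_tsum_le {α : Type*} [MeasurableSpace α] {μ : Measure α} {a : ℕ → α → ℝ≥0∞}
    (ha : ∀ k, AEMeasurable (a k) μ) :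
    eLpNorm (fun p ↦ ∑' k, a k p) 2 μ ≤ ∑' k, eLpNorm (a k) 2 μ := by
  have h1 : Filter.Tendsto (fun N ↦ ∫⁻ p, (∑ k ∈ Finset.range N, a k p) ^ 2 ∂μ) Filter.atTop
      (𝓝 (∫⁻ p, (∑' k, a k p) ^ 2 ∂μ)) := by
    refine lintegral_tendsto_of_tendsto_of_monotone (fun N ↦ ?_) (ae_of_all _ fun p ↦ ?_)
      (ae_of_all _ fun p ↦ ?_)
    · exact (Finset.aemeasurable_fun_sum _ fun k _ ↦ ha k).pow_const 2
    · intro i j hij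
      exact pow_le_pow_left' (Finset.sum_le_sum_of_subset (Finset.range_mono hij)) 2
    · exact ((ENNReal.continuous_pow 2).tendsto _).comp (ENNReal.tendsto_nat_tsum fun k ↦ a k p)
  refine (ENNReal.pow_le_pow_left_iff two_ne_zero).1 ?_
  rw [eLpNorm_two_sq_ennreal]
  refine le_of_tendsto' h1 fun N ↦ ?_
  rw [← eLpNorm_two_sq_ennreal]
  refine pow_le_pow_left' ?_ 2
  have h2 : (fun p ↦ ∑ k ∈ Finset.range N, a k p) = ∑ k ∈ Finset.range N, a k := by
    ext p
    rw [Finset.sum_apply]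
  rw [h2]
  exact (eLpNorm_sum_le (fun k _ ↦ (ha k).aestronglyMeasurable) (by norm_num)).trans
    (ENNReal.sum_le_tsum _)

variable {n : ℕ} {M : Type*} [TopologicalSpace M] [ChartedSpace (EuclideanSpace ℝ (Fin n)) M]
  [RiemannianBundle (fun p : M ↦ TangentSpace (𝓡 n) p)] [IsManifold (𝓡 n) ∞ M]
  [MeasurableSpace M] [BorelSpace M]
  [IsContMDiffRiemannianBundle (𝓡 n) ∞ (EuclideanSpace ℝ (Fin n))
      (fun p : M ↦ TangentSpace (𝓡 n) p)]

/-- The norm `‖φ‖_{L²} + ‖∇φ‖_{L²}` of a smooth function, which is equivalent to the `H¹` norm and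
subadditive. -/
def h1Norm (n : ℕ) {M : Type*} [TopologicalSpace M] [ChartedSpace (EuclideanSpace ℝ (Fin n)) M]
    [RiemannianBundle (fun p : M ↦ TangentSpace (𝓡 n) p)] [MeasurableSpace M] (φ : M → ℝ) :
    ℝ≥0∞ :=
  eLpNorm (fun p ↦ ‖φ p‖ₑ) 2 (vol n M) + eLpNorm (fun p ↦ ‖grad n φ p‖ₑ) 2 (vol n M)

theorem contMDiff_sum {f : ℕ → M → ℝ} (hf : ∀ k, ContMDiff (𝓡 n) 𝓘(ℝ, ℝ) ∞ (f k)) (N : ℕ) :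
    ContMDiff (𝓡 n) 𝓘(ℝ, ℝ) ∞ (fun p ↦ ∑ k ∈ Finset.range N, f k p) := by
  induction N with
  | zero => simpa using contMDiff_const
  | succ N ih =>
    simp only [Finset.sum_range_succ]
    exact ih.add (hf N)

theorem grad_sum {f : ℕ → M → ℝ} (hf : ∀ k, ContMDiff (𝓡 n) 𝓘(ℝ, ℝ) ∞ (f k)) (N : ℕ) (p : M) :
    grad n (fun p ↦ ∑ k ∈ Finset.range N, f k p) p = ∑ k ∈ Finset.range N, grad n (f k) p := by
  induction N with
  | zero =>
    refine ext_inner_right ℝ fun Z ↦ ?_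
    simp [inner_grad, mfderiv_const]
    rfl
  | succ N ih =>
    simp only [Finset.sum_range_succ]
    rw [grad_add (contMDiff_sum hf N) (hf N), ih]

variable [CompactSpace M]

theorem h1Norm_ne_top {φ : M → ℝ} (hφ : ContMDiff (𝓡 n) 𝓘(ℝ, ℝ) ∞ φ) : h1Norm n φ ≠ ⊤ := by
  refine ENNReal.add_ne_top.2 ⟨?_, ?_⟩
  · rw [eLpNorm_enorm]
    exact (memLp_of_continuous hφ.continuous).2.ne
  · have h := (memLp_norm_grad hφ).2.ne
    rw [← eLpNorm_enorm] at h
    simpa using h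

/-- An absolutely convergent series of smooth functions in `H¹` converges. -/
theorem exists_h1_limit {f : ℕ → M → ℝ} (hf : ∀ k, ContMDiff (𝓡 n) 𝓘(ℝ, ℝ) ∞ (f k))
    (hsum : ∑' k, h1Norm n (f k) ≠ ⊤) :
    ∃ X : (p : M) → TangentSpace (𝓡 n) p, IsWeakGradient n (fun p ↦ ∑' k, f k p) X ∧
      MemLp (fun p ↦ ∑' k, f k p) 2 (vol n M) ∧ MemLp (fun p ↦ ‖X p‖) 2 (vol n M) ∧
      (∀ᵐ p ∂(vol n M), Summable fun k ↦ f k p) ∧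
      Filter.Tendsto (fun N ↦ ∫⁻ p, ‖∑ k ∈ Finset.range N, f k p - ∑' k, f k p‖ₑ ^ 2 ∂(vol n M))
        Filter.atTop (𝓝 0) ∧
      Filter.Tendsto (fun N ↦ ∫⁻ p, ‖grad n (fun p ↦ ∑ k ∈ Finset.range N, f k p) p - X p‖ₑ ^ 2
        ∂(vol n M)) Filter.atTop (𝓝 0) ∧
      h1NormSq n (fun p ↦ ∑' k, f k p) ≤ (∑' k, h1Norm n (f k)) ^ 2 := by
  have hm1 : ∀ k, AEMeasurable (fun p ↦ ‖f k p‖ₑ) (vol n M) := fun k ↦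
    (hf k).continuous.enorm.measurable.aemeasurable
  have hm2 : ∀ k, AEMeasurable (fun p ↦ ‖grad n (f k) p‖ₑ) (vol n M) := fun k ↦
    (isWeakGradient_grad (hf k)).measurableSection.aemeasurable_enorm
  have hs1 : ∑' k, eLpNorm (fun p ↦ ‖f k p‖ₑ) 2 (vol n M) ≠ ⊤ :=
    ne_top_of_le_ne_top hsum (ENNReal.tsum_le_tsum fun k ↦ le_self_add)
  have hs2 : ∑' k, eLpNorm (fun p ↦ ‖grad n (f k) p‖ₑ) 2 (vol n M) ≠ ⊤ :=
    ne_top_of_le_ne_top hsum (ENNReal.tsum_le_tsum fun k ↦ le_add_self)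
  have hfin : ∀ a : ℕ → M → ℝ≥0∞, (∀ k, AEMeasurable (a k) (vol n M)) →
      ∑' k, eLpNorm (a k) 2 (vol n M) ≠ ⊤ → ∀ᵐ p ∂(vol n M), ∑' k, a k p ≠ ⊤ := by
    intro a ha hs
    have h1 : ∫⁻ p, (∑' k, a k p) ^ 2 ∂(vol n M) ≠ ⊤ := by
      rw [← eLpNorm_two_sq_ennreal]
      exact ENNReal.pow_ne_top (ne_top_of_le_ne_top hs (eLpNorm_tsum_le ha))
    filter_upwards [ae_lt_top' ((AEMeasurable.tsum ha).pow_const 2) h1] with p hp h2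
    simp [h2] at hp
  have hf1 := hfin _ hm1 hs1
  have hf2 := hfin _ hm2 hs2
  have htail : ∀ a : ℕ → M → ℝ≥0∞, (∀ k, AEMeasurable (a k) (vol n M)) →
      ∑' k, eLpNorm (a k) 2 (vol n M) ≠ ⊤ →
      Filter.Tendsto (fun N ↦ ∫⁻ p, (∑' k, a (k + N) p) ^ 2 ∂(vol n M)) Filter.atTop (𝓝 0) := by
    intro a ha hs
    have h1 := ((ENNReal.continuous_pow 2).tendsto 0).comp (ENNReal.tendsto_sum_nat_add _ hs)
    rw [zero_pow two_ne_zero] at h1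
    refine tendsto_of_tendsto_of_tendsto_of_le_of_le tendsto_const_nhds h1 (fun _ ↦ zero_le)
      fun N ↦ ?_
    simp only [Function.comp]
    rw [← eLpNorm_two_sq_ennreal]
    exact pow_le_pow_left' (eLpNorm_tsum_le fun k ↦ ha (k + N)) 2
  set X : (p : M) → TangentSpace (𝓡 n) p := fun p ↦ ∑' k, grad n (f k) p
  have hX : ∀ᵐ p ∂(vol n M), Summable fun k ↦ grad n (f k) p := by
    filter_upwards [hf2] with p hp using Summable.of_enorm hp
  have hu : ∀ᵐ p ∂(vol n M), Summable fun k ↦ f k p := by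
    filter_upwards [hf1] with p hp using Summable.of_enorm hp
  have hum : AEStronglyMeasurable (fun p ↦ ∑' k, f k p) (vol n M) := by
    refine aestronglyMeasurable_of_tendsto_ae Filter.atTop
      (fun N ↦ (contMDiff_sum hf N).continuous.aestronglyMeasurable) ?_
    filter_upwards [hu] with p hp using hp.hasSum.tendsto_sum_nat
  have hXm : MeasurableSection X := by
    refine MeasurableSection.of_tendsto
      (fun N ↦ (isWeakGradient_grad (contMDiff_sum hf N)).measurableSection) ?_
    filter_upwards [hX] with p hp
    simp only [grad_sum hf]
    exact hp.hasSum.tendsto_sum_nat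
  have hlim1 : Filter.Tendsto
      (fun N ↦ ∫⁻ p, ‖∑ k ∈ Finset.range N, f k p - ∑' k, f k p‖ₑ ^ 2 ∂(vol n M))
      Filter.atTop (𝓝 0) := by
    refine tendsto_of_tendsto_of_tendsto_of_le_of_le tendsto_const_nhds (htail _ hm1 hs1)
      (fun _ ↦ zero_le) fun N ↦ lintegral_mono_ae ?_
    filter_upwards [hu] with p hp
    refine pow_le_pow_left' ?_ 2
    rw [← hp.sum_add_tsum_nat_add N, sub_add_cancel_left, enorm_neg]
    exact enorm_tsum_le_tsum_enorm
  have hlim2 : Filter.Tendsto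
      (fun N ↦ ∫⁻ p, ‖grad n (fun p ↦ ∑ k ∈ Finset.range N, f k p) p - X p‖ₑ ^ 2 ∂(vol n M))
      Filter.atTop (𝓝 0) := by
    refine tendsto_of_tendsto_of_tendsto_of_le_of_le tendsto_const_nhds (htail _ hm2 hs2)
      (fun _ ↦ zero_le) fun N ↦ lintegral_mono_ae ?_
    filter_upwards [hX] with p hp
    refine pow_le_pow_left' ?_ 2
    simp only [X]
    rw [grad_sum hf, ← hp.sum_add_tsum_nat_add N, sub_add_cancel_left, enorm_neg]
    exact enorm_tsum_le_tsum_enorm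
  have hw : IsWeakGradient n (fun p ↦ ∑' k, f k p) X :=
    IsWeakGradient.of_tendsto (fun N ↦ isWeakGradient_grad (contMDiff_sum hf N))
      (fun N ↦ (contMDiff_sum hf N).continuous.aestronglyMeasurable) hum hXm hlim1 hlim2
  have hn1 : eLpNorm (fun p ↦ ∑' k, f k p) 2 (vol n M) ≤
      ∑' k, eLpNorm (fun p ↦ ‖f k p‖ₑ) 2 (vol n M) :=
    (eLpNorm_mono_enorm (g := fun p ↦ ∑' k, ‖f k p‖ₑ) fun p ↦ enorm_tsum_le_tsum_enorm).trans
      (eLpNorm_tsum_le hm1)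
  have hn2 : eLpNorm (fun p ↦ ‖X p‖) 2 (vol n M) ≤
      ∑' k, eLpNorm (fun p ↦ ‖grad n (f k) p‖ₑ) 2 (vol n M) :=
    (eLpNorm_mono_enorm (g := fun p ↦ ∑' k, ‖grad n (f k) p‖ₑ) fun p ↦ by
      rw [enorm_norm]
      exact enorm_tsum_le_tsum_enorm).trans (eLpNorm_tsum_le hm2)
  refine ⟨X, hw, ⟨hum, hn1.trans_lt hs1.lt_top⟩,
    ⟨hXm.aemeasurable_norm.aestronglyMeasurable, hn2.trans_lt hs2.lt_top⟩, hu, hlim1, hlim2, ?_⟩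
  rw [hw.h1NormSq_eq, ← eLpNorm_two_sq]
  have h3 : ∫⁻ p, ‖X p‖ₑ ^ 2 ∂(vol n M) = eLpNorm (fun p ↦ ‖X p‖) 2 (vol n M) ^ 2 := by
    rw [eLpNorm_two_sq]
    simp only [enorm_norm]
  rw [h3]
  unfold h1Norm
  rw [ENNReal.tsum_add]
  calc _ ≤ (∑' k, eLpNorm (fun p ↦ ‖f k p‖ₑ) 2 (vol n M)) ^ 2 +
        (∑' k, eLpNorm (fun p ↦ ‖grad n (f k) p‖ₑ) 2 (vol n M)) ^ 2 := by gcongr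
    _ ≤ _ := by
      rw [add_sq]
      gcongr
      exact le_self_add

/-- A function that is an `H¹` limit of smooth functions, with respect to a given vector field as
its weak gradient, belongs to `H¹₀(M)`. -/
theorem memH10_of_tendsto {u : M → ℝ} {X : (p : M) → TangentSpace (𝓡 n) p} {φ : ℕ → M → ℝ}
    (hφ : ∀ k, ContMDiff (𝓡 n) 𝓘(ℝ, ℝ) ∞ (φ k)) (hX : IsWeakGradient n u X)
    (hu2 : MemLp u 2 (vol n M)) (hX2 : MemLp (fun p ↦ ‖X p‖) 2 (vol n M))
    (h1 : Filter.Tendsto (fun k ↦ ∫⁻ p, ‖φ k p - u p‖ₑ ^ 2 ∂(vol n M)) Filter.atTop (𝓝 0))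
    (h2 : Filter.Tendsto (fun k ↦ ∫⁻ p, ‖grad n (φ k) p - X p‖ₑ ^ 2 ∂(vol n M))
      Filter.atTop (𝓝 0)) : MemH10 n u := by
  refine ⟨⟨hu2, X, hX, hX2⟩, fun ε hε ↦ ?_⟩
  have h3 := h1.add h2
  rw [add_zero] at h3
  obtain ⟨k, hk⟩ := (h3.eventually (gt_mem_nhds hε)).exists
  refine ⟨φ k, hφ k, HasCompactSupport.of_compactSpace _, ?_⟩
  rw [(hX.sub (isWeakGradient_grad (hφ k))).h1NormSq_eq]
  refine lt_of_eq_of_lt ?_ hk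
  simp only [enorm_sub_rev (u _), enorm_sub_rev (X _)]

/-- The capacity of a countable union of open sets is bounded by the square of the sum of the `H¹`
norms of smooth functions that are at least `1` on them: the sum of these functions is a
competitor. -/
theorem cap_iUnion_le {g : ℕ → M → ℝ} (hg : ∀ k, ContMDiff (𝓡 n) 𝓘(ℝ, ℝ) ∞ (g k))
    (hg0 : ∀ k p, 0 ≤ g k p) {A : ℕ → Set M} (hA : ∀ k, IsOpen (A k))
    (hgA : ∀ k, ∀ p ∈ A k, 1 ≤ g k p) (hsum : ∑' k, h1Norm n (g k) ≠ ⊤) :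
    cap n (⋃ k, A k) ≤ (∑' k, h1Norm n (g k)) ^ 2 := by
  obtain ⟨X, hX, hu2, hX2, hs, -, -, hle⟩ := exists_h1_limit hg hsum
  refine (iInf₂_le _ ⟨⟨hu2, X, hX, hX2⟩, ⋃ k, A k, isOpen_iUnion hA, subset_rfl, ?_⟩).trans hle
  filter_upwards [hs] with p hp hpA
  obtain ⟨k, hk⟩ := Set.mem_iUnion.1 hpA
  exact (hgA k p hk).trans (hp.le_tsum k fun j _ ↦ hg0 j p)

end Completeness

/-! ### Quasi-continuous limits -/

section QuasiContinuity

variable {n : ℕ} {M : Type*} [TopologicalSpace M] [ChartedSpace (EuclideanSpace ℝ (Fin n)) M]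
  [RiemannianBundle (fun p : M ↦ TangentSpace (𝓡 n) p)] [IsManifold (𝓡 n) ∞ M]
  [MeasurableSpace M] [BorelSpace M]
  [IsContMDiffRiemannianBundle (𝓡 n) ∞ (EuclideanSpace ℝ (Fin n))
      (fun p : M ↦ TangentSpace (𝓡 n) p)]

theorem QuasiContinuous.quasiOpen_ne_zero {w : M → ℝ} (hw : QuasiContinuous n w) :
    QuasiOpen n {p | w p ≠ 0} := by
  intro ε hε
  obtain ⟨W, hW, hWε, hc⟩ := hw ε hε
  refine ⟨W, hW, hWε, ?_⟩
  have h1 := hc.preimage_isClosed_of_isClosed hW.isClosed_compl (isClosed_singleton (x := (0 : ℝ)))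
  convert! h1.isOpen_compl using 1
  ext p
  simp only [Set.mem_union, Set.mem_ofPred_eq, Set.mem_compl_iff, Set.mem_inter_iff,
    Set.mem_preimage, Set.mem_singleton_iff]
  tauto

theorem QuasiOpen.union_isOpen {Ω V : Set M} (hΩ : QuasiOpen n Ω) (hV : IsOpen V) :
    QuasiOpen n (Ω ∪ V) := by
  intro ε hε
  obtain ⟨W, hW, hWε, hc⟩ := hΩ ε hε
  refine ⟨W, hW, hWε, ?_⟩
  rw [Set.union_right_comm]
  exact hc.union hV

/-- In particular, sets of capacity `0` are null sets. -/
theorem vol_le_cap (A : Set M) : vol n M A ≤ cap n A := by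
  refine le_iInf₂ fun u hu ↦ ?_
  obtain ⟨h1, U, hU, hAU, hu⟩ := hu
  refine (measure_mono hAU).trans ?_
  rw [← lintegral_indicator_one hU.measurableSet]
  refine le_trans (lintegral_mono_ae ?_) (le_self_add (b := ∫⁻ p, ‖weakGrad n u p‖ₑ ^ 2 ∂(vol n M)))
  filter_upwards [hu] with p hp
  by_cases hpU : p ∈ U
  · rw [Set.indicator_of_mem hpU]
    have h2 : (1 : ℝ≥0∞) ≤ ‖u p‖ₑ := by
      rw [Real.enorm_eq_ofReal (zero_le_one.trans (hp hpU))]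
      simpa using hp hpU
    exact one_le_pow₀ h2
  · rw [Set.indicator_of_notMem hpU]
    exact zero_le

variable [CompactSpace M]

theorem isWeakGradient_zero : IsWeakGradient n (fun _ : M ↦ (0 : ℝ)) (fun _ ↦ 0) := by
  have h := isWeakGradient_grad (n := n) (M := M) (φ := fun _ ↦ (0 : ℝ)) contMDiff_const
  have h0 : grad n (fun _ : M ↦ (0 : ℝ)) = fun _ ↦ 0 := by
    ext1 p
    simpa using grad_const_mul (n := n) (M := M) (φ := fun _ ↦ (0 : ℝ)) contMDiff_const 0 p
  rwa [h0] at h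

theorem cap_empty : cap n (∅ : Set M) = 0 := by
  refine le_antisymm ?_ zero_le
  refine (iInf₂_le (fun _ : M ↦ (0 : ℝ)) ⟨⟨MemLp.zero', _, isWeakGradient_zero, by simp⟩,
    ∅, isOpen_empty, subset_rfl, by simp⟩).trans ?_
  rw [isWeakGradient_zero.h1NormSq_eq]
  simp

theorem _root_.Continuous.quasiContinuous {w : M → ℝ} (hw : Continuous w) : QuasiContinuous n w :=
  fun _ hε ↦ ⟨∅, isOpen_empty, by rwa [cap_empty], hw.continuousOn⟩

/-- The function `c √(φ² + ε²)` is a smooth substitute for `c |φ|`. -/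
theorem h1Norm_const_mul_sqrt_le {φ : M → ℝ} (hφ : ContMDiff (𝓡 n) 𝓘(ℝ, ℝ) ∞ φ) {ε : ℝ}
    (hε : 0 < ε) (c : ℝ) :
    ContMDiff (𝓡 n) 𝓘(ℝ, ℝ) ∞ (fun p ↦ c * √(φ p ^ 2 + ε ^ 2)) ∧
    h1Norm n (fun p ↦ c * √(φ p ^ 2 + ε ^ 2)) ≤
      ‖c‖ₑ * (h1Norm n φ + ‖ε‖ₑ * eLpNorm (fun _ : M ↦ (1 : ℝ≥0∞)) 2 (vol n M)) := by
  have hpos : ∀ t : ℝ, 0 < t ^ 2 + ε ^ 2 := fun t ↦ by positivity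
  have hsm : ContDiff ℝ ∞ (fun t : ℝ ↦ c * √(t ^ 2 + ε ^ 2)) :=
    contDiff_const.mul (((contDiff_id.pow 2).add contDiff_const).sqrt fun t ↦ (hpos t).ne')
  have hd : ∀ t : ℝ, HasDerivAt (fun t : ℝ ↦ c * √(t ^ 2 + ε ^ 2)) (c * (t / √(t ^ 2 + ε ^ 2))) t := by
    intro t
    have h := (((hasDerivAt_pow 2 t).add_const (ε ^ 2)).sqrt (hpos t).ne').const_mul c
    convert! h using 1
    field_simp
    push_cast
    ring
  have hroot : ∀ t : ℝ, |t| ≤ √(t ^ 2 + ε ^ 2) := fun t ↦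
    Real.abs_le_sqrt (by nlinarith [sq_nonneg ε])
  refine ⟨hsm.contMDiff.comp hφ, ?_⟩
  have h1 : ∀ p, ‖c * √(φ p ^ 2 + ε ^ 2)‖ₑ ≤ ‖c‖ₑ * (‖φ p‖ₑ + ‖ε‖ₑ) := by
    intro p
    rw [enorm_mul]
    gcongr
    have h2 : √(φ p ^ 2 + ε ^ 2) ≤ |φ p| + |ε| := by
      rw [Real.sqrt_le_left (by positivity), add_sq, sq_abs, sq_abs]
      nlinarith [mul_nonneg (abs_nonneg (φ p)) (abs_nonneg ε)]
    rw [← ofReal_norm, ← ofReal_norm, ← ofReal_norm,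
      ← ENNReal.ofReal_add (norm_nonneg _) (norm_nonneg _), Real.norm_of_nonneg (Real.sqrt_nonneg _)]
    exact ENNReal.ofReal_le_ofReal h2
  have h2 : ∀ p, ‖grad n (fun p ↦ c * √(φ p ^ 2 + ε ^ 2)) p‖ₑ ≤ ‖c‖ₑ * ‖grad n φ p‖ₑ := by
    intro p
    rw [grad_comp (f := fun t : ℝ ↦ c * √(t ^ 2 + ε ^ 2)) (fun t ↦ (hd t).differentiableAt) hφ,
      (hd _).deriv, enorm_smul, enorm_mul, mul_assoc]
    refine mul_le_mul_right ?_ _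
    refine mul_le_of_le_one_left' ?_
    rw [← ofReal_norm, Real.norm_eq_abs, abs_div, abs_of_nonneg (Real.sqrt_nonneg _)]
    exact ENNReal.ofReal_le_one.2 (div_le_one_of_le₀ (hroot _) (Real.sqrt_nonneg _))
  have hmul : ∀ (a : ℝ) (f : M → ℝ≥0∞), AEMeasurable f (vol n M) →
      eLpNorm (fun p ↦ ‖a‖ₑ * f p) 2 (vol n M) = ‖a‖ₑ * eLpNorm f 2 (vol n M) := by
    intro a f hf
    refine (ENNReal.pow_right_strictMono two_ne_zero).injective ?_
    rw [mul_pow, eLpNorm_two_sq_ennreal, eLpNorm_two_sq_ennreal]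
    simp only [mul_pow]
    rw [lintegral_const_mul' _ _ (by finiteness)]
  have hm1 : AEMeasurable (fun p ↦ ‖φ p‖ₑ) (vol n M) := hφ.continuous.enorm.measurable.aemeasurable
  have hm2 : AEMeasurable (fun p ↦ ‖grad n φ p‖ₑ) (vol n M) :=
    (isWeakGradient_grad hφ).measurableSection.aemeasurable_enorm
  have hadd : eLpNorm (fun p ↦ ‖φ p‖ₑ + ‖ε‖ₑ) 2 (vol n M) ≤
      eLpNorm (fun p ↦ ‖φ p‖ₑ) 2 (vol n M) + eLpNorm (fun _ : M ↦ ‖ε‖ₑ) 2 (vol n M) :=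
    eLpNorm_add_le (f := fun p ↦ ‖φ p‖ₑ) (g := fun _ : M ↦ ‖ε‖ₑ) hm1.aestronglyMeasurable
      aestronglyMeasurable_const (by norm_num)
  calc h1Norm n (fun p ↦ c * √(φ p ^ 2 + ε ^ 2))
      ≤ eLpNorm (fun p ↦ ‖c‖ₑ * (‖φ p‖ₑ + ‖ε‖ₑ)) 2 (vol n M) +
        eLpNorm (fun p ↦ ‖c‖ₑ * ‖grad n φ p‖ₑ) 2 (vol n M) :=
      add_le_add (eLpNorm_mono_enorm fun p ↦ by simpa using h1 p)
        (eLpNorm_mono_enorm fun p ↦ by simpa using h2 p)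
    _ ≤ ‖c‖ₑ * (eLpNorm (fun p ↦ ‖φ p‖ₑ) 2 (vol n M) +
          ‖ε‖ₑ * eLpNorm (fun _ : M ↦ (1 : ℝ≥0∞)) 2 (vol n M)) +
          ‖c‖ₑ * eLpNorm (fun p ↦ ‖grad n φ p‖ₑ) 2 (vol n M) := by
      rw [hmul _ _ (hm1.add_const _), hmul _ _ hm2]
      gcongr
      rw [← hmul _ _ aemeasurable_const]
      simp only [mul_one]
      exact hadd
    _ = _ := by
      rw [h1Norm]
      ring

/-- A sequence of smooth functions that is Cauchy in `H¹` has a subsequence that converges in `H¹`,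
and pointwise off open sets of small capacity, to a quasi-continuous function. -/
theorem exists_quasiContinuous_limit {ψ : ℕ → M → ℝ}
    (hψ : ∀ k, ContMDiff (𝓡 n) 𝓘(ℝ, ℝ) ∞ (ψ k))
    (hc : ∀ ε : ℝ≥0∞, 0 < ε → ∃ N, ∀ i ≥ N, ∀ j ≥ N, h1Norm n (fun p ↦ ψ i p - ψ j p) ≤ ε) :
    ∃ (σ : ℕ → ℕ) (u : M → ℝ) (X : (p : M) → TangentSpace (𝓡 n) p), StrictMono σ ∧
      IsWeakGradient n u X ∧ MemLp u 2 (vol n M) ∧ MemLp (fun p ↦ ‖X p‖) 2 (vol n M) ∧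
      QuasiContinuous n u ∧
      Filter.Tendsto (fun k ↦ ∫⁻ p, ‖ψ (σ k) p - u p‖ₑ ^ 2 ∂(vol n M)) Filter.atTop (𝓝 0) ∧
      Filter.Tendsto (fun k ↦ ∫⁻ p, ‖grad n (ψ (σ k)) p - X p‖ₑ ^ 2 ∂(vol n M))
        Filter.atTop (𝓝 0) := by
  obtain ⟨σ, hσ, hσc⟩ : ∃ σ : ℕ → ℕ, StrictMono σ ∧
      ∀ k, ∀ i ≥ σ k, ∀ j ≥ σ k, h1Norm n (fun p ↦ ψ i p - ψ j p) ≤ 4⁻¹ ^ k := by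
    have h1 : ∀ k : ℕ, ∃ N, ∀ i ≥ N, ∀ j ≥ N, h1Norm n (fun p ↦ ψ i p - ψ j p) ≤ 4⁻¹ ^ k :=
      fun k ↦ hc _ (ENNReal.pow_pos (by simp) k)
    choose N hN using h1
    refine ⟨fun k ↦ k + ∑ i ∈ Finset.range (k + 1), N i, strictMono_nat_of_lt_succ fun k ↦ ?_,
      fun k i hi j hj ↦ ?_⟩
    · rw [Finset.sum_range_succ _ (k + 1)]
      omega
    · have h2 : N k ≤ ∑ i ∈ Finset.range (k + 1), N i :=
        Finset.single_le_sum (f := N) (fun _ _ ↦ Nat.zero_le _) (Finset.self_mem_range_succ k)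
      exact hN k i (by beta_reduce at hi; omega) j (by beta_reduce at hj; omega)
  -- The limit is the sum of the series of the increments.
  let f : ℕ → M → ℝ := fun k ↦ Nat.casesOn k (ψ (σ 0)) fun j p ↦ ψ (σ (j + 1)) p - ψ (σ j) p
  have hf : ∀ k, ContMDiff (𝓡 n) 𝓘(ℝ, ℝ) ∞ (f k) := by
    intro k
    cases k with
    | zero => exact hψ _
    | succ j => exact (hψ _).sub (hψ _)
  have hfsum : ∀ N p, ∑ k ∈ Finset.range (N + 1), f k p = ψ (σ N) p := by
    intro N p
    induction N with
    | zero => simp [f]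
    | succ N ih =>
      rw [Finset.sum_range_succ, ih]
      simp [f]
  have hfle : ∀ k, h1Norm n (f (k + 1)) ≤ 4⁻¹ ^ k := fun k ↦
    hσc k _ (hσ.monotone (Nat.le_succ k)) _ le_rfl
  have hgeo : ∀ r : ℝ≥0∞, r < 1 → ∑' k : ℕ, r ^ k ≠ ⊤ := fun r hr ↦ by
    rw [ENNReal.tsum_geometric]
    exact ENNReal.inv_ne_top.2 (tsub_pos_of_lt hr).ne'
  have hsum : ∑' k, h1Norm n (f k) ≠ ⊤ := by
    rw [tsum_eq_zero_add' ENNReal.summable]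
    refine ENNReal.add_ne_top.2 ⟨h1Norm_ne_top (hf 0), ?_⟩
    exact ne_top_of_le_ne_top (hgeo 4⁻¹ (by norm_num)) (ENNReal.tsum_le_tsum hfle)
  obtain ⟨X, hX, hu2, hX2, -, hl1, hl2, -⟩ := exists_h1_limit hf hsum
  refine ⟨σ, _, X, hσ, hX, hu2, hX2, ?_, ?_, ?_⟩
  rotate_left
  · have h := hl1.comp (Filter.tendsto_add_atTop_nat 1)
    simpa only [Function.comp_def, hfsum] using h
  · have h := hl2.comp (Filter.tendsto_add_atTop_nat 1)
    simpa only [Function.comp_def, hfsum] using h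
  -- Off the union of the sets `A k` with `k ≥ N`, the series converges uniformly. Since the `k`-th
  -- increment is of order `4⁻ᵏ` in `H¹`, these unions have small capacity.
  let A : ℕ → Set M := fun k ↦ {p | 1 < 2 ^ k * |f (k + 1) p|}
  have hA : ∀ k, IsOpen (A k) := fun k ↦
    isOpen_lt continuous_const (continuous_const.mul (hf (k + 1)).continuous.abs)
  let g : ℕ → M → ℝ := fun k p ↦ 2 ^ k * √(f (k + 1) p ^ 2 + ((4 : ℝ)⁻¹ ^ k) ^ 2)
  have hg : ∀ k, _ := fun k ↦ h1Norm_const_mul_sqrt_le (hf (k + 1)) (ε := (4 : ℝ)⁻¹ ^ k)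
    (by positivity) (2 ^ k)
  set V : ℝ≥0∞ := eLpNorm (fun _ : M ↦ (1 : ℝ≥0∞)) 2 (vol n M) with hV
  have hVtop : V ≠ ⊤ := by
    intro h
    have h1 := eLpNorm_two_sq_ennreal (μ := vol n M) (fun _ : M ↦ (1 : ℝ≥0∞))
    rw [← hV, h] at h1
    simp at h1
    exact measure_ne_top (vol n M) univ h1.symm
  have hgle : ∀ k, h1Norm n (g k) ≤ 2⁻¹ ^ k * (1 + V) := by
    intro k
    refine (hg k).2.trans ?_
    have e1 : ‖(2 : ℝ) ^ k‖ₑ = 2 ^ k := by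
      rw [enorm_pow]
      congr 1
      rw [← ofReal_norm]
      norm_num
    have e2 : ‖(4 : ℝ)⁻¹ ^ k‖ₑ = 4⁻¹ ^ k := by
      rw [enorm_pow]
      congr 1
      rw [← ofReal_norm, Real.norm_of_nonneg (by norm_num), ENNReal.ofReal_inv_of_pos (by norm_num)]
      norm_num
    have e3 : (2 : ℝ≥0∞) ^ k * 4⁻¹ ^ k = 2⁻¹ ^ k := by
      rw [← mul_pow]
      congr 1
      rw [show (4 : ℝ≥0∞) = 2 * 2 by norm_num, ENNReal.mul_inv (by simp) (by simp), ← mul_assoc,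
        ENNReal.mul_inv_cancel (by simp) (by simp), one_mul]
    rw [e1, e2, ← e3, mul_assoc]
    refine mul_le_mul_right ?_ _
    rw [mul_add, mul_one]
    exact add_le_add (hfle k) le_rfl
  have hgsum : ∑' k, h1Norm n (g k) ≠ ⊤ := by
    refine ne_top_of_le_ne_top ?_ (ENNReal.tsum_le_tsum hgle)
    rw [ENNReal.tsum_mul_right]
    exact ENNReal.mul_ne_top (hgeo _ (by norm_num)) (by finiteness)
  intro ε hε
  have ht := ((ENNReal.continuous_pow 2).tendsto 0).comp (ENNReal.tendsto_sum_nat_add _ hgsum)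
  rw [zero_pow two_ne_zero] at ht
  obtain ⟨N, hN⟩ := (ht.eventually (gt_mem_nhds hε)).exists
  refine ⟨⋃ k, A (k + N), isOpen_iUnion fun k ↦ hA _, ?_, ?_⟩
  · refine lt_of_le_of_lt (cap_iUnion_le (g := fun k ↦ g (k + N)) (fun k ↦ (hg _).1)
      (fun k p ↦ by positivity) (fun k ↦ hA _) (fun k p hp ↦ ?_) ?_) hN
    · refine hp.le.trans (mul_le_mul_of_nonneg_left ?_ (by positivity))
      exact Real.abs_le_sqrt (by nlinarith [sq_nonneg ((4 : ℝ)⁻¹ ^ (k + N))])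
    · exact ne_top_of_le_ne_top hgsum
        (ENNReal.tsum_comp_le_tsum_of_injective (add_left_injective N) _)
  · have hb : ∀ k, ∀ p ∈ (⋃ k, A (k + N))ᶜ, ‖f (k + (N + 1)) p‖ ≤ 2⁻¹ ^ (k + N) := by
      intro k p hp
      have h1 : ¬ 1 < (2 : ℝ) ^ (k + N) * |f (k + N + 1) p| := fun h ↦
        hp (Set.mem_iUnion.2 ⟨k, h⟩)
      rw [not_lt] at h1
      rw [inv_pow, Real.norm_eq_abs, ← add_assoc, ← one_div, le_div_iff₀ (by positivity), mul_comm]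
      exact h1
    have hsm : Summable fun k : ℕ ↦ (2 : ℝ)⁻¹ ^ (k + N) := by
      refine (summable_nat_add_iff N).2 ?_
      exact summable_geometric_of_lt_one (by norm_num) (by norm_num)
    have h1 : ContinuousOn (fun p ↦ ∑ k ∈ Finset.range (N + 1), f k p + ∑' k, f (k + (N + 1)) p)
        (⋃ k, A (k + N))ᶜ :=
      (contMDiff_sum hf (N + 1)).continuous.continuousOn.add
        (continuousOn_tsum (fun k ↦ (hf (k + (N + 1))).continuous.continuousOn) hsm hb)
    refine h1.congr fun p hp ↦ ?_
    have hs : Summable fun k ↦ f (k + (N + 1)) p :=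
      Summable.of_norm_bounded hsm fun k ↦ hb k p hp
    have hs' : Summable fun k ↦ f k p := (summable_nat_add_iff (f := fun k ↦ f k p) (N + 1)).1 hs
    exact (hs'.sum_add_tsum_nat_add (N + 1)).symm

end QuasiContinuity

/-! ### The gradient on the zero set -/

section LevelSet

/-- Convergence in `L²` implies convergence almost everywhere along a subsequence. -/
theorem exists_seq_tendsto_ae_of_lintegral {α : Type*} [MeasurableSpace α] {μ : Measure α}
    {φ : ℕ → α → ℝ} {u : α → ℝ} (hφ : ∀ k, AEStronglyMeasurable (φ k) μ)
    (hu : AEStronglyMeasurable u μ)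
    (h : Filter.Tendsto (fun k ↦ ∫⁻ p, ‖φ k p - u p‖ₑ ^ 2 ∂μ) Filter.atTop (𝓝 0)) :
    ∃ σ : ℕ → ℕ, StrictMono σ ∧
      ∀ᵐ p ∂μ, Filter.Tendsto (fun k ↦ φ (σ k) p) Filter.atTop (𝓝 (u p)) :=
  (tendstoInMeasure_of_tendsto_eLpNorm (p := 2) two_ne_zero hφ hu
    (tendsto_lintegral_sq_iff.1 h)).exists_seq_tendsto_ae

variable {n : ℕ} {M : Type*} [TopologicalSpace M] [ChartedSpace (EuclideanSpace ℝ (Fin n)) M]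
  [RiemannianBundle (fun p : M ↦ TangentSpace (𝓡 n) p)] [IsManifold (𝓡 n) ∞ M]
  [MeasurableSpace M] [BorelSpace M]
  [IsContMDiffRiemannianBundle (𝓡 n) ∞ (EuclideanSpace ℝ (Fin n))
      (fun p : M ↦ TangentSpace (𝓡 n) p)] [CompactSpace M]

/-- The chain rule for the composition of an `H¹` limit of smooth functions with a smooth function
whose derivative is bounded by `1`. -/
theorem isWeakGradient_comp {u : M → ℝ} {X : (p : M) → TangentSpace (𝓡 n) p} {φ : ℕ → M → ℝ}
    (hφ : ∀ k, ContMDiff (𝓡 n) 𝓘(ℝ, ℝ) ∞ (φ k)) (hX : IsWeakGradient n u X)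
    (hu2 : MemLp u 2 (vol n M)) (hX2 : MemLp (fun p ↦ ‖X p‖) 2 (vol n M))
    (h1 : Filter.Tendsto (fun k ↦ ∫⁻ p, ‖φ k p - u p‖ₑ ^ 2 ∂(vol n M)) Filter.atTop (𝓝 0))
    (h2 : Filter.Tendsto (fun k ↦ ∫⁻ p, ‖grad n (φ k) p - X p‖ₑ ^ 2 ∂(vol n M))
      Filter.atTop (𝓝 0)) {f : ℝ → ℝ} (hf : ContDiff ℝ ∞ f) (hf1 : ∀ t, ‖deriv f t‖ ≤ 1) :
    IsWeakGradient n (fun p ↦ f (u p)) (fun p ↦ deriv f (u p) • X p) := by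
  obtain ⟨σ, hσ, hae⟩ := exists_seq_tendsto_ae_of_lintegral
    (fun k ↦ (hφ k).continuous.aestronglyMeasurable) hu2.1 h1
  have hfd : Differentiable ℝ f := hf.differentiable (by simp)
  have hf' : Continuous (deriv f) := hf.continuous_deriv (by simp)
  have hXm := hX.measurableSection
  have hcm : AEStronglyMeasurable (fun p ↦ deriv f (u p)) (vol n M) :=
    hf'.comp_aestronglyMeasurable hu2.1
  have hf1' : ∀ t, ‖deriv f t‖ₑ ≤ 1 := fun t ↦ by
    rw [← ofReal_norm]
    exact ENNReal.ofReal_le_one.2 (hf1 t)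
  refine IsWeakGradient.of_tendsto (φ := fun k p ↦ f (φ (σ k) p))
    (fun k ↦ isWeakGradient_grad (hf.contMDiff.comp (hφ (σ k))))
    (fun k ↦ (hf.continuous.comp (hφ (σ k)).continuous).aestronglyMeasurable)
    (hf.continuous.comp_aestronglyMeasurable hu2.1) (hXm.smul hcm) ?_ ?_
  · refine tendsto_of_tendsto_of_tendsto_of_le_of_le tendsto_const_nhds
      (h1.comp hσ.tendsto_atTop) (fun _ ↦ zero_le) fun k ↦ lintegral_mono fun p ↦ ?_
    refine pow_le_pow_left' ?_ 2
    rw [← ofReal_norm, ← ofReal_norm]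
    refine ENNReal.ofReal_le_ofReal ?_
    have h := Convex.norm_image_sub_le_of_norm_deriv_le (f := f) (C := 1) (s := univ)
      (x := u p) (y := φ (σ k) p) (fun t _ ↦ hfd t) (fun t _ ↦ hf1 t) convex_univ
      (mem_univ _) (mem_univ _)
    simpa using h
  · have h3 : Filter.Tendsto (fun k ↦ ∫⁻ p,
        (‖deriv f (φ (σ k) p) - deriv f (u p)‖ₑ * ‖X p‖ₑ) ^ 2 ∂(vol n M))
        Filter.atTop (𝓝 0) := by
      rw [← lintegral_zero (μ := vol n M)]
      refine tendsto_lintegral_of_dominated_convergence' (fun p ↦ (2 * ‖X p‖ₑ) ^ 2)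
        (fun k ↦ ?_) (fun k ↦ ae_of_all _ fun p ↦ ?_) ?_ ?_
      · exact ((((hf'.comp (hφ (σ k)).continuous).aestronglyMeasurable.sub hcm).enorm.mul
          hXm.aemeasurable_enorm).pow_const 2)
      · refine pow_le_pow_left' (mul_le_mul_left ?_ _) 2
        refine (enorm_sub_le).trans ((add_le_add (hf1' _) (hf1' _)).trans_eq ?_)
        norm_num
      · have h4 : ∫⁻ p, ‖X p‖ₑ ^ 2 ∂(vol n M) < ⊤ := by
          simpa using lintegral_sq_lt_top hX2
        simp only [mul_pow]
        rw [lintegral_const_mul' _ _ (by finiteness)]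
        exact ENNReal.mul_ne_top (by finiteness) h4.ne
      · filter_upwards [hae] with p hp
        have h5 : Filter.Tendsto (fun k ↦ ‖deriv f (φ (σ k) p) - deriv f (u p)‖ₑ)
            Filter.atTop (𝓝 0) := by
          have h6 := (((hf'.tendsto _).comp hp).sub_const (deriv f (u p))).enorm
          simpa using h6
        have h7 := ENNReal.Tendsto.mul_const h5 (b := ‖X p‖ₑ) (Or.inr enorm_ne_top)
        rw [zero_mul] at h7
        simpa [Function.comp_def] using ((ENNReal.continuous_pow 2).tendsto 0).comp h7
    have h8 := ENNReal.Tendsto.const_mul (a := 2)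
      ((h2.comp hσ.tendsto_atTop).add h3) (Or.inr (by simp))
    rw [add_zero, mul_zero] at h8
    refine tendsto_of_tendsto_of_tendsto_of_le_of_le tendsto_const_nhds h8
      (fun _ ↦ zero_le) fun k ↦ ?_
    simp only [Function.comp_def]
    have hgm : AEMeasurable (fun p ↦ ‖grad n (φ (σ k)) p - X p‖ₑ ^ 2) (vol n M) :=
      (((isWeakGradient_grad (hφ (σ k))).measurableSection.sub hXm).aemeasurable_enorm).pow_const 2
    rw [← lintegral_add_left' hgm, ← lintegral_const_mul' _ _ (by simp)]
    refine lintegral_mono fun p ↦ ?_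
    refine le_trans (pow_le_pow_left' ?_ 2) (enn_add_sq_le _ _)
    have h9 : grad n (fun p ↦ f (φ (σ k) p)) p - deriv f (u p) • X p =
        deriv f (φ (σ k) p) • (grad n (φ (σ k)) p - X p) +
          (deriv f (φ (σ k) p) - deriv f (u p)) • X p := by
      rw [grad_comp hfd (hφ (σ k)), smul_sub, sub_smul]
      abel
    change ‖grad n (fun p ↦ f (φ (σ k) p)) p - deriv f (u p) • X p‖ₑ ≤ _
    rw [h9]
    refine (enorm_add_le _ _).trans ?_
    rw [enorm_smul, enorm_smul]
    exact add_le_add_left (mul_le_of_le_one_left' (hf1' _)) _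

/-- The gradient of a Sobolev function vanishes almost everywhere on its zero set. The functions
`arctan (k u) / k` tend to `0`, and their gradients `∇u / (1 + k² u²)` tend to the restriction of
`∇u` to the zero set. -/
theorem weakGradient_ae_eq_zero {u : M → ℝ} {X : (p : M) → TangentSpace (𝓡 n) p} {φ : ℕ → M → ℝ}
    (hφ : ∀ k, ContMDiff (𝓡 n) 𝓘(ℝ, ℝ) ∞ (φ k)) (hX : IsWeakGradient n u X)
    (hu2 : MemLp u 2 (vol n M)) (hX2 : MemLp (fun p ↦ ‖X p‖) 2 (vol n M))
    (h1 : Filter.Tendsto (fun k ↦ ∫⁻ p, ‖φ k p - u p‖ₑ ^ 2 ∂(vol n M)) Filter.atTop (𝓝 0))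
    (h2 : Filter.Tendsto (fun k ↦ ∫⁻ p, ‖grad n (φ k) p - X p‖ₑ ^ 2 ∂(vol n M))
      Filter.atTop (𝓝 0)) : ∀ᵐ p ∂(vol n M), u p = 0 → X p = 0 := by
  classical
  let f : ℕ → ℝ → ℝ := fun k t ↦ ((k : ℝ) + 1)⁻¹ * Real.arctan (((k : ℝ) + 1) * t)
  have hk : ∀ k : ℕ, (0 : ℝ) < (k : ℝ) + 1 := fun k ↦ by positivity
  have hf : ∀ k, ContDiff ℝ ∞ (f k) := fun k ↦
    contDiff_const.mul (Real.contDiff_arctan.comp (contDiff_const.mul contDiff_id))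
  have hd : ∀ k t, deriv (f k) t = (1 + (((k : ℝ) + 1) * t) ^ 2)⁻¹ := by
    intro k t
    have h := (((hasDerivAt_id t).const_mul ((k : ℝ) + 1)).arctan).const_mul ((k : ℝ) + 1)⁻¹
    rw [show f k = fun t ↦ ((k : ℝ) + 1)⁻¹ * Real.arctan (((k : ℝ) + 1) * t) from rfl]
    refine h.deriv.trans ?_
    have := (hk k).ne'
    simp only [id, mul_one, one_div]
    field_simp
  have hd1 : ∀ k t, ‖deriv (f k) t‖ ≤ 1 := by
    intro k t
    rw [hd, norm_inv, Real.norm_of_nonneg (by positivity)]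
    exact inv_le_one_of_one_le₀ (by nlinarith [sq_nonneg (((k : ℝ) + 1) * t)])
  let Y : (p : M) → TangentSpace (𝓡 n) p := fun p ↦ (if u p = 0 then (1 : ℝ) else 0) • X p
  have hw : ∀ k, _ := fun k ↦ isWeakGradient_comp hφ hX hu2 hX2 h1 h2 (hf k) (hd1 k)
  have hlim : ∀ t : ℝ, Filter.Tendsto (fun k ↦ deriv (f k) t) Filter.atTop
      (𝓝 (if t = 0 then 1 else 0)) := by
    intro t
    simp only [hd]
    by_cases ht : t = 0
    · simp [ht]
    · rw [if_neg ht]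
      refine Filter.Tendsto.inv_tendsto_atTop ?_
      refine Filter.tendsto_atTop_add_const_left _ _ ?_
      simp only [mul_pow]
      refine Filter.Tendsto.atTop_mul_const (by positivity) ?_
      exact (Filter.tendsto_pow_atTop two_ne_zero).comp
        (Filter.tendsto_atTop_add_const_right _ _ tendsto_natCast_atTop_atTop)
  have hYlim : ∀ p, Filter.Tendsto (fun k ↦ deriv (f k) (u p) • X p) Filter.atTop (𝓝 (Y p)) :=
    fun p ↦ (hlim (u p)).smul_const (X p)
  have hYm : MeasurableSection Y :=
    MeasurableSection.of_tendsto (fun k ↦ (hw k).measurableSection) (ae_of_all _ hYlim)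
  have hY : IsWeakGradient n (fun _ ↦ 0) Y := by
    refine IsWeakGradient.of_tendsto hw
      (fun k ↦ (hf k).continuous.comp_aestronglyMeasurable hu2.1) aestronglyMeasurable_const hYm
      ?_ ?_
    · have h3 : Filter.Tendsto (fun k : ℕ ↦ ENNReal.ofReal (((k : ℝ) + 1)⁻¹ * 2) ^ 2 *
          vol n M univ) Filter.atTop (𝓝 0) := by
        have h4 : Filter.Tendsto (fun k : ℕ ↦ ((k : ℝ) + 1)⁻¹ * 2) Filter.atTop (𝓝 0) := by
          have h5 := (tendsto_one_div_add_atTop_nhds_zero_nat (𝕜 := ℝ)).mul_const 2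
          simpa using h5
        have h5 := ((ENNReal.continuous_pow 2).tendsto _).comp (ENNReal.tendsto_ofReal h4)
        have h6 := ENNReal.Tendsto.mul_const h5 (b := vol n M univ)
          (Or.inr (measure_ne_top _ _))
        simpa [Function.comp_def] using h6
      refine tendsto_of_tendsto_of_tendsto_of_le_of_le tendsto_const_nhds h3
        (fun _ ↦ zero_le) fun k ↦ ?_
      rw [← lintegral_const]
      refine lintegral_mono fun p ↦ pow_le_pow_left' ?_ 2
      rw [sub_zero, ← ofReal_norm]
      refine ENNReal.ofReal_le_ofReal ?_
      simp only [f]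
      rw [norm_mul, norm_inv, Real.norm_of_nonneg (hk k).le]
      refine mul_le_mul_of_nonneg_left ?_ (inv_nonneg.2 (hk k).le)
      have h7 := Real.arctan_lt_pi_div_two (((k : ℝ) + 1) * u p)
      have h8 := Real.neg_pi_div_two_lt_arctan (((k : ℝ) + 1) * u p)
      have h9 := Real.pi_le_four
      exact abs_le.2 ⟨by linarith, by linarith⟩
    · rw [← lintegral_zero (μ := vol n M)]
      refine tendsto_lintegral_of_dominated_convergence' (fun p ↦ (2 * ‖X p‖ₑ) ^ 2)
        (fun k ↦ ?_) (fun k ↦ ae_of_all _ fun p ↦ ?_) ?_ (ae_of_all _ fun p ↦ ?_)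
      · exact (((hw k).measurableSection.sub hYm).aemeasurable_enorm).pow_const 2
      · refine pow_le_pow_left' ?_ 2
        simp only [Y]
        rw [← sub_smul, enorm_smul]
        refine mul_le_mul_left ?_ _
        refine (enorm_sub_le).trans ((add_le_add (b := 1) (d := 1) ?_ ?_).trans_eq ?_)
        · rw [← ofReal_norm]
          exact ENNReal.ofReal_le_one.2 (hd1 k _)
        · split_ifs <;> simp
        · norm_num
      · have h4 : ∫⁻ p, ‖X p‖ₑ ^ 2 ∂(vol n M) < ⊤ := by
          simpa using lintegral_sq_lt_top hX2
        simp only [mul_pow]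
        rw [lintegral_const_mul' _ _ (by finiteness)]
        exact ENNReal.mul_ne_top (by finiteness) h4.ne
      · have h6 := ((hYlim p).sub_const (Y p)).enorm
        rw [sub_self, enorm_zero] at h6
        simpa [Function.comp_def] using ((ENNReal.continuous_pow 2).tendsto 0).comp h6
  filter_upwards [hY.ae_eq isWeakGradient_zero] with p hp hup
  simpa [Y, hup] using hp

end LevelSet

/-! ### Enlarging a set by an open set -/

section Enlargement

variable {n : ℕ} {M : Type*} [TopologicalSpace M] [ChartedSpace (EuclideanSpace ℝ (Fin n)) M]
  [RiemannianBundle (fun p : M ↦ TangentSpace (𝓡 n) p)] [IsManifold (𝓡 n) ∞ M]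
  [MeasurableSpace M] [BorelSpace M]
  [IsContMDiffRiemannianBundle (𝓡 n) ∞ (EuclideanSpace ℝ (Fin n))
      (fun p : M ↦ TangentSpace (𝓡 n) p)] [CompactSpace M]
  {e : OpenPartialHomeomorph M (EuclideanSpace ℝ (Fin n))}

/-- Coordinate balls are added to the set `Ω`, which need not be measurable: only the subadditivity
of the volume is used. -/
theorem continuousOn_vol_union_ball (hn : n ≠ 0) (he : e ∈ atlas (EuclideanSpace ℝ (Fin n)) M)
    {x : EuclideanSpace ℝ (Fin n)} {r : ℝ} (hr : Metric.closedBall x r ⊆ e.target) (Ω : Set M) :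
    ContinuousOn (fun t ↦ vol n M (Ω ∪ e.symm '' Metric.ball x t)) (Icc 0 r) := by
  have : Nonempty (Fin n) := ⟨⟨0, Nat.pos_of_ne_zero hn⟩⟩
  obtain ⟨C, hC⟩ := exists_vol_restrict_le he (isCompact_closedBall x r) hr
  set c : ℝ := (volume (Metric.ball (0 : EuclideanSpace ℝ (Fin n)) 1)).toReal
  -- The increments are bounded by those of a multiple of the Lebesgue measure of the balls.
  have hinc : ∀ s t, 0 ≤ s → s ≤ t → t ≤ r →
      (vol n M).real (Ω ∪ e.symm '' Metric.ball x t) ≤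
        (vol n M).real (Ω ∪ e.symm '' Metric.ball x s) +
          C * (volume.real (Metric.ball x t) - volume.real (Metric.ball x s)) := by
    intro s t hs hst htr
    set D := Metric.ball x t \ Metric.ball x s
    have hD : D ⊆ Metric.closedBall x r := (Set.sdiff_subset.trans Metric.ball_subset_closedBall).trans
      (Metric.closedBall_subset_closedBall htr)
    have hDm : MeasurableSet D := measurableSet_ball.diff measurableSet_ball
    have hm := measurableSet_image_symm e (hD.trans hr) hDm
    have h1 : vol n M (e.symm '' D) ≤ C * volume D := by
      have h2 := Measure.le_iff'.1 hC (e.symm '' D)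
      rw [Measure.restrict_apply hm, Set.inter_eq_left.2 (Set.image_mono hD), Measure.smul_apply,
        Measure.map_apply_of_aemeasurable (aemeasurable_chart_symm_of_subset e hr) hm,
        Measure.restrict_apply₀' measurableSet_closedBall.nullMeasurableSet] at h2
      refine h2.trans (mul_le_mul_right (measure_mono ?_) _)
      rintro y ⟨⟨z, hz, hzy⟩, hy⟩
      have : z = y := e.symm.injOn (hr (hD hz)) (hr hy) hzy
      rwa [← this]
    have h3 : (vol n M).real (e.symm '' D) ≤ C * volume.real D := by
      have h4 := ENNReal.toReal_mono (ENNReal.mul_ne_top ENNReal.coe_ne_top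
        ((measure_mono hD).trans_lt (isCompact_closedBall x r).measure_lt_top).ne) h1
      rwa [ENNReal.toReal_mul] at h4
    have h5 : volume.real D = volume.real (Metric.ball x t) - volume.real (Metric.ball x s) :=
      measureReal_sdiff (Metric.ball_subset_ball hst) measurableSet_ball
    rw [← h5]
    refine le_trans ?_ ((measureReal_union_le _ (e.symm '' D)).trans (add_le_add_right h3 _))
    refine measureReal_mono ?_ (measure_ne_top _ _)
    rw [Set.union_assoc, ← Set.image_union, Set.union_sdiff_self]
    exact Set.union_subset_union_right _ (Set.image_mono Set.subset_union_right)
  have hball : ∀ t, 0 ≤ t → volume.real (Metric.ball x t) = t ^ n * c := by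
    intro t ht
    rw [Measure.real, Measure.addHaar_ball _ _ ht, ENNReal.toReal_mul,
      ENNReal.toReal_ofReal (by positivity), finrank_euclideanSpace_fin]
  have hmono : ∀ s t, s ≤ t → (vol n M).real (Ω ∪ e.symm '' Metric.ball x s) ≤
      (vol n M).real (Ω ∪ e.symm '' Metric.ball x t) := fun s t hst ↦
    measureReal_mono (Set.union_subset_union_right _ (Set.image_mono (Metric.ball_subset_ball hst)))
      (measure_ne_top _ _)
  have hdist : ∀ s ∈ Icc 0 r, ∀ t ∈ Icc 0 r,
      dist ((vol n M).real (Ω ∪ e.symm '' Metric.ball x t))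
        ((vol n M).real (Ω ∪ e.symm '' Metric.ball x s)) ≤
        |C * (t ^ n * c - s ^ n * c)| := by
    intro s hs t ht
    rw [Real.dist_eq]
    rcases le_total s t with hst | hst
    · have h1 := hinc s t hs.1 hst ht.2
      rw [hball s hs.1, hball t ht.1] at h1
      rw [abs_of_nonneg (sub_nonneg.2 (hmono s t hst))]
      exact le_trans (by linarith) (le_abs_self _)
    · have h1 := hinc t s ht.1 hst hs.2
      rw [hball s hs.1, hball t ht.1] at h1
      rw [abs_sub_comm, abs_of_nonneg (sub_nonneg.2 (hmono t s hst))]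
      exact le_trans (by linarith) (neg_le_abs _)
  have hreal : ContinuousOn (fun t ↦ (vol n M).real (Ω ∪ e.symm '' Metric.ball x t)) (Icc 0 r) := by
    intro s hs
    rw [ContinuousWithinAt, tendsto_iff_dist_tendsto_zero]
    have h1 : Filter.Tendsto (fun t : ℝ ↦ |C * (t ^ n * c - s ^ n * c)|) (𝓝[Icc 0 r] s) (𝓝 0) := by
      have h2 : Continuous fun t : ℝ ↦ |C * (t ^ n * c - s ^ n * c)| := by fun_prop
      have h3 := (h2.tendsto s).mono_left (nhdsWithin_le_nhds (s := Icc 0 r))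
      simpa using h3
    refine squeeze_zero' (Filter.Eventually.of_forall fun _ ↦ dist_nonneg) ?_ h1
    filter_upwards [self_mem_nhdsWithin] with t ht using hdist s hs t ht
  refine (ENNReal.continuous_ofReal.comp_continuousOn hreal).congr fun t _ ↦ ?_
  exact (ENNReal.ofReal_toReal (measure_ne_top _ _)).symm

/-- The volume of a set can be increased to any larger value by adding an open set: coordinate
balls of a finite cover are added one after another, the last one with its radius adjusted. -/
theorem exists_isOpen_vol_union_eq (hn : n ≠ 0) {Ω : Set M} {m : ℝ≥0∞} (h1 : vol n M Ω ≤ m)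
    (h2 : m ≤ vol n M univ) : ∃ V : Set M, IsOpen V ∧ vol n M (Ω ∪ V) = m := by
  classical
  obtain ⟨t, r, hr, hrt, ht⟩ := exists_finite_ball_cover n M
  have hrt' : ∀ p, Metric.closedBall (chartAt (EuclideanSpace ℝ (Fin n)) p p) (r p) ⊆
      (chartAt (EuclideanSpace ℝ (Fin n)) p).target := fun p ↦
    (Metric.closedBall_subset_closedBall (by linarith [hr p])).trans (hrt p)
  have hopen : ∀ p, ∀ s ≤ r p, IsOpen ((chartAt (EuclideanSpace ℝ (Fin n)) p).symm ''
      Metric.ball (chartAt (EuclideanSpace ℝ (Fin n)) p p) s) := fun p s hs ↦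
    (chartAt (EuclideanSpace ℝ (Fin n)) p).isOpen_image_symm_of_subset_target
      Metric.isOpen_ball ((Metric.ball_subset_closedBall.trans
        (Metric.closedBall_subset_closedBall hs)).trans (hrt' p))
  have key : ∀ t' : Finset M, m ≤ vol n M (Ω ∪ ⋃ p ∈ t',
      (chartAt (EuclideanSpace ℝ (Fin n)) p).symm ''
        Metric.ball (chartAt (EuclideanSpace ℝ (Fin n)) p p) (r p)) →
      ∃ V : Set M, IsOpen V ∧ vol n M (Ω ∪ V) = m := by
    intro t'
    induction t' using Finset.induction_on with
    | empty =>
      intro h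
      refine ⟨∅, isOpen_empty, ?_⟩
      simp only [Finset.notMem_empty, iUnion_of_empty, iUnion_empty] at h
      exact le_antisymm (by simpa using h1) h
    | insert p t' _ ih =>
      intro h
      set U := ⋃ p ∈ t', (chartAt (EuclideanSpace ℝ (Fin n)) p).symm ''
        Metric.ball (chartAt (EuclideanSpace ℝ (Fin n)) p p) (r p) with hU
      rcases le_total m (vol n M (Ω ∪ U)) with h3 | h3
      · exact ih h3
      rw [Finset.set_biUnion_insert, ← hU, Set.union_comm _ U, ← Set.union_assoc] at h
      obtain ⟨s, hs, hsm⟩ := intermediate_value_Icc (hr p).le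
        (continuousOn_vol_union_ball hn (chart_mem_atlas _ p) (hrt' p) (Ω ∪ U))
        ⟨by simpa using h3, h⟩
      refine ⟨U ∪ (chartAt (EuclideanSpace ℝ (Fin n)) p).symm ''
        Metric.ball (chartAt (EuclideanSpace ℝ (Fin n)) p p) s, ?_, ?_⟩
      · exact (isOpen_biUnion fun q _ ↦ hopen q _ le_rfl).union (hopen p s hs.2)
      · rw [← Set.union_assoc]
        exact hsm
  exact key t (h2.trans (measure_mono (ht.trans Set.subset_union_right)))

theorem vol_pos_of_isOpen {U : Set M} (hU : IsOpen U) (hne : U.Nonempty) : 0 < vol n M U := by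
  obtain ⟨p, hp⟩ := hne
  rw [pos_iff_ne_zero]
  intro h0
  have h1 : ∀ᵐ q ∂(vol n M), q ∉ U := measure_eq_zero_iff_ae_notMem.1 h0
  have h2 := ae_chart_of_ae_vol (chart_mem_atlas (EuclideanSpace ℝ (Fin n)) p) h1
  set e := chartAt (EuclideanSpace ℝ (Fin n)) p
  have h3 : IsOpen (e.target ∩ e.symm ⁻¹' U) := e.isOpen_inter_preimage_symm hU
  rw [ae_restrict_iff' e.open_target.measurableSet] at h2
  have h4 : volume (e.target ∩ e.symm ⁻¹' U) = 0 :=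
    measure_mono_null (fun y hy ↦ by simpa using hy) h2
  refine (h3.measure_pos volume ⟨e p, mem_chart_target _ p, ?_⟩).ne' h4
  simpa [e] using hp

/-- There are open sets of small volume that support nontrivial smooth functions. -/
theorem exists_isOpen_contMDiff_support [T2Space M] [Nonempty M] (hn : n ≠ 0) {m : ℝ≥0∞}
    (hm : 0 < m) :
    ∃ (U : Set M) (φ : M → ℝ), IsOpen U ∧ vol n M U ≤ m ∧ ContMDiff (𝓡 n) 𝓘(ℝ, ℝ) ∞ φ ∧
      (∀ p, p ∉ U → φ p = 0) ∧ ¬ φ =ᵐ[vol n M] 0 := by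
  obtain ⟨p⟩ := ‹Nonempty M›
  set e := chartAt (EuclideanSpace ℝ (Fin n)) p with he
  obtain ⟨r, hr, hrt⟩ := Metric.nhds_basis_closedBall.mem_iff.1
    (e.open_target.mem_nhds (mem_chart_target _ p))
  have h1 := continuousOn_vol_union_ball hn (chart_mem_atlas _ p) hrt ∅ 0 ⟨le_rfl, hr.le⟩
  rw [ContinuousWithinAt] at h1
  simp only [Set.empty_union, Metric.ball_zero, Set.image_empty, measure_empty] at h1
  have h2 : ∀ᶠ t in 𝓝[Icc 0 r] (0 : ℝ), vol n M (e.symm '' Metric.ball (e p) t) < m :=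
    h1.eventually (gt_mem_nhds hm)
  have h3 : ∀ᶠ t in 𝓝[>] (0 : ℝ), t ∈ Ioc 0 r ∧ vol n M (e.symm '' Metric.ball (e p) t) < m := by
    have h4 : 𝓝[Ioc 0 r] (0 : ℝ) ≤ 𝓝[Icc 0 r] 0 := nhdsWithin_mono _ Ioc_subset_Icc_self
    rw [nhdsWithin_Ioc_eq_nhdsGT hr] at h4
    exact Filter.Eventually.and (Ioc_mem_nhdsGT hr) (h2.filter_mono h4)
  obtain ⟨t, ht, htm⟩ := h3.exists
  set U := e.symm '' Metric.ball (e p) t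
  have hU : IsOpen U := e.isOpen_image_symm_of_subset_target
      Metric.isOpen_ball ((Metric.ball_subset_closedBall.trans
        (Metric.closedBall_subset_closedBall ht.2)).trans hrt)
  have hp : p ∈ U := ⟨e p, Metric.mem_ball_self ht.1, e.left_inv (mem_chart_source _ p)⟩
  obtain ⟨f, hf0, hf1, -⟩ := exists_contMDiffMap_zero_one_of_isClosed (n := (⊤ : ℕ∞)) (𝓡 n)
    hU.isClosed_compl (isClosed_singleton (x := p)) (by simpa using hp)
  refine ⟨U, f, hU, htm.le, f.contMDiff, fun q hq ↦ hf0 hq, fun h ↦ ?_⟩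
  have h5 : IsOpen {q | f q ≠ 0} := isOpen_ne_fun f.contMDiff.continuous continuous_const
  refine (vol_pos_of_isOpen (n := n) h5 ⟨p, ?_⟩).ne' h
  simp [hf1 (Set.mem_singleton p)]

end Enlargement

/-! ### Minimizing the energy -/

section EnergyMinimization

/-- Convergence in `L²` implies convergence of the `L²` norms. The triangle inequality is stated for
the pointwise norms, so that the lemma applies to vector fields on `M` too. -/
theorem tendsto_lintegral_sq_of_le {α : Type*} [MeasurableSpace α] {μ : Measure α}
    {f h : ℕ → α → ℝ≥0∞} {g : α → ℝ≥0∞} (hf : ∀ k, AEMeasurable (f k) μ) (hg : AEMeasurable g μ)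
    (hh : ∀ k, AEMeasurable (h k) μ) (h1 : ∀ k p, f k p ≤ g p + h k p)
    (h2 : ∀ k p, g p ≤ f k p + h k p)
    (h0 : Filter.Tendsto (fun k ↦ ∫⁻ p, h k p ^ 2 ∂μ) Filter.atTop (𝓝 0)) :
    Filter.Tendsto (fun k ↦ ∫⁻ p, f k p ^ 2 ∂μ) Filter.atTop (𝓝 (∫⁻ p, g p ^ 2 ∂μ)) := by
  simp only [← eLpNorm_two_sq_ennreal] at h0 ⊢
  have h3 := tendsto_zero_of_sq h0
  refine ((ENNReal.continuous_pow 2).tendsto _).comp ?_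
  have h4 : ∀ k, eLpNorm (f k) 2 μ ≤ eLpNorm g 2 μ + eLpNorm (h k) 2 μ := fun k ↦
    (eLpNorm_mono_enorm (g := g + h k) fun p ↦ h1 k p).trans
      (eLpNorm_add_le hg.aestronglyMeasurable (hh k).aestronglyMeasurable (by norm_num))
  have h5 : ∀ k, eLpNorm g 2 μ ≤ eLpNorm (f k) 2 μ + eLpNorm (h k) 2 μ := fun k ↦
    (eLpNorm_mono_enorm (g := f k + h k) fun p ↦ h2 k p).trans
      (eLpNorm_add_le (hf k).aestronglyMeasurable (hh k).aestronglyMeasurable (by norm_num))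
  have h6 := ENNReal.Tendsto.sub (tendsto_const_nhds (x := eLpNorm g 2 μ)) h3
    (Or.inr ENNReal.zero_ne_top)
  have h7 := (tendsto_const_nhds (x := eLpNorm g 2 μ)).add h3
  rw [tsub_zero] at h6
  rw [add_zero] at h7
  exact tendsto_of_tendsto_of_tendsto_of_le_of_le h6 h7
    (fun k ↦ tsub_le_iff_right.2 (h5 k)) h4

theorem tendsto_lintegral_enorm_sq {α : Type*} [MeasurableSpace α] {μ : Measure α}
    {f : ℕ → α → ℝ} {g : α → ℝ} (hf : ∀ k, AEStronglyMeasurable (f k) μ)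
    (hg : AEStronglyMeasurable g μ)
    (h0 : Filter.Tendsto (fun k ↦ ∫⁻ p, ‖f k p - g p‖ₑ ^ 2 ∂μ) Filter.atTop (𝓝 0)) :
    Filter.Tendsto (fun k ↦ ∫⁻ p, ‖f k p‖ₑ ^ 2 ∂μ) Filter.atTop (𝓝 (∫⁻ p, ‖g p‖ₑ ^ 2 ∂μ)) := by
  refine tendsto_lintegral_sq_of_le (fun k ↦ (hf k).enorm) hg.enorm
    (fun k ↦ ((hf k).sub hg).enorm) (fun k p ↦ ?_) (fun k p ↦ ?_) h0
  · simpa using enorm_add_le (g p) (f k p - g p)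
  · simpa using enorm_sub_le (a := f k p) (b := f k p - g p)

variable {n : ℕ} {M : Type*} [TopologicalSpace M] [ChartedSpace (EuclideanSpace ℝ (Fin n)) M]
  [RiemannianBundle (fun p : M ↦ TangentSpace (𝓡 n) p)] [IsManifold (𝓡 n) ∞ M]
  [MeasurableSpace M] [BorelSpace M]
  [IsContMDiffRiemannianBundle (𝓡 n) ∞ (EuclideanSpace ℝ (Fin n))
      (fun p : M ↦ TangentSpace (𝓡 n) p)] [CompactSpace M]

theorem tendsto_lintegral_enorm_sq_section {X : (p : M) → TangentSpace (𝓡 n) p}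
    {Y : ℕ → (p : M) → TangentSpace (𝓡 n) p} (hY : ∀ k, MeasurableSection (Y k))
    (hX : MeasurableSection X)
    (h0 : Filter.Tendsto (fun k ↦ ∫⁻ p, ‖Y k p - X p‖ₑ ^ 2 ∂(vol n M)) Filter.atTop (𝓝 0)) :
    Filter.Tendsto (fun k ↦ ∫⁻ p, ‖Y k p‖ₑ ^ 2 ∂(vol n M)) Filter.atTop
      (𝓝 (∫⁻ p, ‖X p‖ₑ ^ 2 ∂(vol n M))) := by
  refine tendsto_lintegral_sq_of_le (fun k ↦ (hY k).aemeasurable_enorm) hX.aemeasurable_enorm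
    (fun k ↦ ((hY k).sub hX).aemeasurable_enorm) (fun k p ↦ ?_) (fun k p ↦ ?_) h0
  · simpa using enorm_add_le (X p) (Y k p - X p)
  · simpa using enorm_sub_le (a := Y k p) (b := Y k p - X p)

theorem lintegral_grad_parallelogram {φ χ : M → ℝ} (hφ : ContMDiff (𝓡 n) 𝓘(ℝ, ℝ) ∞ φ)
    (hχ : ContMDiff (𝓡 n) 𝓘(ℝ, ℝ) ∞ χ) :
    (∫⁻ p, ‖grad n (fun p ↦ φ p - χ p) p‖ₑ ^ 2 ∂(vol n M)) +
      4 * ∫⁻ p, ‖grad n (fun p ↦ (1 / 2 : ℝ) * φ p + (1 / 2 : ℝ) * χ p) p‖ₑ ^ 2 ∂(vol n M) =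
    2 * (∫⁻ p, ‖grad n φ p‖ₑ ^ 2 ∂(vol n M)) + 2 * ∫⁻ p, ‖grad n χ p‖ₑ ^ 2 ∂(vol n M) := by
  have hm : ∀ f : M → ℝ, ContMDiff (𝓡 n) 𝓘(ℝ, ℝ) ∞ f →
      AEMeasurable (fun p ↦ ‖grad n f p‖ₑ ^ 2) (vol n M) := fun f hf ↦
    (isWeakGradient_grad hf).measurableSection.aemeasurable_enorm.pow_const 2
  have hcast : ∀ x y z w : ℝ, 0 ≤ x → 0 ≤ y → 0 ≤ z → 0 ≤ w →
      x ^ 2 + 4 * y ^ 2 = 2 * z ^ 2 + 2 * w ^ 2 → ENNReal.ofReal x ^ 2 + 4 * ENNReal.ofReal y ^ 2 =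
        2 * ENNReal.ofReal z ^ 2 + 2 * ENNReal.ofReal w ^ 2 := by
    intro x y z w hx hy hz hw h
    rw [← ENNReal.ofReal_pow hx, ← ENNReal.ofReal_pow hy, ← ENNReal.ofReal_pow hz,
      ← ENNReal.ofReal_pow hw, show (4 : ℝ≥0∞) = ENNReal.ofReal 4 by norm_num,
      show (2 : ℝ≥0∞) = ENNReal.ofReal 2 by norm_num, ← ENNReal.ofReal_mul (by norm_num),
      ← ENNReal.ofReal_mul (by norm_num), ← ENNReal.ofReal_mul (by norm_num),
      ← ENNReal.ofReal_add (by positivity) (by positivity),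
      ← ENNReal.ofReal_add (by positivity) (by positivity), h]
  rw [← lintegral_const_mul' _ _ (by finiteness), ← lintegral_const_mul' _ _ (by finiteness),
    ← lintegral_const_mul' _ _ (by finiteness), ← lintegral_add_left' (hm _ (hφ.sub hχ)),
    ← lintegral_add_left' ((hm _ hφ).const_mul 2)]
  refine lintegral_congr fun p ↦ ?_
  have hφ2 : ContMDiff (𝓡 n) 𝓘(ℝ, ℝ) ∞ (fun p ↦ (1 / 2 : ℝ) * φ p) := contMDiff_const.mul hφ
  have hχ2 : ContMDiff (𝓡 n) 𝓘(ℝ, ℝ) ∞ (fun p ↦ (1 / 2 : ℝ) * χ p) := contMDiff_const.mul hχ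
  rw [grad_sub hφ hχ, grad_add hφ2 hχ2, grad_const_mul hφ, grad_const_mul hχ, ← smul_add]
  set a := grad n φ p
  set b := grad n χ p
  have h1 := parallelogram_law_with_norm ℝ a b
  have h2 : ‖a - b‖ ^ 2 + 4 * ‖(1 / 2 : ℝ) • (a + b)‖ ^ 2 = 2 * ‖a‖ ^ 2 + 2 * ‖b‖ ^ 2 := by
    rw [norm_smul, mul_pow]
    norm_num
    linarith
  simp only [← ofReal_norm]
  exact hcast _ _ _ _ (norm_nonneg _) (norm_nonneg _) (norm_nonneg _) (norm_nonneg _) h2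

/-- A sequence of smooth functions that converges in `L²`, with energies asymptotically bounded by
`Λ`, has an `H¹` limit of energy at most `Λ`. In place of weak compactness, convex combinations of
the tails that almost minimize the energy are used: by the parallelogram identity, they form a
Cauchy sequence. -/
theorem exists_h1_limit_of_energy_le {ψ : ℕ → M → ℝ}
    (hψ : ∀ k, ContMDiff (𝓡 n) 𝓘(ℝ, ℝ) ∞ (ψ k)) {u : M → ℝ} (hu : MemLp u 2 (vol n M))
    (hlim : Filter.Tendsto (fun k ↦ ∫⁻ p, ‖ψ k p - u p‖ₑ ^ 2 ∂(vol n M)) Filter.atTop (𝓝 0))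
    {Λ : ℝ≥0∞} (hΛ : Λ ≠ ⊤) {δ : ℕ → ℝ≥0∞} (hδ : Filter.Tendsto δ Filter.atTop (𝓝 0))
    (hE : ∀ k, ∫⁻ p, ‖grad n (ψ k) p‖ₑ ^ 2 ∂(vol n M) ≤ Λ + δ k) :
    ∃ (φ : ℕ → M → ℝ) (w : M → ℝ) (X : (p : M) → TangentSpace (𝓡 n) p),
      (∀ k, ContMDiff (𝓡 n) 𝓘(ℝ, ℝ) ∞ (φ k)) ∧ w =ᵐ[vol n M] u ∧
      IsWeakGradient n w X ∧ MemLp w 2 (vol n M) ∧ MemLp (fun p ↦ ‖X p‖) 2 (vol n M) ∧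
      QuasiContinuous n w ∧
      Filter.Tendsto (fun k ↦ ∫⁻ p, ‖φ k p - w p‖ₑ ^ 2 ∂(vol n M)) Filter.atTop (𝓝 0) ∧
      Filter.Tendsto (fun k ↦ ∫⁻ p, ‖grad n (φ k) p - X p‖ₑ ^ 2 ∂(vol n M))
        Filter.atTop (𝓝 0) ∧
      ∫⁻ p, ‖X p‖ₑ ^ 2 ∂(vol n M) ≤ Λ := by
  -- The convex hulls of the tails, and the infima of the energy on them.
  let T : ℕ → Set (M → ℝ) := fun k ↦ convexHull ℝ {f | ∃ j, k ≤ j ∧ ψ j = f}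
  let E : (M → ℝ) → ℝ≥0∞ := fun f ↦ ∫⁻ p, ‖grad n f p‖ₑ ^ 2 ∂(vol n M)
  let d : ℕ → ℝ≥0∞ := fun k ↦ ⨅ f ∈ T k, E f
  have hTmem : ∀ k j, k ≤ j → ψ j ∈ T k := fun k j hkj ↦ subset_convexHull ℝ _ ⟨j, hkj, rfl⟩
  have hTanti : ∀ i j, i ≤ j → T j ⊆ T i := fun i j hij ↦
    convexHull_mono fun f ⟨l, hl, hf⟩ ↦ ⟨l, hij.trans hl, hf⟩
  have hTsm : ∀ k, ∀ f ∈ T k, ContMDiff (𝓡 n) 𝓘(ℝ, ℝ) ∞ f := by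
    intro k
    refine convexHull_min (t := {f | ContMDiff (𝓡 n) 𝓘(ℝ, ℝ) ∞ f}) ?_ ?_
    · rintro _ ⟨j, -, rfl⟩
      exact hψ j
    · intro f hf g hg a b _ _ _
      exact (contMDiff_const.mul hf).add (contMDiff_const.mul hg)
  have hTdist : ∀ ε : ℝ≥0∞, 0 < ε → ∃ N, ∀ f ∈ T N, eLpNorm (fun p ↦ f p - u p) 2 (vol n M) ≤ ε := by
    intro ε hε
    have h1 := tendsto_lintegral_sq_iff.1 hlim
    obtain ⟨N, hN⟩ := Filter.eventually_atTop.1 (h1.eventually (ge_mem_nhds hε))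
    refine ⟨N, fun f hf ↦ ?_⟩
    have h2 : T N ⊆ {f | AEStronglyMeasurable f (vol n M) ∧
        eLpNorm (fun p ↦ f p - u p) 2 (vol n M) ≤ ε} := by
      refine convexHull_min ?_ ?_
      · rintro _ ⟨j, hj, rfl⟩
        exact ⟨(hψ j).continuous.aestronglyMeasurable, hN j hj⟩
      · rintro f ⟨hf, hf'⟩ g ⟨hg, hg'⟩ a b ha hb hab
        refine ⟨(hf.const_smul a).add (hg.const_smul b), ?_⟩
        have h3 : (fun p ↦ (a • f + b • g) p - u p) =
            a • (fun p ↦ f p - u p) + b • (fun p ↦ g p - u p) := by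
          ext p
          simp only [Pi.add_apply, Pi.smul_apply, smul_eq_mul]
          linear_combination u p * hab
        rw [h3]
        refine (eLpNorm_add_le ((hf.sub hu.1).const_smul a) ((hg.sub hu.1).const_smul b)
          (by norm_num)).trans ?_
        rw [eLpNorm_const_smul, eLpNorm_const_smul, Real.enorm_of_nonneg ha,
          Real.enorm_of_nonneg hb]
        refine (add_le_add (mul_le_mul_right hf' _) (mul_le_mul_right hg' _)).trans_eq ?_
        rw [← add_mul, ← ENNReal.ofReal_add ha hb, hab, ENNReal.ofReal_one, one_mul]
    exact (h2 hf).2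
  have hdΛ : ∀ k, d k ≤ Λ := by
    intro k
    have h1 : Filter.Tendsto (fun j ↦ Λ + δ j) Filter.atTop (𝓝 Λ) := by
      simpa using tendsto_const_nhds.add hδ
    refine ge_of_tendsto h1 (Filter.eventually_atTop.2 ⟨k, fun j hj ↦ ?_⟩)
    exact (iInf₂_le (ψ j) (hTmem k j hj)).trans (hE j)
  have hdtop : ∀ k, d k ≠ ⊤ := fun k ↦ ne_top_of_le_ne_top hΛ (hdΛ k)
  have hdmono : Monotone d := fun i j hij ↦ biInf_mono fun f hf ↦ hTanti i j hij hf
  have hη : Filter.Tendsto (fun k : ℕ ↦ ((k : ℝ≥0∞) + 1)⁻¹) Filter.atTop (𝓝 0) := by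
    have h1 := (ENNReal.tendsto_inv_nat_nhds_zero).comp (Filter.tendsto_add_atTop_nat 1)
    simpa [Function.comp_def] using h1
  have hηanti : ∀ i j : ℕ, i ≤ j → ((j : ℝ≥0∞) + 1)⁻¹ ≤ ((i : ℝ≥0∞) + 1)⁻¹ := fun i j hij ↦
    ENNReal.inv_le_inv.2 (by gcongr)
  have hex : ∀ k : ℕ, ∃ f ∈ T k, E f ≤ d k + ((k : ℝ≥0∞) + 1)⁻¹ := by
    intro k
    have h1 : d k < d k + ((k : ℝ≥0∞) + 1)⁻¹ :=
      ENNReal.lt_add_right (hdtop k) (by simp [ENNReal.add_eq_top])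
    obtain ⟨f, hf⟩ := iInf_lt_iff.1 h1
    obtain ⟨hfT, hf⟩ := iInf_lt_iff.1 hf
    exact ⟨f, hfT, hf.le⟩
  choose χ hχT hχE using hex
  have hχ : ∀ k, ContMDiff (𝓡 n) 𝓘(ℝ, ℝ) ∞ (χ k) := fun k ↦ hTsm k _ (hχT k)
  have hcauchy : ∀ ε : ℝ≥0∞, 0 < ε → ∃ N, ∀ i ≥ N, ∀ j ≥ N, E (fun p ↦ χ i p - χ j p) ≤ ε := by
    intro ε hε
    have h1 : Filter.Tendsto d Filter.atTop (𝓝 (⨆ k, d k)) := tendsto_atTop_iSup hdmono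
    have hsup : (⨆ k, d k) ≠ ⊤ := ne_top_of_le_ne_top hΛ (iSup_le hdΛ)
    have h2 : Filter.Tendsto (fun k : ℕ ↦ 4 * ((⨆ k, d k) - d k + ((k : ℝ≥0∞) + 1)⁻¹))
        Filter.atTop (𝓝 0) := by
      have h3 := (ENNReal.Tendsto.sub (tendsto_const_nhds (x := ⨆ k, d k)) h1
        (Or.inl hsup)).add hη
      have h4 := ENNReal.Tendsto.const_mul (a := 4) h3 (Or.inr (by simp))
      simpa using h4
    obtain ⟨N, hN⟩ := (h2.eventually (ge_mem_nhds hε)).exists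
    refine ⟨N, fun i hi j hj ↦ le_trans ?_ hN⟩
    have h5 := lintegral_grad_parallelogram (hχ i) (hχ j)
    have h6 : d N ≤ E (fun p ↦ (1 / 2 : ℝ) * χ i p + (1 / 2 : ℝ) * χ j p) := by
      refine iInf₂_le _ ?_
      exact (convex_convexHull ℝ _) (hTanti N i hi (hχT i)) (hTanti N j hj (hχT j))
        (by norm_num) (by norm_num) (by norm_num)
    have h7 : ∀ l ≥ N, E (χ l) ≤ (⨆ k, d k) + ((N : ℝ≥0∞) + 1)⁻¹ := fun l hl ↦
      (hχE l).trans (add_le_add (le_iSup d l) (hηanti N l hl))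
    have h8 : E (fun p ↦ χ i p - χ j p) + 4 * d N ≤
        4 * ((⨆ k, d k) - d N + ((N : ℝ≥0∞) + 1)⁻¹) + 4 * d N := by
      refine (add_le_add_right (mul_le_mul_right h6 4) _).trans (h5.le.trans ?_)
      refine (add_le_add (mul_le_mul_right (h7 i hi) 2) (mul_le_mul_right (h7 j hj) 2)).trans_eq ?_
      rw [← mul_add 4, add_right_comm, tsub_add_cancel_of_le (le_iSup d N)]
      ring
    exact ENNReal.le_of_add_le_add_right (ENNReal.mul_ne_top (by simp) (hdtop N)) h8
  obtain ⟨σ, w, X, hσ, hX, hw2, hX2, hqc, hl1, hl2⟩ := exists_quasiContinuous_limit hχ (by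
    intro ε hε
    have hε2 : 0 < ε / 2 := ENNReal.half_pos hε.ne'
    obtain ⟨N1, hN1⟩ := hcauchy ((ε / 2) ^ 2) (ENNReal.pow_pos hε2 2)
    obtain ⟨N2, hN2⟩ := hTdist (ε / 2 / 2) (ENNReal.half_pos hε2.ne')
    refine ⟨max N1 N2, fun i hi j hj ↦ ?_⟩
    rw [← ENNReal.add_halves ε]
    refine add_le_add ?_ ?_
    · rw [← ENNReal.add_halves (ε / 2), eLpNorm_enorm]
      have h1 : (fun p ↦ χ i p - χ j p) = (fun p ↦ χ i p - u p) - fun p ↦ χ j p - u p := by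
        ext p
        simp
      rw [h1]
      refine (eLpNorm_sub_le ((hχ i).continuous.aestronglyMeasurable.sub hu.1)
        ((hχ j).continuous.aestronglyMeasurable.sub hu.1) (by norm_num)).trans ?_
      exact add_le_add (hN2 _ (hTanti _ i ((le_max_right _ _).trans hi) (hχT i)))
        (hN2 _ (hTanti _ j ((le_max_right _ _).trans hj) (hχT j)))
    · rw [← ENNReal.pow_le_pow_left_iff two_ne_zero, eLpNorm_two_sq_ennreal]
      exact hN1 i ((le_max_left _ _).trans hi) j ((le_max_left _ _).trans hj))
  have hχm : ∀ k, AEStronglyMeasurable (χ k) (vol n M) := fun k ↦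
    (hχ k).continuous.aestronglyMeasurable
  refine ⟨fun k ↦ χ (σ k), w, X, fun k ↦ hχ _, ?_, hX, hw2, hX2, hqc, hl1, hl2, ?_⟩
  · have h1 : Filter.Tendsto (fun k ↦ eLpNorm (χ (σ k) - u) 2 (vol n M)) Filter.atTop (𝓝 0) := by
      refine ENNReal.tendsto_nhds_zero.2 fun ε hε ↦ ?_
      obtain ⟨N, hN⟩ := hTdist ε hε
      refine Filter.eventually_atTop.2 ⟨N, fun k hk ↦ ?_⟩
      exact hN _ (hTanti N _ (hk.trans (hσ.id_le k)) (hχT _))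
    exact tendstoInMeasure_ae_unique
      (tendstoInMeasure_of_tendsto_eLpNorm two_ne_zero (fun k ↦ hχm (σ k)) hw2.1
        (tendsto_lintegral_sq_iff.1 hl1))
      (tendstoInMeasure_of_tendsto_eLpNorm two_ne_zero (fun k ↦ hχm (σ k)) hu.1 h1)
  · have h1 := tendsto_lintegral_enorm_sq_section
      (fun k ↦ (isWeakGradient_grad (hχ (σ k))).measurableSection) hX.measurableSection hl2
    have h2 : Filter.Tendsto (fun k ↦ Λ + (((σ k : ℕ) : ℝ≥0∞) + 1)⁻¹) Filter.atTop (𝓝 Λ) := by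
      simpa using tendsto_const_nhds.add (hη.comp hσ.tendsto_atTop)
    exact le_of_tendsto_of_tendsto' h1 h2 fun k ↦
      (hχE (σ k)).trans (add_le_add_left (hdΛ _) _)

end EnergyMinimization

/-! ### Existence of the optimal set -/

section Existence

/-- The set `s` need not be measurable, and a quasi-open set need not be Borel. -/
theorem setLIntegral_eq_lintegral_of_ae {α : Type*} [MeasurableSpace α] {μ : Measure α}
    {f : α → ℝ≥0∞} (hf : AEMeasurable f μ) {s : Set α} (h : ∀ᵐ p ∂μ, p ∉ s → f p = 0) :
    ∫⁻ p in s, f p ∂μ = ∫⁻ p, f p ∂μ := by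
  refine le_antisymm (setLIntegral_le_lintegral _ _) ?_
  have hm : NullMeasurableSet {p | f p ≠ 0} μ :=
    hf.nullMeasurable (measurableSet_singleton (0 : ℝ≥0∞)).compl
  have h1 : ∫⁻ p, f p ∂μ = ∫⁻ p in {p | f p ≠ 0}, f p ∂μ := by
    rw [← lintegral_indicator₀ hm]
    refine lintegral_congr fun p ↦ ?_
    by_cases hp : f p = 0
    · rw [hp, Set.indicator_of_notMem (show p ∉ {p | f p ≠ 0} from not_not.2 hp)]
    · rw [Set.indicator_of_mem (show p ∈ {p | f p ≠ 0} from hp)]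
  rw [h1]
  refine lintegral_mono' (Measure.restrict_mono' ?_ le_rfl) le_rfl
  filter_upwards [h] with p hp hfp
  by_contra hps
  exact hfp (hp hps)

variable {n : ℕ} {M : Type*} [TopologicalSpace M] [ChartedSpace (EuclideanSpace ℝ (Fin n)) M]
  [RiemannianBundle (fun p : M ↦ TangentSpace (𝓡 n) p)] [IsManifold (𝓡 n) ∞ M]
  [MeasurableSpace M] [BorelSpace M]
  [IsContMDiffRiemannianBundle (𝓡 n) ∞ (EuclideanSpace ℝ (Fin n))
      (fun p : M ↦ TangentSpace (𝓡 n) p)] [CompactSpace M]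

/-- The approximation by smooth functions in `H¹₀(M)`, in terms of the gradients instead of
`h1NormSq`. -/
theorem MemH10.exists_approx {u : M → ℝ} (hu : MemH10 n u) :
    IsWeakGradient n u (weakGrad n u) ∧ MemLp u 2 (vol n M) ∧
      MemLp (fun p ↦ ‖weakGrad n u p‖) 2 (vol n M) ∧
      ∃ φ : ℕ → M → ℝ, (∀ k, ContMDiff (𝓡 n) 𝓘(ℝ, ℝ) ∞ (φ k)) ∧
        Filter.Tendsto (fun k ↦ ∫⁻ p, ‖φ k p - u p‖ₑ ^ 2 ∂(vol n M)) Filter.atTop (𝓝 0) ∧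
        Filter.Tendsto (fun k ↦ ∫⁻ p, ‖grad n (φ k) p - weakGrad n u p‖ₑ ^ 2 ∂(vol n M))
          Filter.atTop (𝓝 0) := by
  obtain ⟨⟨hu2, X, hX, hX2⟩, happ⟩ := hu
  have hw : IsWeakGradient n u (weakGrad n u) := by
    rw [weakGrad, dif_pos ⟨X, hX⟩]
    exact Exists.choose_spec (⟨X, hX⟩ : ∃ X, IsWeakGradient n u X)
  have hη : Filter.Tendsto (fun k : ℕ ↦ ((k : ℝ≥0∞))⁻¹) Filter.atTop (𝓝 0) :=
    ENNReal.tendsto_inv_nat_nhds_zero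
  choose φ hφ _ hφu using fun k : ℕ ↦ happ ((k : ℝ≥0∞))⁻¹ (by simp)
  have hle : ∀ k, (∫⁻ p, ‖φ k p - u p‖ₑ ^ 2 ∂(vol n M)) +
      ∫⁻ p, ‖grad n (φ k) p - weakGrad n u p‖ₑ ^ 2 ∂(vol n M) ≤ ((k : ℝ≥0∞))⁻¹ := by
    intro k
    refine le_of_eq_of_le ?_ (hφu k).le
    rw [(hw.sub (isWeakGradient_grad (hφ k))).h1NormSq_eq]
    simp only [enorm_sub_rev (u _), enorm_sub_rev (weakGrad n u _)]
  refine ⟨hw, hu2, hX2.congr_norm hw.measurableSection.aemeasurable_norm.aestronglyMeasurable ?_,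
    φ, hφ, ?_, ?_⟩
  · filter_upwards [hX.weakGrad_ae_eq] with p hp
    rw [hp]
  · exact tendsto_of_tendsto_of_tendsto_of_le_of_le tendsto_const_nhds hη (fun _ ↦ zero_le)
      fun k ↦ le_self_add.trans (hle k)
  · exact tendsto_of_tendsto_of_tendsto_of_le_of_le tendsto_const_nhds hη (fun _ ↦ zero_le)
      fun k ↦ le_add_self.trans (hle k)

theorem MemH10On.ae_eq_zero {Ω : Set M} {u : M → ℝ} (hu : MemH10On n Ω u) :
    ∀ᵐ p ∂(vol n M), p ∉ Ω → u p = 0 := by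
  obtain ⟨-, w, hwu, -, hcap⟩ := hu
  have h1 : vol n M {p | p ∉ Ω ∧ w p ≠ 0} = 0 := le_antisymm (hcap ▸ vol_le_cap _) zero_le
  filter_upwards [hwu, measure_eq_zero_iff_ae_notMem.1 h1] with p hp hp' hpΩ
  rw [← hp]
  by_contra h
  exact hp' ⟨hpΩ, h⟩

/-- The gradient of an element of `H¹₀(Ω)` vanishes almost everywhere outside `Ω`, so that its
Rayleigh quotient can be computed with integrals over `M`. -/
theorem MemH10On.rayleigh_eq {Ω : Set M} {u : M → ℝ} (hu : MemH10On n Ω u) :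
    rayleigh n Ω u = (∫⁻ p, ‖weakGrad n u p‖ₑ ^ 2 ∂(vol n M)) / ∫⁻ p, ‖u p‖ₑ ^ 2 ∂(vol n M) := by
  obtain ⟨hX, hu2, hX2, φ, hφ, h1, h2⟩ := hu.1.exists_approx
  rw [rayleigh, setLIntegral_eq_lintegral_of_ae
    (hX.measurableSection.aemeasurable_enorm.pow_const 2),
    setLIntegral_eq_lintegral_of_ae (hu2.1.enorm.pow_const 2)]
  · filter_upwards [hu.ae_eq_zero] with p hp hpΩ
    simp [hp hpΩ]
  · filter_upwards [hu.ae_eq_zero, weakGradient_ae_eq_zero hφ hX hu2 hX2 h1 h2] with p hp hp' hpΩ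
    simp [hp' (hp hpΩ)]

theorem lintegral_sq_pos {u : M → ℝ} (hu : MemLp u 2 (vol n M)) (h0 : ¬ u =ᵐ[vol n M] 0) :
    ∫⁻ p, ‖u p‖ₑ ^ 2 ∂(vol n M) ≠ 0 := by
  intro h
  rw [lintegral_eq_zero_iff' (hu.1.enorm.pow_const 2)] at h
  refine h0 ?_
  filter_upwards [h] with p hp
  simpa using hp

theorem _root_.IsOpen.quasiOpen {Ω : Set M} (hΩ : IsOpen Ω) : QuasiOpen n Ω := fun ε hε ↦
  ⟨∅, isOpen_empty, by rwa [cap_empty], by simpa using hΩ⟩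

theorem MemH10.memH10On {u : M → ℝ} (hu : MemH10 n u) (hqc : QuasiContinuous n u) {Ω : Set M}
    (h : ∀ p, p ∉ Ω → u p = 0) : MemH10On n Ω u := by
  refine ⟨hu, u, Filter.EventuallyEq.rfl, hqc, ?_⟩
  rw [show {p | p ∉ Ω ∧ u p ≠ 0} = ∅ from Set.eq_empty_of_forall_notMem fun p hp ↦ hp.2 (h p hp.1),
    cap_empty]

theorem memH10On_of_contMDiff {φ : M → ℝ} (hφ : ContMDiff (𝓡 n) 𝓘(ℝ, ℝ) ∞ φ) {Ω : Set M}
    (h : ∀ p, p ∉ Ω → φ p = 0) : MemH10On n Ω φ :=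
  (memH10_of_tendsto (φ := fun _ ↦ φ) (fun _ ↦ hφ) (isWeakGradient_grad hφ)
    (memLp_of_continuous hφ.continuous) (memLp_norm_grad hφ) (by simp) (by simp)).memH10On
    hφ.continuous.quasiContinuous h

/-- A normalized smooth approximation `ψ` of an element of `H¹₀(Ω)`: it is close in `L²` to a
function `v` of norm `1` that vanishes outside `Ω`, and its energy is controlled by the Rayleigh
quotient. -/
theorem exists_smooth_near_of_rayleigh_lt {Ω : Set M} {u : M → ℝ} (hu : MemH10On n Ω u)
    (hu0 : ¬ u =ᵐ[vol n M] 0) {B η : ℝ≥0∞} (hB : rayleigh n Ω u < B) (hη : 0 < η) :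
    ∃ ψ v : M → ℝ, ContMDiff (𝓡 n) 𝓘(ℝ, ℝ) ∞ ψ ∧ AEStronglyMeasurable v (vol n M) ∧
      (∫⁻ p, ‖v p‖ₑ ^ 2 ∂(vol n M) = 1) ∧ (∀ᵐ p ∂(vol n M), p ∉ Ω → v p = 0) ∧
      (∫⁻ p, ‖ψ p - v p‖ₑ ^ 2 ∂(vol n M) ≤ η) ∧
      ∫⁻ p, ‖grad n ψ p‖ₑ ^ 2 ∂(vol n M) ≤ B := by
  obtain ⟨hX, hu2, hX2, φ, hφ, h1, h2⟩ := hu.1.exists_approx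
  rw [hu.rayleigh_eq] at hB
  set a : ℝ≥0∞ := ∫⁻ p, ‖u p‖ₑ ^ 2 ∂(vol n M) with ha
  have ha0 : a ≠ 0 := lintegral_sq_pos hu2 hu0
  have hatop : a ≠ ⊤ := (lintegral_sq_lt_top hu2).ne
  have hB' : ∫⁻ p, ‖weakGrad n u p‖ₑ ^ 2 ∂(vol n M) < B * a :=
    (ENNReal.div_lt_iff (Or.inl ha0) (Or.inl hatop)).1 hB
  have h3 := tendsto_lintegral_enorm_sq_section
    (fun k ↦ (isWeakGradient_grad (hφ k)).measurableSection) hX.measurableSection h2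
  obtain ⟨k, hk1, hk2⟩ := ((h3.eventually (gt_mem_nhds hB')).and
    (h1.eventually (gt_mem_nhds (ENNReal.mul_pos hη.ne' ha0)))).exists
  -- The normalization to `L²` norm `1`.
  set c : ℝ := (√a.toReal)⁻¹
  have hc : ‖c‖ₑ ^ 2 = a⁻¹ := by
    rw [← ofReal_norm, ← ENNReal.ofReal_pow (norm_nonneg _), norm_inv, inv_pow,
      Real.norm_of_nonneg (Real.sqrt_nonneg _), Real.sq_sqrt ENNReal.toReal_nonneg,
      ENNReal.ofReal_inv_of_pos (ENNReal.toReal_pos ha0 hatop), ENNReal.ofReal_toReal hatop]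
  refine ⟨fun p ↦ c * φ k p, fun p ↦ c * u p, contMDiff_const.mul (hφ k), hu2.1.const_mul c,
    ?_, ?_, ?_, ?_⟩
  · simp only [enorm_mul, mul_pow, hc]
    rw [lintegral_const_mul' _ _ (ENNReal.inv_ne_top.2 ha0), ← ha, ENNReal.inv_mul_cancel ha0 hatop]
  · filter_upwards [hu.ae_eq_zero] with p hp hpΩ
    rw [hp hpΩ, mul_zero]
  · simp only [← mul_sub, enorm_mul, mul_pow, hc]
    rw [lintegral_const_mul' _ _ (ENNReal.inv_ne_top.2 ha0), mul_comm, ← div_eq_mul_inv]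
    exact ENNReal.div_le_of_le_mul hk2.le
  · simp only [grad_const_mul (hφ k), enorm_smul, mul_pow, hc]
    rw [lintegral_const_mul' _ _ (ENNReal.inv_ne_top.2 ha0), mul_comm, ← div_eq_mul_inv]
    exact ENNReal.div_le_of_le_mul hk1.le

/-- The measure of the set where a function does not vanish is lower semicontinuous with respect to
convergence almost everywhere. -/
theorem measure_ne_zero_le_of_tendsto {α : Type*} [MeasurableSpace α] {μ : Measure α}
    {v : ℕ → α → ℝ} {u : α → ℝ} {m : ℝ≥0∞} (hv : ∀ k, μ {p | v k p ≠ 0} ≤ m)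
    (h : ∀ᵐ p ∂μ, Filter.Tendsto (fun k ↦ v k p) Filter.atTop (𝓝 (u p))) :
    μ {p | u p ≠ 0} ≤ m := by
  let s : ℕ → Set α := fun N ↦ {p | ∀ k ≥ N, v k p ≠ 0}
  have hs : Monotone s := fun i j hij p hp k hk ↦ hp k (hij.trans hk)
  refine (measure_mono_ae (t := ⋃ N, s N) ?_).trans ?_
  · filter_upwards [h] with p hp hup
    obtain ⟨N, hN⟩ := Filter.eventually_atTop.1 (hp.eventually_ne hup)
    exact Set.mem_iUnion.2 ⟨N, hN⟩
  · rw [hs.measure_iUnion]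
    exact iSup_le fun N ↦ (measure_mono fun p (hp : p ∈ s N) ↦ hp N le_rfl).trans (hv N)

end Existence

end FaberKrahn

end

open FaberKrahn

theorem theorem1p1 (n : ℕ) (hn : 2 ≤ n) {M : Type*} [TopologicalSpace M] [T2Space M]
    [CompactSpace M] [ChartedSpace (EuclideanSpace ℝ (Fin n)) M] [IsManifold (𝓡 n) ∞ M]
    [RiemannianBundle (fun p : M ↦ TangentSpace (𝓡 n) p)]
    [IsContMDiffRiemannianBundle (𝓡 n) ∞ (EuclideanSpace ℝ (Fin n))
      (fun p : M ↦ TangentSpace (𝓡 n) p)]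
    [MeasurableSpace M] [BorelSpace M]
    (m : ℝ) (hm : 0 < m) (hmM : ENNReal.ofReal m < FaberKrahn.vol n M univ) :
    ∃ Ωstar : Set M,
      FaberKrahn.QuasiOpen n Ωstar ∧ FaberKrahn.vol n M Ωstar = ENNReal.ofReal m ∧
      (∃ u : M → ℝ, FaberKrahn.MemH10On n Ωstar u ∧ ¬ u =ᵐ[FaberKrahn.vol n M] 0 ∧
        FaberKrahn.rayleigh n Ωstar u = FaberKrahn.lambda1 n Ωstar) ∧
      FaberKrahn.lambda1 n Ωstar < ⊤ ∧
      ∀ Ω : Set M, FaberKrahn.QuasiOpen n Ω → FaberKrahn.vol n M Ω = ENNReal.ofReal m →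
        FaberKrahn.lambda1 n Ωstar ≤ FaberKrahn.lambda1 n Ω := by
  have hn0 : n ≠ 0 := by omega
  have hm0 : 0 < ENNReal.ofReal m := ENNReal.ofReal_pos.2 hm
  have : Nonempty M := by
    by_contra h
    rw [not_nonempty_iff] at h
    rw [Set.univ_eq_empty_iff.2 h, measure_empty] at hmM
    exact not_lt_zero hmM
  set Λ : ℝ≥0∞ := ⨅ (Ω : Set M) (_ : QuasiOpen n Ω ∧ vol n M Ω = ENNReal.ofReal m),
    lambda1 n Ω with hΛdef
  have hΛle : ∀ Ω : Set M, QuasiOpen n Ω → vol n M Ω = ENNReal.ofReal m → Λ ≤ lambda1 n Ω :=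
    fun Ω h1 h2 ↦ iInf₂_le Ω ⟨h1, h2⟩
  have hΛ : Λ ≠ ⊤ := by
    obtain ⟨U, φ, hU, hUm, hφ, hφU, hφ0⟩ := exists_isOpen_contMDiff_support (n := n) (M := M) hn0 hm0
    obtain ⟨V, hV, hVm⟩ := exists_isOpen_vol_union_eq hn0 hUm hmM.le
    have h1 : MemH10On n (U ∪ V) φ := memH10On_of_contMDiff hφ fun p hp ↦ hφU p fun h ↦ hp (Or.inl h)
    refine ne_top_of_le_ne_top ?_ ((hΛle _ (hU.union hV).quasiOpen hVm).trans
      (iInf₂_le φ ⟨h1, hφ0⟩))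
    rw [h1.rayleigh_eq]
    obtain ⟨-, h2, h3, -⟩ := h1.1.exists_approx
    exact (ENNReal.div_lt_top (by simpa using (lintegral_sq_lt_top h3).ne)
      (lintegral_sq_pos h2 hφ0)).ne
  let δ : ℕ → ℝ≥0∞ := fun k ↦ ((k : ℝ≥0∞) + 1)⁻¹
  have hδ0 : ∀ k, 0 < δ k := fun k ↦ by simp [δ, ENNReal.add_eq_top]
  have hδ1 : ∀ k, δ k ≤ 1 := fun k ↦ ENNReal.inv_le_one.2 le_add_self
  have hδ : Filter.Tendsto δ Filter.atTop (𝓝 0) := by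
    have h1 := (ENNReal.tendsto_inv_nat_nhds_zero).comp (Filter.tendsto_add_atTop_nat 1)
    simpa [Function.comp_def, δ] using h1
  -- Normalized smooth approximations of a minimizing sequence.
  have hmin : ∀ k, ∃ ψ v : M → ℝ, ContMDiff (𝓡 n) 𝓘(ℝ, ℝ) ∞ ψ ∧ AEStronglyMeasurable v (vol n M) ∧
      (∫⁻ p, ‖v p‖ₑ ^ 2 ∂(vol n M) = 1) ∧ vol n M {p | v p ≠ 0} ≤ ENNReal.ofReal m ∧
      (∫⁻ p, ‖ψ p - v p‖ₑ ^ 2 ∂(vol n M) ≤ δ k) ∧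
      ∫⁻ p, ‖grad n ψ p‖ₑ ^ 2 ∂(vol n M) ≤ Λ + δ k := by
    intro k
    obtain ⟨Ω, hΩ⟩ := iInf_lt_iff.1 (ENNReal.lt_add_right hΛ (hδ0 k).ne')
    obtain ⟨⟨hΩq, hΩm⟩, hΩ⟩ := iInf_lt_iff.1 hΩ
    obtain ⟨u, hu⟩ := iInf_lt_iff.1 hΩ
    obtain ⟨⟨huΩ, hu0⟩, hu⟩ := iInf_lt_iff.1 hu
    obtain ⟨ψ, v, h1, h2, h3, h4, h5, h6⟩ := exists_smooth_near_of_rayleigh_lt huΩ hu0 hu (hδ0 k)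
    refine ⟨ψ, v, h1, h2, h3, ?_, h5, h6⟩
    rw [← hΩm]
    refine measure_mono_ae ?_
    filter_upwards [h4] with p hp hvp
    by_contra h
    exact hvp (hp h)
  choose ψ v hψ hvm hv1 hvol hψv hE using hmin
  have hψm : ∀ k, AEStronglyMeasurable (ψ k) (vol n M) := fun k ↦
    (hψ k).continuous.aestronglyMeasurable
  have hψ4 : ∀ k, ∫⁻ p, ‖ψ k p‖ₑ ^ 2 ∂(vol n M) ≤ 4 := by
    intro k
    have h1 : ∫⁻ p, ‖ψ k p‖ₑ ^ 2 ∂(vol n M) ≤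
        ∫⁻ p, 2 * (‖ψ k p - v k p‖ₑ ^ 2 + ‖v k p‖ₑ ^ 2) ∂(vol n M) := by
      refine lintegral_mono fun p ↦ le_trans (pow_le_pow_left' ?_ 2) (enn_add_sq_le _ _)
      simpa using enorm_add_le (ψ k p - v k p) (v k p)
    refine h1.trans ?_
    rw [lintegral_const_mul' _ _ (by simp), lintegral_add_right' _ ((hvm k).enorm.pow_const 2), hv1]
    refine (mul_le_mul_right (add_le_add_left ((hψv k).trans (hδ1 k)) 1) 2).trans_eq (by norm_num)
  obtain ⟨σ, u, hσ, hu2, hlim⟩ := exists_subseq_tendsto_L2 hψ (C := 4 + (Λ + 1).toNNReal)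
    (fun k ↦ (hψ4 k).trans (by simp)) (fun k ↦ (hE k).trans (by
      rw [ENNReal.coe_add, ENNReal.coe_toNNReal (by finiteness)]
      exact (add_le_add_right (hδ1 k) _).trans le_add_self))
  have hδσ : Filter.Tendsto (fun k ↦ δ (σ k)) Filter.atTop (𝓝 0) := hδ.comp hσ.tendsto_atTop
  have hvlim : Filter.Tendsto (fun k ↦ ∫⁻ p, ‖v (σ k) p - u p‖ₑ ^ 2 ∂(vol n M))
      Filter.atTop (𝓝 0) := by
    have h1 := ENNReal.Tendsto.const_mul (a := 2) (hδσ.add hlim) (Or.inr (by simp))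
    rw [add_zero, mul_zero] at h1
    refine tendsto_of_tendsto_of_tendsto_of_le_of_le tendsto_const_nhds h1
      (fun _ ↦ zero_le) fun k ↦ ?_
    have h2 : ∫⁻ p, ‖v (σ k) p - u p‖ₑ ^ 2 ∂(vol n M) ≤
        ∫⁻ p, 2 * (‖ψ (σ k) p - v (σ k) p‖ₑ ^ 2 + ‖ψ (σ k) p - u p‖ₑ ^ 2) ∂(vol n M) := by
      refine lintegral_mono fun p ↦ le_trans (pow_le_pow_left' ?_ 2) (enn_add_sq_le _ _)
      rw [enorm_sub_rev (ψ (σ k) p) (v (σ k) p)]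
      simpa using enorm_add_le (v (σ k) p - ψ (σ k) p) (ψ (σ k) p - u p)
    refine h2.trans ?_
    have h3 : AEMeasurable (fun p ↦ ‖ψ (σ k) p - u p‖ₑ ^ 2) (vol n M) :=
      ((hψm (σ k)).sub hu2.1).enorm.pow_const 2
    rw [lintegral_const_mul' _ _ (by simp), lintegral_add_right' _ h3]
    exact mul_le_mul_right (add_le_add_left (hψv _) _) 2
  have hu1 : ∫⁻ p, ‖u p‖ₑ ^ 2 ∂(vol n M) = 1 := by
    have h1 := tendsto_lintegral_enorm_sq (fun k ↦ hvm (σ k)) hu2.1 hvlim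
    simp only [hv1] at h1
    exact tendsto_nhds_unique h1 tendsto_const_nhds
  have huvol : vol n M {p | u p ≠ 0} ≤ ENNReal.ofReal m := by
    obtain ⟨τ, -, hae⟩ := exists_seq_tendsto_ae_of_lintegral (fun k ↦ hvm (σ k)) hu2.1 hvlim
    exact measure_ne_zero_le_of_tendsto (fun k ↦ hvol (σ (τ k))) hae
  obtain ⟨φ, w, X, hφ, hwu, hX, hw2, hX2, hqc, hl1, hl2, hXΛ⟩ :=
    exists_h1_limit_of_energy_le (fun k ↦ hψ (σ k)) hu2 hlim hΛ hδσ fun k ↦ hE (σ k)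
  have hw1 : ∫⁻ p, ‖w p‖ₑ ^ 2 ∂(vol n M) = 1 := by
    rw [← hu1]
    refine lintegral_congr_ae ?_
    filter_upwards [hwu] with p hp
    rw [hp]
  have hwvol : vol n M {p | w p ≠ 0} ≤ ENNReal.ofReal m := by
    refine le_trans (measure_mono_ae ?_) huvol
    filter_upwards [hwu] with p hp hwp
    exact fun h ↦ hwp (hp.trans h)
  -- The set `{w ≠ 0}` is quasi-open and has volume at most `m`; it remains to enlarge it.
  obtain ⟨V, hV, hVm⟩ := exists_isOpen_vol_union_eq hn0 hwvol hmM.le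
  have hqo : QuasiOpen n ({p | w p ≠ 0} ∪ V) := hqc.quasiOpen_ne_zero.union_isOpen hV
  have hmem : MemH10On n ({p | w p ≠ 0} ∪ V) w := by
    refine (memH10_of_tendsto hφ hX hw2 hX2 hl1 hl2).memH10On hqc fun p hp ↦ ?_
    by_contra h
    exact hp (Or.inl h)
  have hw0 : ¬ w =ᵐ[vol n M] 0 := by
    intro h
    have h1 : ∫⁻ p, ‖w p‖ₑ ^ 2 ∂(vol n M) = 0 := by
      rw [lintegral_congr_ae (g := fun _ ↦ 0) ?_, lintegral_zero]
      filter_upwards [h] with p hp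
      simp [hp]
    rw [hw1] at h1
    exact one_ne_zero h1
  have hray : rayleigh n ({p | w p ≠ 0} ∪ V) w ≤ Λ := by
    rw [hmem.rayleigh_eq, hw1, div_one]
    refine le_of_eq_of_le (lintegral_congr_ae ?_) hXΛ
    filter_upwards [hX.weakGrad_ae_eq] with p hp
    rw [hp]
  have hle : lambda1 n ({p | w p ≠ 0} ∪ V) ≤ rayleigh n ({p | w p ≠ 0} ∪ V) w :=
    iInf₂_le w ⟨hmem, hw0⟩
  exact ⟨{p | w p ≠ 0} ∪ V, hqo, hVm,
    ⟨w, hmem, hw0, le_antisymm (hray.trans (hΛle _ hqo hVm)) hle⟩,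
    (hle.trans hray).trans_lt hΛ.lt_top, fun Ω h1 h2 ↦ (hle.trans hray).trans (hΛle Ω h1 h2)⟩
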